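/- A substring consistent equivalence relation (SCER) is an equivalence relation $\approx$ on strings such that $X\approx Y$ implies $|X|=|Y|$ and $X[i\mathinner{.\,.}j]\approx Y[i\mathinner{.\,.}j]$ for all $1\le i\le j\le |X|$. A function $\mathcal E$ from strings to $\mathbb Z$ is an encoding function for $\approx$ if, for all strings $X,Y$, \[X\approx Y\iff |X|=|Y|\ \text{ and }\ \mathcal E(X[1\mathinner{.\,.}i])=\mathcal E(Y[1\mathinner{.\,.}i])\ \text{ for all } 1\le i\le |X|.\] An $\approx$-square is a string $XY$ with $X\approx Y$. For a string $T$ of length $n$ and $1\le p\le n/2$, let \[\mathsf{Squares}^{\approx}_p=\{\,i\in[1\mathinner{.\,.}n-2p+1] : T[i\mathinner{.\,.}i+2p)\text{ is an }\approx\text{-square}\,\}.\] The interval representation of a set $X$ of integers is $X=[i_1\mathinner{.\,.}j_1]\cup\dots\cup[i_t\mathinner{.\,.}j_t]$ with nonempty intervals and $j_s+1<i_{s+1}$ for $1\le s<t$; $t$ is its size. The model is the word RAM with word length $\Theta(\log n)$ on inputs of length $n$ (the constant factor may depend on the program), where arithmetic, comparison, bitwise, shift and memory operations on words take one step each. Let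 $c\ge 0$ be an integer; strings $T$ of length $n$ over the integer alphabet $[0\mathinner{.\,.}n^c]$ are considered. Let $\pi^{\mathcal E},\rho^{\mathcal E}:\mathbb N\to\mathbb N$ be such that, for some fixed preprocessing and query programs and every such $T$, the preprocessing of $T$ takes at most $\pi^{\mathcal E}(n)$ time, and after it $\mathcal E(T[i\mathinner{.\,.}j])$ is computed in at most $\rho^{\mathcal E}(n)$ time for any $1\le i\le j\le n$, in any sequence of such queries. **Lemma.** There is an absolute constant $C$ such that the following holds. 1. For every SCER $\approx$ on strings over any alphabet and every string $T$ of length $n$, the interval representations of the sets $\mathsf{Squares}^{\approx}_p$, taken over all $1\le p\le n/2$, have total size at most $C\,n\log n$. 2. For every SCER $\approx$ on strings of natural numbers, every encoding function $\mathcal E$ for $\approx$, and all $c,\pi^{\mathcal E},\rho^{\mathcal E}$ as above, there is a word-RAM program that, given any string $T$ of length $n$ over the integer alphabet $[0\mathinner{.\,.}n^c]$, computes the interval representations of the sets $\mathsf{Squares}^{\approx}_p$ for all $1\le p\le n/2$ in at most $C\,(\pi^{\mathcal E}(n)+n\,\rho^{\mathcal E}(n)+n\log n+1)$ time. (The summand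 $1$ matters only for $n\le 1$, where $n\log n=0$.) -/

import Mathlib

/-! Strings, substring consistent equivalence relations, squares, interval representations -/

/-- The factor `T[i .. j]` of a string, with positions counted from `1`, both ends included. -/
def factor {α : Type*} (T : List α) (i j : ℕ) : List α :=
  (T.take j).drop (i - 1)

/-- Substring consistent equivalence relations (SCERs) on strings over `α`. -/
structure IsSCER {α : Type*} (r : List α → List α → Prop) : Prop where
  equivalence : Equivalence r
  length_eq : ∀ X Y, r X Y → X.length = Y.length
  factors : ∀ X Y, r X Y → ∀ i j, 1 ≤ i → i ≤ j → j ≤ X.length →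
    r (factor X i j) (factor Y i j)

/-- `E` is an encoding function for `r`: two strings are equivalent iff they have the same length
and corresponding nonempty prefixes have the same value under `E`. -/
def IsEncoding {α : Type*} (r : List α → List α → Prop) (E : List α → ℤ) : Prop :=
  ∀ X Y, r X Y ↔
    (X.length = Y.length ∧
      ∀ i, 1 ≤ i → i ≤ X.length → E (factor X 1 i) = E (factor Y 1 i))

/-- A generalised square: a concatenation of two equivalent strings. -/
def IsGenSquare {α : Type*} (r : List α → List α → Prop) (S : List α) : Prop :=
  ∃ X Y, S = X ++ Y ∧ r X Y

/-- The set of start positions `i ∈ [1 .. n - 2p + 1]` of generalised squares of length `2p`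
in a string `T` of length `n`. -/
def Squares {α : Type*} (r : List α → List α → Prop) (T : List α) (p : ℕ) : Set ℕ :=
  {i | 1 ≤ i ∧ i + 2 * p ≤ T.length + 1 ∧ IsGenSquare r (factor T i (i + 2 * p - 1))}

/-- `L = [(i₁, j₁), …, (i_t, j_t)]` is an interval representation (of size `t = L.length`) of `X`:
`X` is the union of the nonempty intervals `[i_k .. j_k]`, and `j_k + 1 < i_{k+1}`. -/
structure IsIntervalRep (X : Set ℕ) (L : List (ℕ × ℕ)) : Prop where
  nonempty : ∀ I ∈ L, I.1 ≤ I.2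
  separated : L.IsChain (fun I J => I.2 + 1 < J.1)
  union : X = {x | ∃ I ∈ L, I.1 ≤ x ∧ x ≤ I.2}

/-! The word RAM -/

namespace WordRAM

/-- Unit-cost operations on machine words. -/
inductive Op
  | add | sub | mul | div | mod | eq | lt | and | or | xor | shl | shr

/-- Operations are total: division by `0` yields `0`, the remainder modulo `0` is the dividend,
and a negative shift amount counts as `0`. Comparisons yield `1` (true) or `0` (false). Bitwise
operations act on two's complement representations. -/
def Op.eval : Op → ℤ → ℤ → ℤ
  | .add, a, b => a + b
  | .sub, a, b => a - b
  | .mul, a, b => a * b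
  | .div, a, b => a / b
  | .mod, a, b => a % b
  | .eq, a, b => if a = b then 1 else 0
  | .lt, a, b => if a < b then 1 else 0
  | .and, a, b => Int.land a b
  | .or, a, b => Int.lor a b
  | .xor, a, b => Int.xor a b
  | .shl, a, b => a * 2 ^ b.toNat
  | .shr, a, b => a / 2 ^ b.toNat

/-- Programs. A program is a finite text, so it refers to finitely many registers `0, 1, 2, …` and
finitely many memory arrays `0, 1, 2, …`; registers and arrays are named statically, whereas
the address inside an array is a computed word. -/
inductive Prog
  /-- do nothing -/
  | skip
  /-- `x := v` -/
  | const (x : ℕ) (v : ℤ)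
  /-- `x := y` -/
  | copy (x y : ℕ)
  /-- `x := y o z` -/
  | op (o : Op) (x y z : ℕ)
  /-- `x := A[y]` -/
  | load (x A y : ℕ)
  /-- `A[x] := y` -/
  | store (A x y : ℕ)
  /-- `P; Q` -/
  | seq (P Q : Prog)
  /-- if `x ≠ 0` then `P` else `Q` -/
  | cond (x : ℕ) (P Q : Prog)
  /-- while `x ≠ 0` do `P` -/
  | loop (x : ℕ) (P : Prog)

/-- Memory contents: registers, and arrays with addresses in `ℕ`. -/
structure Store where
  reg : ℕ → ℤ
  arr : ℕ → ℕ → ℤ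

def Store.setReg (s : Store) (x : ℕ) (v : ℤ) : Store :=
  { s with reg := Function.update s.reg x v }

def Store.setArr (s : Store) (A a : ℕ) (v : ℤ) : Store :=
  { s with arr := Function.update s.arr A (Function.update (s.arr A) a v) }

/-- The integer `v` fits into a signed machine word with `w` bits and a sign. -/
def Fits (w : ℕ) (v : ℤ) : Prop := -(2 : ℤ) ^ w ≤ v ∧ v < 2 ^ w

/-- `Exec w P s t s'`: with word length `w`, program `P` started in `s` halts in `s'` after exactly
`t` steps. Each elementary instruction and each test of a conditional or loop is one
step. Every value put into a register has to fit into a machine word, and addresses have to be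
nonnegative: a program that violates this has no halting execution. -/
inductive Exec (w : ℕ) : Prog → Store → ℕ → Store → Prop
  | skip (s : Store) : Exec w .skip s 1 s
  | const (s : Store) (x : ℕ) (v : ℤ) (h : Fits w v) :
      Exec w (.const x v) s 1 (s.setReg x v)
  | copy (s : Store) (x y : ℕ) (h : Fits w (s.reg y)) :
      Exec w (.copy x y) s 1 (s.setReg x (s.reg y))
  | op (s : Store) (o : Op) (x y z : ℕ) (h : Fits w (o.eval (s.reg y) (s.reg z))) :
      Exec w (.op o x y z) s 1 (s.setReg x (o.eval (s.reg y) (s.reg z)))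
  | load (s : Store) (x A y a : ℕ) (ha : s.reg y = (a : ℤ)) (h : Fits w (s.arr A a)) :
      Exec w (.load x A y) s 1 (s.setReg x (s.arr A a))
  | store (s : Store) (A x y a : ℕ) (ha : s.reg x = (a : ℤ)) (h : Fits w (s.reg y)) :
      Exec w (.store A x y) s 1 (s.setArr A a (s.reg y))
  | seq (P Q : Prog) (s s' s'' : Store) (t t' : ℕ)
      (hP : Exec w P s t s') (hQ : Exec w Q s' t' s'') :
      Exec w (.seq P Q) s (t + t') s''
  | cond_true (x : ℕ) (P Q : Prog) (s s' : Store) (t : ℕ) (hx : s.reg x ≠ 0)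
      (hP : Exec w P s t s') : Exec w (.cond x P Q) s (1 + t) s'
  | cond_false (x : ℕ) (P Q : Prog) (s s' : Store) (t : ℕ) (hx : s.reg x = 0)
      (hQ : Exec w Q s t s') : Exec w (.cond x P Q) s (1 + t) s'
  | loop_exit (x : ℕ) (P : Prog) (s : Store) (hx : s.reg x = 0) :
      Exec w (.loop x P) s 1 s
  | loop_step (x : ℕ) (P : Prog) (s s' s'' : Store) (t t' : ℕ) (hx : s.reg x ≠ 0)
      (hP : Exec w P s t s') (hL : Exec w (.loop x P) s' t' s'') :
      Exec w (.loop x P) s (1 + t + t') s''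

/-- The word length `k · (⌊log₂ n⌋ + 1) = Θ(log n)` used on inputs of length `n`. -/
def wordLength (k n : ℕ) : ℕ := k * (Nat.log 2 n + 1)

/-- The input memory for a string `T` of length `n`: register `0` holds `n`, array `0` holds `T[i]`
at address `i` for `1 ≤ i ≤ n`, and all other registers and cells hold `0`. -/
def input (T : List ℕ) : Store where
  reg := fun x => if x = 0 then (T.length : ℤ) else 0
  arr := fun A a => if A = 0 ∧ 1 ≤ a then ((T.getD (a - 1) 0 : ℕ) : ℤ) else 0

/-- `T` is a string over the integer alphabet `[0 .. n ^ c]`, where `n` is its length. -/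
def IntegerAlphabet (c : ℕ) (T : List ℕ) : Prop := ∀ a ∈ T, a ≤ T.length ^ c

/-- Passing the query `(i, j)`: `i` goes to register `1` and `j` to register `2`. -/
def ask (s : Store) (i j : ℕ) : Store := (s.setReg 1 (i : ℤ)).setReg 2 (j : ℤ)

/-- The memory contents that can arise by running the preprocessing `pre` on the input `T` and then
answering any finite sequence of queries `(i, j)`, `1 ≤ i ≤ j ≤ n`, with `query`. -/
inductive Ready (w : ℕ) (pre query : Prog) (T : List ℕ) : Store → Prop
  | preprocessed (t : ℕ) (s : Store) (h : Exec w pre (input T) t s) : Ready w pre query T s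
  | queried (s s' : Store) (t i j : ℕ) (hs : Ready w pre query T s) (hi : 1 ≤ i) (hij : i ≤ j)
      (hj : j ≤ T.length) (h : Exec w query (ask s i j) t s') : Ready w pre query T s'

/-- For every string `T` of length `n` over the integer alphabet `[0 .. n ^ c]`, the program `pre`
halts within `π n` steps; after that, `query` computes `E (T[i .. j])` into register `0` within
`ρ n` steps, for any `1 ≤ i ≤ j ≤ n` and in any sequence of queries. -/
def ComputesFactorCodes (k c : ℕ) (E : List ℕ → ℤ) (π ρ : ℕ → ℕ) (pre query : Prog) : Prop :=
  ∀ T : List ℕ, IntegerAlphabet c T →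
    (∃ t s, Exec (wordLength k T.length) pre (input T) t s ∧ t ≤ π T.length) ∧
    ∀ s, Ready (wordLength k T.length) pre query T s →
      ∀ i j, 1 ≤ i → i ≤ j → j ≤ T.length →
        ∃ t s', Exec (wordLength k T.length) query (ask s i j) t s' ∧ t ≤ ρ T.length ∧
          s'.reg 0 = E (factor T i j)

/-- The list `L` of intervals is stored in `s` as entry `p`: cell `p` of array `1` holds an address
`a`, cell `p` of array `2` holds the size of `L`, and the left and the right ends of the
intervals are in consecutive cells of arrays `3` and `4`, respectively, from address `a` on. -/
def StoredAt (s : Store) (p : ℕ) (L : List (ℕ × ℕ)) : Prop :=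
  ∃ a : ℕ, s.arr 1 p = (a : ℤ) ∧ s.arr 2 p = (L.length : ℤ) ∧
    ∀ (m : ℕ) (hm : m < L.length),
      s.arr 3 (a + m) = ((L[m].1 : ℕ) : ℤ) ∧ s.arr 4 (a + m) = ((L[m].2 : ℕ) : ℤ)

end WordRAM

/-!
Fix a string `T` of length `n`. For each length `L`, equivalence of the factors `T[x .. x + L)` and
`T[y .. y + L)` is a partial equivalence relation `rel L` on positions, and `rel (L + 1) x y` implies
both `rel L x y` and `rel L (x + 1) (y + 1)` (`LevelSystem`). Position `i` starts a square of
period `p` iff `rel p i (i + p)` (`mem_squares_iff`).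

*Size of the representations.* If an interval of squares of period `p` ends at `i`, then `i` and
`i + p` are equivalent at level `p`, but not at level `p + 1`: otherwise `i + 1` would start a square
as well. The number of pairs `(i, p)` of this kind (`newPairs`) is bounded by a potential argument.
As the level decreases, classes are joined, and whenever `i` and `i + p` become equivalent, the class
of one of them at least doubles. For given `p`, each position occurs in at most two pairs, so the
sum over all positions of the logarithm of the class size pays for all pairs
(`LevelSystem.sum_card_newPairs_le`).

*Computing the forest.* Let `dep x` be the least level at which `x` is equivalent to no smaller
position, and `par x` the representative of `x` one level below. Then the representative of `x` at
level `L` is `x` if `dep x ≤ L`, and that of `par x` otherwise. This forest is built by inserting the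
positions one after the other. The shift property implies `dep i ≥ dep (i - 1) - 1`, and the class
where the descent for `i` may start is found by binary lifting from `par (i - 1) + 1`
(`climb_spec`). Therefore only `O(n)` codes are queried altogether (`buildForest_spec`). Branches are
found in a dictionary addressed by level, class and code; memory that is initially zero makes this
a plain array.

*Collecting the pairs.* Going down the levels from `n` to `1`, each position is joined to its parent
when the level falls below its depth. The smaller class is moved into the larger one, and each moved
member is tested against its two neighbours at distance `p`, which finds exactly the new pairs
(`collectPairs_spec`). The potential again bounds the time by `O(n log n)`.

*The intervals.* The new pairs contain all right ends of intervals, but also positions in the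
interior of an interval. The same computation for the reversed string, where the representatives of
the first forest serve as codes, yields a superset of the left ends. A new pair at `b` is a true right
end iff `b + 1` is not in the other set, and symmetrically (`LevelSystem.leftEnds_eq`,
`LevelSystem.rightEnds_eq`); matching left and right ends in increasing order gives the interval
representations (`isIntervalRep_zip`).

Programs are written in a small structured language above the word RAM; `HT` is a total-correctness
triple with a time bound, and loops are verified with invariants that contain a time budget. The
given programs for the codes run on an embedded store that occupies separate registers and arrays
(`HT.onExt`).
-/


/-! ### Level systems -/

/-- The abstract shape of the relations `T[x .. x + L) ≈ T[y .. y + L)` for a fixed string of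
length `n`: for each length `L` a partial equivalence relation on positions whose domain consists
of the positions `x` with `1 ≤ x` and `x + L ≤ n + 1`, compatible with deleting the last or
the first letter. -/
structure LevelSystem (n : ℕ) (rel : ℕ → ℕ → ℕ → Prop) : Prop where
  symm : ∀ {L x y}, rel L x y → rel L y x
  trans : ∀ {L x y z}, rel L x y → rel L y z → rel L x z
  valid : ∀ {L x y}, rel L x y → 1 ≤ x ∧ x + L ≤ n + 1
  refl : ∀ {L x}, 1 ≤ x → x + L ≤ n + 1 → rel L x x
  zero : ∀ {x y}, 1 ≤ x → x ≤ n + 1 → 1 ≤ y → y ≤ n + 1 → rel 0 x y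
  mono : ∀ {L x y}, rel (L + 1) x y → rel L x y
  shift : ∀ {L x y}, rel (L + 1) x y → rel L (x + 1) (y + 1)

/-- The level system of the reversed string. -/
def revRel (n : ℕ) (rel : ℕ → ℕ → ℕ → Prop) (L x y : ℕ) : Prop :=
  1 ≤ x ∧ x + L ≤ n + 1 ∧ 1 ≤ y ∧ y + L ≤ n + 1 ∧ rel L (n + 2 - L - x) (n + 2 - L - y)

/-- The least position equivalent to `x` at level `L`; it is `x` itself if `x` is outside of the
domain of level `L`. -/
noncomputable def rp (rel : ℕ → ℕ → ℕ → Prop) (L x : ℕ) : ℕ := sInf {y | y = x ∨ rel L x y}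

/-- The least level at which `x` is not equivalent to any smaller position. -/
noncomputable def dep (rel : ℕ → ℕ → ℕ → Prop) (x : ℕ) : ℕ := sInf {L | ∀ y < x, ¬ rel L x y}

/-- The least position equivalent to `x` at the deepest level at which `x` has a smaller equivalent
position; `0` if there is no such level. -/
noncomputable def par (rel : ℕ → ℕ → ℕ → Prop) (x : ℕ) : ℕ :=
  if dep rel x = 0 then 0 else rp rel (dep rel x - 1) x

namespace LevelSystem

variable {n : ℕ} {rel : ℕ → ℕ → ℕ → Prop}

theorem rev (h : LevelSystem n rel) : LevelSystem n (revRel n rel) where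
  symm := by
    rintro L x y ⟨h1, h2, h3, h4, h5⟩
    exact ⟨h3, h4, h1, h2, h.symm h5⟩
  trans := by
    rintro L x y z ⟨h1, h2, h3, h4, h5⟩ ⟨g1, g2, g3, g4, g5⟩
    exact ⟨h1, h2, g3, g4, h.trans h5 g5⟩
  valid := by
    rintro L x y ⟨h1, h2, -⟩
    exact ⟨h1, h2⟩
  refl := by
    intro L x h1 h2
    exact ⟨h1, h2, h1, h2, h.refl (by omega) (by omega)⟩
  zero := by
    intro x y h1 h2 h3 h4
    exact ⟨h1, by omega, h3, by omega, h.zero (by omega) (by omega) (by omega) (by omega)⟩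
  mono := by
    rintro L x y ⟨h1, h2, h3, h4, h5⟩
    refine ⟨h1, by omega, h3, by omega, ?_⟩
    have := h.shift h5
    rwa [show n + 2 - (L + 1) - x + 1 = n + 2 - L - x by omega,
      show n + 2 - (L + 1) - y + 1 = n + 2 - L - y by omega] at this
  shift := by
    rintro L x y ⟨h1, h2, h3, h4, h5⟩
    refine ⟨by omega, by omega, by omega, by omega, ?_⟩
    have := h.mono h5
    rwa [show n + 2 - (L + 1) - x = n + 2 - L - (x + 1) by omega,
      show n + 2 - (L + 1) - y = n + 2 - L - (y + 1) by omega] at this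

theorem mono_le (h : LevelSystem n rel) {L L' x y : ℕ} (hL : L ≤ L') (hr : rel L' x y) :
    rel L x y := by
  induction hL with
  | refl => exact hr
  | step _ ih => exact ih (h.mono hr)

theorem valid_right (h : LevelSystem n rel) {L x y : ℕ} (hr : rel L x y) :
    1 ≤ y ∧ y + L ≤ n + 1 := h.valid (h.symm hr)

theorem rp_mem (_h : LevelSystem n rel) (L x : ℕ) : rp rel L x = x ∨ rel L x (rp rel L x) :=
  Nat.sInf_mem (s := {y | y = x ∨ rel L x y}) ⟨x, Or.inl rfl⟩

theorem rp_le (_h : LevelSystem n rel) (L x : ℕ) : rp rel L x ≤ x :=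
  Nat.sInf_le (s := {y | y = x ∨ rel L x y}) (Or.inl rfl)

theorem rp_le_of_rel (_h : LevelSystem n rel) {L x y : ℕ} (hr : rel L x y) : rp rel L x ≤ y :=
  Nat.sInf_le (s := {y | y = x ∨ rel L x y}) (Or.inr hr)

theorem rp_eq_of_rel (h : LevelSystem n rel) {L x y : ℕ} (hr : rel L x y) :
    rp rel L x = rp rel L y := by
  apply le_antisymm
  · rcases h.rp_mem L y with e | e
    · rw [e]; exact h.rp_le_of_rel hr
    · exact h.rp_le_of_rel (h.trans hr e)
  · rcases h.rp_mem L x with e | e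
    · rw [e]; exact h.rp_le_of_rel (h.symm hr)
    · exact h.rp_le_of_rel (h.trans (h.symm hr) e)

theorem rp_eq_iff (h : LevelSystem n rel) {L x y : ℕ} :
    rp rel L x = rp rel L y ↔ x = y ∨ rel L x y := by
  constructor
  · intro e
    rcases h.rp_mem L x with e1 | e1 <;> rcases h.rp_mem L y with e2 | e2
    · left; omega
    · right; rw [← e, e1] at e2; exact h.symm e2
    · right; rw [e, e2] at e1; exact e1
    · right; rw [e] at e1; exact h.trans e1 (h.symm e2)
  · rintro (rfl | e)
    · rfl
    · exact h.rp_eq_of_rel e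

theorem rel_rp (h : LevelSystem n rel) {L x : ℕ} (h1 : 1 ≤ x) (h2 : x + L ≤ n + 1) :
    rel L x (rp rel L x) := by
  rcases h.rp_mem L x with e | e
  · rw [e]; exact h.refl h1 h2
  · exact e

theorem one_le_rp (h : LevelSystem n rel) {L x : ℕ} (hx : 1 ≤ x) : 1 ≤ rp rel L x := by
  rcases h.rp_mem L x with e | e
  · omega
  · exact (h.valid_right e).1

theorem dep_le_iff (h : LevelSystem n rel) {x L : ℕ} :
    dep rel x ≤ L ↔ ∀ y < x, ¬ rel L x y := by
  constructor
  · intro hL y hy hr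
    have hne : {L | ∀ y < x, ¬ rel L x y}.Nonempty :=
      ⟨n + 2, fun y _ hr => by have := h.valid hr; omega⟩
    exact Nat.sInf_mem hne y hy (h.mono_le hL hr)
  · intro hL
    exact Nat.sInf_le (s := {L | ∀ y < x, ¬ rel L x y}) hL

theorem lt_dep_iff (h : LevelSystem n rel) {x L : ℕ} :
    L < dep rel x ↔ ∃ y < x, rel L x y := by
  rw [← not_le, h.dep_le_iff]; push Not; rfl

theorem rp_eq_self_iff (h : LevelSystem n rel) {x L : ℕ} : rp rel L x = x ↔ dep rel x ≤ L := by
  rw [h.dep_le_iff]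
  constructor
  · intro e y hy hr
    have := h.rp_le_of_rel hr
    omega
  · intro hL
    rcases h.rp_mem L x with e | e
    · exact e
    · by_contra hne
      exact hL _ (lt_of_le_of_ne (h.rp_le L x) hne) e

theorem dep_rp_le (h : LevelSystem n rel) (x L : ℕ) : dep rel (rp rel L x) ≤ L := by
  rw [← h.rp_eq_self_iff]
  rcases h.rp_mem L x with e | e
  · rw [e, e]
  · exact (h.rp_eq_of_rel e).symm

theorem par_of_pos (_h : LevelSystem n rel) {x : ℕ} (hx : 0 < dep rel x) :
    par rel x = rp rel (dep rel x - 1) x := by rw [par, if_neg (by omega)]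

theorem par_lt (h : LevelSystem n rel) {x : ℕ} (hx : 0 < dep rel x) : par rel x < x := by
  rw [h.par_of_pos hx]
  refine lt_of_le_of_ne (h.rp_le _ x) fun e => ?_
  rw [h.rp_eq_self_iff] at e
  omega

theorem rel_par (h : LevelSystem n rel) {x : ℕ} (hx : 0 < dep rel x) :
    rel (dep rel x - 1) x (par rel x) := by
  rcases h.rp_mem (dep rel x - 1) x with e | e
  · have := h.par_lt hx
    rw [h.par_of_pos hx] at this
    omega
  · rwa [h.par_of_pos hx]

theorem one_le_par (h : LevelSystem n rel) {x : ℕ} (hx : 0 < dep rel x) : 1 ≤ par rel x :=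
  (h.valid_right (h.rel_par hx)).1

theorem dep_par_lt (h : LevelSystem n rel) {x : ℕ} (hx : 0 < dep rel x) :
    dep rel (par rel x) < dep rel x := by
  have := h.dep_rp_le x (dep rel x - 1)
  rw [← h.par_of_pos hx] at this
  omega

theorem rp_par (h : LevelSystem n rel) {L x : ℕ} (hx : L < dep rel x) :
    rp rel L (par rel x) = rp rel L x :=
  (h.rp_eq_of_rel (h.mono_le (by omega) (h.rel_par (by omega)))).symm

theorem dep_one (h : LevelSystem n rel) : dep rel 1 = 0 := by
  rw [← Nat.le_zero, h.dep_le_iff]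
  intro y hy hr
  have := h.valid_right hr
  omega

theorem dep_zero (h : LevelSystem n rel) : dep rel 0 = 0 := by
  rw [← Nat.le_zero, h.dep_le_iff]
  intro y hy
  omega

theorem dep_pos (h : LevelSystem n rel) {x : ℕ} (hx : 2 ≤ x) (hx' : x ≤ n) : 0 < dep rel x :=
  h.lt_dep_iff.2 ⟨1, by omega, h.zero (by omega) (by omega) le_rfl (by omega)⟩

theorem dep_le (h : LevelSystem n rel) {x : ℕ} (hx : x ≤ n + 1) : dep rel x ≤ n + 2 - x := by
  rw [h.dep_le_iff]
  intro y _ hr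
  have := h.valid hr
  omega

theorem dep_le_succ (h : LevelSystem n rel) (x : ℕ) : dep rel x ≤ n + 1 := by
  rw [h.dep_le_iff]
  intro y hy hr
  have := h.valid hr
  have := h.valid_right hr
  omega

/-! ### Counting the pairs that become equivalent -/

end LevelSystem

open Classical in
/-- The size of the class of `x` among the positions `1, …, n`, for the partition given by the
fibres of `F`. -/
noncomputable def classSize (n : ℕ) (F : ℕ → ℕ) (x : ℕ) : ℕ :=
  ((Finset.Icc 1 n).filter fun y => F y = F x).card

/-- The sum of the logarithms of the class sizes, the potential of small-to-large merging. -/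
noncomputable def potential (n : ℕ) (F : ℕ → ℕ) : ℕ :=
  ∑ x ∈ Finset.Icc 1 n, Nat.log 2 (classSize n F x)

theorem classSize_pos {n : ℕ} {F : ℕ → ℕ} {x : ℕ} (hx : x ∈ Finset.Icc 1 n) :
    0 < classSize n F x := by
  classical
  exact Finset.card_pos.2 ⟨x, by simpa using hx⟩

theorem classSize_le {n : ℕ} {F : ℕ → ℕ} {x : ℕ} : classSize n F x ≤ n := by
  classical
  refine (Finset.card_filter_le _ _).trans ?_
  simp

theorem potential_le (n : ℕ) (F : ℕ → ℕ) : potential n F ≤ n * Nat.log 2 n := by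
  refine (Finset.sum_le_card_nsmul _ _ (Nat.log 2 n) fun x _ =>
    Nat.log_mono_right classSize_le).trans ?_
  simp

/-- When two classes are joined, one of the two at least doubles. -/
theorem log_classSize_join {n : ℕ} {F F' : ℕ → ℕ} {x y : ℕ}
    (hF : ∀ a ∈ Finset.Icc 1 n, ∀ b ∈ Finset.Icc 1 n, F a = F b → F' a = F' b)
    (hx : x ∈ Finset.Icc 1 n) (hy : y ∈ Finset.Icc 1 n) (hne : F x ≠ F y) (he : F' x = F' y)
    (hle : classSize n F x ≤ classSize n F y) :
    Nat.log 2 (classSize n F x) + 1 ≤ Nat.log 2 (classSize n F' x) := by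
  classical
  have h2 : classSize n F x * 2 ≤ classSize n F' x := by
    have hd : Disjoint ((Finset.Icc 1 n).filter fun z => F z = F x)
        ((Finset.Icc 1 n).filter fun z => F z = F y) := by
      rw [Finset.disjoint_left]
      intro z hz hz'
      simp only [Finset.mem_filter] at hz hz'
      exact hne (hz.2.symm.trans hz'.2)
    have hsub : ((Finset.Icc 1 n).filter fun z => F z = F x) ∪
        ((Finset.Icc 1 n).filter fun z => F z = F y) ⊆
        (Finset.Icc 1 n).filter fun z => F' z = F' x := by
      intro z hz
      simp only [Finset.mem_union, Finset.mem_filter] at hz ⊢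
      rcases hz with hz | hz
      · exact ⟨hz.1, hF _ hz.1 _ hx hz.2⟩
      · exact ⟨hz.1, (hF _ hz.1 _ hy hz.2).trans he.symm⟩
    have := Finset.card_le_card hsub
    rw [Finset.card_union_of_disjoint hd] at this
    unfold classSize at hle ⊢
    omega
  rw [← Nat.log_mul_base (by norm_num) (classSize_pos hx).ne']
  exact Nat.log_mono_right h2

theorem classSize_mono {n : ℕ} {F F' : ℕ → ℕ}
    (hF : ∀ a ∈ Finset.Icc 1 n, ∀ b ∈ Finset.Icc 1 n, F a = F b → F' a = F' b)
    {x : ℕ} (hx : x ∈ Finset.Icc 1 n) : classSize n F x ≤ classSize n F' x := by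
  classical
  refine Finset.card_le_card fun z hz => ?_
  simp only [Finset.mem_filter] at hz ⊢
  exact ⟨hz.1, hF _ hz.1 _ hx hz.2⟩

open Classical in
/-- The positions `x` for which `x` and `x + p` are equivalent at level `p` but not at
level `p + 1`. -/
noncomputable def newPairs (n : ℕ) (rel : ℕ → ℕ → ℕ → Prop) (p : ℕ) : Finset ℕ :=
  (Finset.Icc 1 n).filter fun x => rel p x (x + p) ∧ ¬ rel (p + 1) x (x + p)

namespace LevelSystem

variable {n : ℕ} {rel : ℕ → ℕ → ℕ → Prop}

theorem mem_newPairs (h : LevelSystem n rel) {p x : ℕ} (hp : 1 ≤ p) :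
    x ∈ newPairs n rel p ↔ rel p x (x + p) ∧ ¬ rel (p + 1) x (x + p) := by
  classical
  rw [newPairs, Finset.mem_filter, Finset.mem_Icc]
  refine ⟨fun h => h.2, fun hx => ⟨?_, hx⟩⟩
  have := h.valid hx.1
  omega

theorem rp_mono (h : LevelSystem n rel) {L x y : ℕ} (e : rp rel (L + 1) x = rp rel (L + 1) y) :
    rp rel L x = rp rel L y := by
  rw [h.rp_eq_iff] at e ⊢
  exact e.imp_right h.mono

/-- Each new pair is paid for by one of its positions, whose class at least doubles from level `p + 1`
to level `p`; each position pays for at most two pairs. -/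
theorem card_newPairs_le (h : LevelSystem n rel) {p : ℕ} (hp : 1 ≤ p) :
    (newPairs n rel p).card + 2 * potential n (rp rel (p + 1)) ≤ 2 * potential n (rp rel p) := by
  classical
  let gain : ℕ → ℕ := fun y =>
    Nat.log 2 (classSize n (rp rel p) y) - Nat.log 2 (classSize n (rp rel (p + 1)) y)
  have hF : ∀ a ∈ Finset.Icc 1 n, ∀ b ∈ Finset.Icc 1 n,
      rp rel (p + 1) a = rp rel (p + 1) b → rp rel p a = rp rel p b := fun a _ b _ e => h.rp_mono e
  have hgain : ∀ y ∈ Finset.Icc 1 n, Nat.log 2 (classSize n (rp rel (p + 1)) y) + gain y =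
      Nat.log 2 (classSize n (rp rel p) y) := fun y hy => by
    have := Nat.log_mono_right (b := 2) (classSize_mono hF hy)
    simp only [gain]
    omega
  have hmem : ∀ x ∈ newPairs n rel p, x ∈ Finset.Icc 1 n ∧ x + p ∈ Finset.Icc 1 n ∧
      1 ≤ gain x + gain (x + p) := by
    intro x hx
    rw [h.mem_newPairs hp] at hx
    have v1 := h.valid hx.1
    have v2 := h.valid_right hx.1
    have hx1 : x ∈ Finset.Icc 1 n := Finset.mem_Icc.2 (by omega)
    have hx2 : x + p ∈ Finset.Icc 1 n := Finset.mem_Icc.2 (by omega)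
    refine ⟨hx1, hx2, ?_⟩
    have hne : rp rel (p + 1) x ≠ rp rel (p + 1) (x + p) := by
      rw [Ne, h.rp_eq_iff]
      rintro (e | e)
      · omega
      · exact hx.2 e
    have he : rp rel p x = rp rel p (x + p) := h.rp_eq_of_rel hx.1
    rcases le_total (classSize n (rp rel (p + 1)) x) (classSize n (rp rel (p + 1)) (x + p))
      with hle | hle
    · have := log_classSize_join hF hx1 hx2 hne he hle
      have := hgain x hx1
      omega
    · have := log_classSize_join hF hx2 hx1 hne.symm he.symm hle
      have := hgain _ hx2
      omega
  have h1 : (newPairs n rel p).card ≤ ∑ x ∈ newPairs n rel p, (gain x + gain (x + p)) := by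
    rw [Finset.card_eq_sum_ones]
    exact Finset.sum_le_sum fun x hx => (hmem x hx).2.2
  have h2 : ∑ x ∈ newPairs n rel p, gain x ≤ ∑ x ∈ Finset.Icc 1 n, gain x :=
    Finset.sum_le_sum_of_subset fun x hx => (hmem x hx).1
  have h3 : ∑ x ∈ newPairs n rel p, gain (x + p) ≤ ∑ x ∈ Finset.Icc 1 n, gain x := by
    rw [← Finset.sum_image (f := gain) (g := fun x => x + p) (fun a _ b _ e => by simpa using e)]
    refine Finset.sum_le_sum_of_subset fun y hy => ?_
    obtain ⟨x, hx, rfl⟩ := Finset.mem_image.1 hy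
    exact (hmem x hx).2.1
  have h4 : potential n (rp rel (p + 1)) + ∑ x ∈ Finset.Icc 1 n, gain x =
      potential n (rp rel p) := by
    rw [potential, potential, ← Finset.sum_add_distrib]
    exact Finset.sum_congr rfl hgain
  rw [Finset.sum_add_distrib] at h1
  omega

/-- Over all levels, at most `2 n log n` pairs `(x, x + p)` become equivalent exactly at level
`p`. -/
theorem sum_card_newPairs_le (h : LevelSystem n rel) (m : ℕ) :
    ∑ p ∈ Finset.Icc 1 m, (newPairs n rel p).card ≤ 2 * (n * Nat.log 2 n) := by
  have key : ∀ m, ∑ p ∈ Finset.Icc 1 m, (newPairs n rel p).card +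
      2 * potential n (rp rel (m + 1)) ≤ 2 * potential n (rp rel 1) := by
    intro m
    induction m with
    | zero => simp
    | succ m ih =>
      rw [Finset.sum_Icc_succ_top (by omega)]
      have := h.card_newPairs_le (p := m + 1) (by omega)
      omega
  have := key m
  have := potential_le n (rp rel 1)
  omega

/-- The new pairs of the reversed string, as positions `a` of the string: squares of period `p` that
cannot be extended to the left at level `p + 1`. -/
theorem newPairs_rev_iff (h : LevelSystem n rel) {p a : ℕ} (hp : 1 ≤ p) :
    (∃ i, i ∈ newPairs n (revRel n rel) p ∧ i + 2 * p + a = n + 2) ↔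
      rel p a (a + p) ∧ (a = 1 ∨ ¬ rel (p + 1) (a - 1) (a - 1 + p)) := by
  constructor
  · rintro ⟨i, hi, ha⟩
    rw [h.rev.mem_newPairs hp] at hi
    obtain ⟨⟨h1, h2, h3, h4, h5⟩, h6⟩ := hi
    rw [show n + 2 - p - i = a + p by omega, show n + 2 - p - (i + p) = a by omega] at h5
    refine ⟨h.symm h5, ?_⟩
    by_contra hc
    push Not at hc
    have v := h.valid hc.2
    have v' := h.valid_right hc.2
    refine h6 ⟨h1, by omega, by omega, by omega, ?_⟩
    rw [show n + 2 - (p + 1) - i = a - 1 + p by omega,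
      show n + 2 - (p + 1) - (i + p) = a - 1 by omega]
    exact h.symm hc.2
  · rintro ⟨h1, h2⟩
    have v := h.valid h1
    have v' := h.valid_right h1
    refine ⟨n + 2 - 2 * p - a, ?_, by omega⟩
    rw [h.rev.mem_newPairs hp]
    refine ⟨⟨by omega, by omega, by omega, by omega, ?_⟩, ?_⟩
    · rw [show n + 2 - p - (n + 2 - 2 * p - a) = a + p by omega,
        show n + 2 - p - (n + 2 - 2 * p - a + p) = a by omega]
      exact h.symm h1
    · rintro ⟨g1, g2, g3, g4, g5⟩
      rw [show n + 2 - (p + 1) - (n + 2 - 2 * p - a) = a - 1 + p by omega,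
        show n + 2 - (p + 1) - (n + 2 - 2 * p - a + p) = a - 1 by omega] at g5
      rcases h2 with h2 | h2
      · omega
      · exact h2 (h.symm g5)

end LevelSystem

/-! ### Strings, squares and interval representations -/

section Strings

variable {α : Type*}

theorem length_factor (T : List α) {i j : ℕ} (hj : j ≤ T.length) :
    (factor T i j).length = j - (i - 1) := by
  simp [factor, hj]

theorem factor_factor (T : List α) {x y i j : ℕ} (hx : 1 ≤ x) (hi : 1 ≤ i) (hj : x + j ≤ y + 1) :
    factor (factor T x y) i j = factor T (x + i - 1) (x + j - 1) := by
  simp only [factor]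
  rw [List.take_drop, List.drop_drop, List.take_take]
  congr 2 <;> omega

/-- Equivalence of the factors of length `L` of `T` that start at `x` and at `y`. -/
def factorRel (r : List α → List α → Prop) (T : List α) (L x y : ℕ) : Prop :=
  1 ≤ x ∧ x + L ≤ T.length + 1 ∧ 1 ≤ y ∧ y + L ≤ T.length + 1 ∧
    r (factor T x (x + L - 1)) (factor T y (y + L - 1))

theorem IsSCER.levelSystem {r : List α → List α → Prop} (hr : IsSCER r) (T : List α) :
    LevelSystem T.length (factorRel r T) where
  symm := by
    rintro L x y ⟨h1, h2, h3, h4, h5⟩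
    exact ⟨h3, h4, h1, h2, hr.equivalence.symm h5⟩
  trans := by
    rintro L x y z ⟨h1, h2, h3, h4, h5⟩ ⟨g1, g2, g3, g4, g5⟩
    exact ⟨h1, h2, g3, g4, hr.equivalence.trans h5 g5⟩
  valid := by
    rintro L x y ⟨h1, h2, -⟩
    exact ⟨h1, h2⟩
  refl := fun h1 h2 => ⟨h1, h2, h1, h2, hr.equivalence.refl _⟩
  zero := by
    intro x y h1 h2 h3 h4
    refine ⟨h1, h2, h3, h4, ?_⟩
    have e : ∀ z, factor T z (z + 0 - 1) = [] := fun z => by simp [factor]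
    rw [e, e]
    exact hr.equivalence.refl _
  mono := by
    rintro L x y ⟨h1, h2, h3, h4, h5⟩
    refine ⟨h1, by omega, h3, by omega, ?_⟩
    rcases Nat.eq_zero_or_pos L with rfl | hL
    · have e : ∀ z, factor T z (z + 0 - 1) = [] := fun z => by simp [factor]
      rw [e, e]
      exact hr.equivalence.refl _
    · have := hr.factors _ _ h5 1 L le_rfl hL (by rw [length_factor _ (by omega)]; omega)
      rwa [factor_factor _ h1 le_rfl (by omega), factor_factor _ h3 le_rfl (by omega)] at this
  shift := by
    rintro L x y ⟨h1, h2, h3, h4, h5⟩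
    refine ⟨by omega, by omega, by omega, by omega, ?_⟩
    rcases Nat.eq_zero_or_pos L with rfl | hL
    · have e : ∀ z, factor T z (z + 0 - 1) = [] := fun z => by simp [factor]
      rw [e, e]
      exact hr.equivalence.refl _
    · have := hr.factors _ _ h5 2 (L + 1) (by omega) (by omega)
        (by rw [length_factor _ (by omega)]; omega)
      rwa [factor_factor _ h1 (by omega) (by omega), factor_factor _ h3 (by omega) (by omega),
        show x + 2 - 1 = x + 1 by omega, show y + 2 - 1 = y + 1 by omega,
        show x + (L + 1) - 1 = x + 1 + L - 1 by omega,
        show y + (L + 1) - 1 = y + 1 + L - 1 by omega] at this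

theorem mem_squares_iff {r : List α → List α → Prop} (hr : IsSCER r) (T : List α) {p i : ℕ}
    (hp : 1 ≤ p) : i ∈ Squares r T p ↔ factorRel r T p i (i + p) := by
  have key : ∀ i, 1 ≤ i → i + 2 * p ≤ T.length + 1 →
      (IsGenSquare r (factor T i (i + 2 * p - 1)) ↔
        r (factor T i (i + p - 1)) (factor T (i + p) (i + p + p - 1))) := by
    intro i h1 h2
    have e1 : (factor T i (i + 2 * p - 1)).take p = factor T i (i + p - 1) := by
      have := factor_factor T (x := i) (y := i + 2 * p - 1) (i := 1) (j := p) h1 le_rfl (by omega)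
      simpa [factor] using this
    have e2 : (factor T i (i + 2 * p - 1)).drop p = factor T (i + p) (i + p + p - 1) := by
      simp only [factor, List.drop_drop]
      congr 2 <;> omega
    have e3 : (factor T i (i + 2 * p - 1)).length = 2 * p := by
      rw [length_factor _ (by omega)]; omega
    constructor
    · rintro ⟨X, Y, hS, hXY⟩
      have hl := hr.length_eq _ _ hXY
      have hX : X.length = p := by
        rw [hS, List.length_append] at e3; omega
      rw [← e1, ← e2, hS, List.take_left' hX, List.drop_left' hX]
      exact hXY
    · intro h
      rw [← e1, ← e2] at h
      exact ⟨_, _, (List.take_append_drop p _).symm, h⟩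
  simp only [Squares, Set.mem_ofPred_eq, factorRel]
  constructor
  · rintro ⟨h1, h2, h3⟩
    exact ⟨h1, by omega, by omega, by omega, (key i h1 h2).1 h3⟩
  · rintro ⟨h1, h2, h3, h4, h5⟩
    exact ⟨h1, by omega, (key i h1 (by omega)).2 h5⟩

end Strings

theorem IsIntervalRep.pairwise {X : Set ℕ} {L : List (ℕ × ℕ)} (h : IsIntervalRep X L) :
    L.Pairwise fun I J => I.2 + 1 < J.1 := by
  have : ∀ L : List (ℕ × ℕ), (∀ I ∈ L, I.1 ≤ I.2) → L.IsChain (fun I J => I.2 + 1 < J.1) →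
      L.Pairwise fun I J => I.2 + 1 < J.1 := by
    intro L
    induction L with
    | nil => intros; exact List.Pairwise.nil
    | cons I L ih =>
      intro hne hc
      have hL := ih (fun J hJ => hne J (List.mem_cons_of_mem _ hJ)) hc.tail
      refine List.Pairwise.cons (fun K hK => ?_) hL
      cases L with
      | nil => cases hK
      | cons J L =>
        rw [List.isChain_cons_cons] at hc
        rcases List.mem_cons.1 hK with rfl | hK'
        · exact hc.1
        · have h1 := (List.pairwise_cons.1 hL).1 K hK'
          have h2 := hne J (by simp)
          have h3 := hc.1
          omega
  exact this L h.nonempty h.separated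

theorem IsIntervalRep.length_le {X : Set ℕ} {L : List (ℕ × ℕ)} (h : IsIntervalRep X L)
    (S : Finset ℕ) (hS : ∀ x ∈ X, x + 1 ∉ X → x ∈ S) : L.length ≤ S.card := by
  classical
  have hp := h.pairwise
  have hnd : (L.map Prod.snd).Nodup := by
    rw [List.Nodup, List.pairwise_map]
    refine hp.imp_of_mem fun {I J} hI hJ hIJ => ?_
    have := h.nonempty J hJ
    omega
  have hsub : (L.map Prod.snd).toFinset ⊆ S := by
    intro x hx
    rw [List.mem_toFinset, List.mem_map] at hx
    obtain ⟨I, hI, rfl⟩ := hx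
    have hI' := h.nonempty I hI
    apply hS
    · rw [h.union]; exact ⟨I, hI, hI', le_rfl⟩
    · rw [h.union]
      rintro ⟨J, hJ, h1, h2⟩
      rcases eq_or_ne I J with rfl | hne
      · omega
      · have : ∀ I ∈ L, ∀ J ∈ L, I.2 + 1 < J.1 ∨ J.2 + 1 < I.1 ∨ I = J := fun I hI J hJ =>
          have : Std.Symm fun I J : ℕ × ℕ => I.2 + 1 < J.1 ∨ J.2 + 1 < I.1 ∨ I = J :=
            ⟨fun x y h => by tauto⟩
          List.Pairwise.forall_of_forall
            (R := fun I J : ℕ × ℕ => I.2 + 1 < J.1 ∨ J.2 + 1 < I.1 ∨ I = J) (fun _ _ => Or.inr (Or.inr rfl))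
            (hp.imp fun h => Or.inl h) hI hJ
        have := this I hI J hJ
        rcases this with g | g | g
        · omega
        · omega
        · exact hne g
  have := Finset.card_le_card hsub
  rwa [List.toFinset_card_of_nodup hnd, List.length_map] at this

theorem natLog_le_two_mul_log (n : ℕ) : (Nat.log 2 n : ℝ) ≤ 2 * Real.log n := by
  rcases Nat.eq_zero_or_pos n with rfl | hn
  · simp
  have h1 : ((2 ^ Nat.log 2 n : ℕ) : ℝ) ≤ n := by exact_mod_cast Nat.pow_log_le_self 2 hn.ne'
  have h2 : Real.log ((2 ^ Nat.log 2 n : ℕ) : ℝ) ≤ Real.log n :=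
    Real.log_le_log (by positivity) h1
  rw [Nat.cast_pow, Real.log_pow] at h2
  have h3 : (1 / 2 : ℝ) ≤ Real.log 2 := by have := Real.log_two_gt_d9; linarith
  have h4 : (0 : ℝ) ≤ Nat.log 2 n := by positivity
  push_cast at h2
  nlinarith

/-- The interval representations of the squares of all periods have total size `O(n log n)`. -/
theorem IsSCER.sum_length_le {α : Type*} {r : List α → List α → Prop} (hr : IsSCER r)
    (T : List α) (R : ℕ → List (ℕ × ℕ))
    (hR : ∀ p ∈ Finset.Icc 1 (T.length / 2), IsIntervalRep (Squares r T p) (R p)) :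
    ∑ p ∈ Finset.Icc 1 (T.length / 2), (R p).length ≤ 2 * (T.length * Nat.log 2 T.length) := by
  have h := hr.levelSystem T
  refine le_trans (Finset.sum_le_sum fun p hp => ?_) (h.sum_card_newPairs_le (T.length / 2))
  have hp1 := (Finset.mem_Icc.1 hp).1
  refine (hR p hp).length_le _ fun x hx hx' => ?_
  rw [mem_squares_iff hr T hp1] at hx hx'
  rw [h.mem_newPairs hp1]
  refine ⟨hx, fun hc => hx' ?_⟩
  have := h.shift hc
  rwa [show x + p + 1 = x + 1 + p by omega] at this

open Classical in
/-- The elements of `X` in `[1 .. m]` whose predecessor is not in `X`, in increasing order. -/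
noncomputable def leftEnds (X : Set ℕ) (m : ℕ) : List ℕ :=
  (List.range' 1 m).filter fun x => x ∈ X ∧ x - 1 ∉ X

open Classical in
/-- The elements of `X` in `[1 .. m]` whose successor is not in `X`, in increasing order. -/
noncomputable def rightEnds (X : Set ℕ) (m : ℕ) : List ℕ :=
  (List.range' 1 m).filter fun x => x ∈ X ∧ x + 1 ∉ X

open Classical in
theorem leftEnds_succ (X : Set ℕ) (m : ℕ) : leftEnds X (m + 1) =
    leftEnds X m ++ if m + 1 ∈ X ∧ m ∉ X then [m + 1] else [] := by
  rw [leftEnds, List.range'_1_concat, List.filter_append, leftEnds]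
  congr 1
  rw [show 1 + m = m + 1 by omega, List.filter_cons]
  simp

open Classical in
theorem rightEnds_succ (X : Set ℕ) (m : ℕ) : rightEnds X (m + 1) =
    rightEnds X m ++ if m + 1 ∈ X ∧ m + 2 ∉ X then [m + 1] else [] := by
  rw [rightEnds, List.range'_1_concat, List.filter_append, rightEnds]
  congr 1
  rw [show 1 + m = m + 1 by omega, List.filter_cons]
  simp

theorem isIntervalRep_concat {X : Set ℕ} {L : List (ℕ × ℕ)} {a b : ℕ} (h : IsIntervalRep X L)
    (hab : a ≤ b) (hX : ∀ x ∈ X, x + 1 < a) :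
    IsIntervalRep {x | x ∈ X ∨ a ≤ x ∧ x ≤ b} (L ++ [(a, b)]) where
  nonempty := by
    intro I hI
    rcases List.mem_append.1 hI with hI | hI
    · exact h.nonempty I hI
    · rw [List.mem_singleton.1 hI]; exact hab
  separated := by
    rw [List.isChain_append]
    refine ⟨h.separated, List.isChain_singleton _, ?_⟩
    intro I hI J hJ
    have hI' : I ∈ L := List.mem_of_getLast? hI
    simp only [List.head?_cons, Option.mem_some_iff] at hJ
    subst hJ
    apply hX
    rw [h.union]
    exact ⟨I, hI', h.nonempty I hI', le_rfl⟩
  union := by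
    ext x
    simp only [Set.mem_ofPred_eq, List.mem_append, List.mem_singleton]
    rw [h.union]
    constructor
    · rintro (⟨I, hI, hx⟩ | hx)
      · exact ⟨I, Or.inl hI, hx⟩
      · exact ⟨(a, b), Or.inr rfl, hx⟩
    · rintro ⟨I, hI | rfl, hx⟩
      · exact Or.inl ⟨I, hI, hx⟩
      · exact Or.inr hx

/-- Matching the left ends with the right ends in increasing order gives the interval
representation. -/
theorem isIntervalRep_zip {X : Set ℕ} {n : ℕ} (hX : ∀ x ∈ X, 1 ≤ x ∧ x ≤ n) :
    (leftEnds X n).length = (rightEnds X n).length ∧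
      IsIntervalRep X ((leftEnds X n).zip (rightEnds X n)) := by
  have key : ∀ m,
      ((m ∉ X ∨ m + 1 ∉ X) ∧ (leftEnds X m).length = (rightEnds X m).length ∧
        IsIntervalRep {x | x ∈ X ∧ x ≤ m} ((leftEnds X m).zip (rightEnds X m))) ∨
      (m ∈ X ∧ m + 1 ∈ X ∧ ∃ l a, leftEnds X m = l ++ [a] ∧ l.length = (rightEnds X m).length ∧
        a ≤ m ∧ (∀ x, a ≤ x → x ≤ m → x ∈ X) ∧ a - 1 ∉ X ∧
        IsIntervalRep {x | x ∈ X ∧ x < a} (l.zip (rightEnds X m))) := by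
    intro m
    induction m with
    | zero =>
      left
      have h0 : (0 : ℕ) ∉ X := fun h => by have := hX _ h; omega
      refine ⟨Or.inl h0, by simp [leftEnds, rightEnds], ?_, ?_, ?_⟩
      · simp [leftEnds]
      · simp [leftEnds]
      · ext x
        simp only [leftEnds, rightEnds, Set.mem_ofPred_eq, Nat.le_zero]
        constructor
        · rintro ⟨hx, rfl⟩; exact absurd hx h0
        · simp
    | succ m ih =>
      rw [leftEnds_succ, rightEnds_succ]
      by_cases h1 : m + 1 ∈ X
      · rcases ih with ⟨g1, g2, g3⟩ | ⟨g1, g2, l, a, g3, g4, g5, g6, g7, g8⟩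
        · -- a new interval starts at `m + 1`
          have hm : m ∉ X := by tauto
          rw [if_pos ⟨h1, hm⟩]
          by_cases h2 : m + 2 ∈ X
          · right
            rw [if_neg (by tauto), List.append_nil]
            refine ⟨h1, h2, _, _, rfl, g2, le_rfl, ?_, by simpa using hm, ?_⟩
            · intro x hx hx'
              rwa [show x = m + 1 by omega]
            · simpa [Nat.lt_succ_iff] using g3
          · left
            rw [if_pos ⟨h1, h2⟩]
            refine ⟨Or.inr h2, by simp [g2], ?_⟩
            rw [List.zip_append g2, show [m + 1].zip [m + 1] = [(m + 1, m + 1)] from rfl]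
            have := isIntervalRep_concat g3 (le_refl (m + 1)) (fun x hx => by
              have : x ≠ m := fun e => hm (e ▸ hx.1)
              have := hx.2
              omega)
            convert this using 1
            ext x
            simp only [Set.mem_ofPred_eq]
            constructor
            · rintro ⟨hx, hx'⟩
              by_cases e : x ≤ m
              · exact Or.inl ⟨hx, e⟩
              · exact Or.inr (by omega)
            · rintro (⟨hx, hx'⟩ | hx)
              · exact ⟨hx, by omega⟩
              · rw [show x = m + 1 by omega]
                exact ⟨h1, le_rfl⟩
        · rw [if_neg (by tauto), List.append_nil]
          by_cases h2 : m + 2 ∈ X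
          · right
            rw [if_neg (by tauto), List.append_nil]
            refine ⟨h1, h2, l, a, g3, g4, by omega, ?_, g7, g8⟩
            intro x hx hx'
            rcases Nat.lt_or_ge m x with e | e
            · rwa [show x = m + 1 by omega]
            · exact g6 x hx e
          · left
            rw [if_pos ⟨h1, h2⟩]
            refine ⟨Or.inr h2, by simp [g3, g4], ?_⟩
            rw [g3, List.zip_append g4, show [a].zip [m + 1] = [(a, m + 1)] from rfl]
            have := isIntervalRep_concat g8 (show a ≤ m + 1 by omega) (fun x hx => by
              have : x ≠ a - 1 := fun e => g7 (e ▸ hx.1)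
              have := hx.2
              omega)
            convert this using 1
            ext x
            simp only [Set.mem_ofPred_eq]
            constructor
            · rintro ⟨hx, hx'⟩
              by_cases e : x < a
              · exact Or.inl ⟨hx, e⟩
              · exact Or.inr (by omega)
            · rintro (⟨hx, hx'⟩ | hx)
              · exact ⟨hx, by omega⟩
              · refine ⟨?_, hx.2⟩
                rcases Nat.lt_or_ge m x with e | e
                · rwa [show x = m + 1 by omega]
                · exact g6 x hx.1 e
      · rw [if_neg (by tauto), if_neg (by tauto), List.append_nil, List.append_nil]
        rcases ih with ⟨g1, g2, g3⟩ | ⟨g1, g2, -⟩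
        · left
          refine ⟨Or.inl h1, g2, ?_⟩
          convert g3 using 1
          ext x
          simp only [Set.mem_ofPred_eq]
          constructor
          · rintro ⟨hx, hx'⟩
            have : x ≠ m + 1 := fun e => h1 (e ▸ hx)
            exact ⟨hx, by omega⟩
          · rintro ⟨hx, hx'⟩
            exact ⟨hx, by omega⟩
        · exact absurd g2 h1
  rcases key n with ⟨-, g2, g3⟩ | ⟨-, g2, -⟩
  · refine ⟨g2, ?_⟩
    convert g3 using 1
    ext x
    exact ⟨fun hx => ⟨hx, (hX x hx).2⟩, fun hx => hx.1⟩
  · have := hX _ g2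
    omega

/-! ### Runs of word-RAM programs -/

namespace WordRAM

theorem Fits.mono {w w' : ℕ} (hw : w ≤ w') {v : ℤ} (h : Fits w v) : Fits w' v := by
  have : (2 : ℤ) ^ w ≤ 2 ^ w' := pow_le_pow_right₀ (by norm_num) hw
  exact ⟨by have := h.1; linarith, by have := h.2; linarith⟩

/-- Longer words do not invalidate a run. -/
theorem Exec.mono {w w' : ℕ} (hw : w ≤ w') {P : Prog} {s s' : Store} {t : ℕ}
    (h : Exec w P s t s') : Exec w' P s t s' := by
  induction h with
  | skip s => exact .skip s
  | const s x v h => exact .const s x v (h.mono hw)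
  | copy s x y h => exact .copy s x y (h.mono hw)
  | op s o x y z h => exact .op s o x y z (h.mono hw)
  | load s x A y a ha h => exact .load s x A y a ha (h.mono hw)
  | store s A x y a ha h => exact .store s A x y a ha (h.mono hw)
  | seq P Q s s' s'' t t' _ _ ih1 ih2 => exact .seq P Q s s' s'' t t' ih1 ih2
  | cond_true x P Q s s' t hx _ ih => exact .cond_true x P Q s s' t hx ih
  | cond_false x P Q s s' t hx _ ih => exact .cond_false x P Q s s' t hx ih
  | loop_exit x P s hx => exact .loop_exit x P s hx
  | loop_step x P s s' s'' t t' hx _ _ ih1 ih2 => exact .loop_step x P s s' s'' t t' hx ih1 ih2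

theorem Exec.one_le {w : ℕ} {P : Prog} {s s' : Store} {t : ℕ}
    (h : Exec w P s t s') : 1 ≤ t := by
  induction h <;> omega

/-- If all registers fit into `w'` bits before a run with word length at most `w'`, then they do so
afterwards. -/
theorem Exec.fits {w w' : ℕ} (hw : w ≤ w') {P : Prog} {s s' : Store} {t : ℕ}
    (h : Exec w P s t s') (hs : ∀ x, Fits w' (s.reg x)) : ∀ x, Fits w' (s'.reg x) := by
  have upd : ∀ (s : Store) (x : ℕ) (v : ℤ), Fits w v → (∀ y, Fits w' (s.reg y)) →
      ∀ y, Fits w' ((s.setReg x v).reg y) := by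
    intro s x v hv hs y
    simp only [Store.setReg, Function.update_apply]
    split_ifs
    · exact hv.mono hw
    · exact hs y
  induction h with
  | skip s => exact hs
  | const s x v h => exact upd _ _ _ h hs
  | copy s x y h => exact upd _ _ _ h hs
  | op s o x y z h => exact upd _ _ _ h hs
  | load s x A y a ha h => exact upd _ _ _ h hs
  | store s A x y a ha h => exact hs
  | seq P Q s s' s'' t t' _ _ ih1 ih2 => exact ih2 (ih1 hs)
  | cond_true x P Q s s' t hx _ ih => exact ih hs
  | cond_false x P Q s s' t hx _ ih => exact ih hs
  | loop_exit x P s hx => exact hs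
  | loop_step x P s s' s'' t t' hx _ _ ih1 ih2 => exact ih2 (ih1 hs)

/-! ### A structured layer above the word RAM -/

/-- A structured memory: variables and arrays of natural numbers, and a separate store on which
given programs run. -/
structure St where
  v : ℕ → ℕ
  a : ℕ → ℕ → ℕ
  x : Store

/-- The array of the machine that holds the `A`-th own array. -/
def ownArr (A : ℕ) : ℕ := if A < 6 then A else 2 * A

/-- The array of the machine that holds the `A`-th array of the embedded store. -/
def extArr (A : ℕ) : ℕ := 2 * A + 7

/-- The store `s` of the machine represents the structured memory `σ`: variables are in the
registers `3 i`, registers of the embedded store in the registers `3 i + 1`; the registers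
`3 i + 2` are free for intermediate results. -/
structure Rep (σ : St) (s : Store) : Prop where
  var : ∀ i, s.reg (3 * i) = (σ.v i : ℤ)
  ext : ∀ i, s.reg (3 * i + 1) = σ.x.reg i
  arr : ∀ A j, s.arr (ownArr A) j = (σ.a A j : ℤ)
  earr : ∀ A j, s.arr (extArr A) j = σ.x.arr A j

def St.setV (σ : St) (i n : ℕ) : St := { σ with v := Function.update σ.v i n }

def St.setA (σ : St) (A j n : ℕ) : St :=
  { σ with a := Function.update σ.a A (Function.update (σ.a A) j n) }

def St.setX (σ : St) (x : Store) : St := { σ with x := x }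

@[simp] theorem St.setV_v (σ : St) (i n j : ℕ) :
    (σ.setV i n).v j = if j = i then n else σ.v j := by
  simp [St.setV, Function.update_apply]

@[simp] theorem St.setV_a (σ : St) (i n : ℕ) : (σ.setV i n).a = σ.a := rfl

@[simp] theorem St.setV_x (σ : St) (i n : ℕ) : (σ.setV i n).x = σ.x := rfl

@[simp] theorem St.setA_v (σ : St) (A j n : ℕ) : (σ.setA A j n).v = σ.v := rfl

@[simp] theorem St.setA_x (σ : St) (A j n : ℕ) : (σ.setA A j n).x = σ.x := rfl

@[simp] theorem St.setA_a (σ : St) (A j n B k : ℕ) :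
    (σ.setA A j n).a B k = if B = A ∧ k = j then n else σ.a B k := by
  simp only [St.setA, Function.update_apply]
  by_cases h1 : B = A
  · subst h1
    simp [Function.update_apply]
  · simp [h1]

@[simp] theorem St.setX_v (σ : St) (x : Store) : (σ.setX x).v = σ.v := rfl

@[simp] theorem St.setX_a (σ : St) (x : Store) : (σ.setX x).a = σ.a := rfl

@[simp] theorem St.setX_x (σ : St) (x : Store) : (σ.setX x).x = x := rfl

theorem Store.setReg_reg (s : Store) (x : ℕ) (v : ℤ) (y : ℕ) :
    (s.setReg x v).reg y = if y = x then v else s.reg y := by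
  simp [Store.setReg, Function.update_apply]

theorem Store.setArr_arr (s : Store) (A j : ℕ) (v : ℤ) (B k : ℕ) :
    (s.setArr A j v).arr B k = if B = A ∧ k = j then v else s.arr B k := by
  simp only [Store.setArr, Function.update_apply]
  by_cases h1 : B = A
  · subst h1
    simp [Function.update_apply]
  · simp [h1]

theorem ownArr_inj {A B : ℕ} : ownArr A = ownArr B ↔ A = B := by
  simp only [ownArr]; split_ifs <;> omega

theorem extArr_inj {A B : ℕ} : extArr A = extArr B ↔ A = B := by
  simp only [extArr]; omega

theorem ownArr_ne_extArr (A B : ℕ) : ownArr A ≠ extArr B := by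
  simp only [extArr, ownArr]; split_ifs <;> omega

theorem Rep.setV {σ : St} {s : Store} (h : Rep σ s) (i n : ℕ) :
    Rep (σ.setV i n) (s.setReg (3 * i) (n : ℤ)) where
  var := by
    intro j
    rw [Store.setReg_reg, St.setV_v]
    by_cases e : j = i
    · simp [e]
    · rw [if_neg (by omega), if_neg e, h.var]
  ext := by
    intro j
    rw [Store.setReg_reg, if_neg (by omega)]
    exact h.ext j
  arr := h.arr
  earr := h.earr

theorem Rep.setScratch {σ : St} {s : Store} (h : Rep σ s) (d : ℕ) (v : ℤ) :
    Rep σ (s.setReg (3 * d + 2) v) where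
  var := by
    intro j
    rw [Store.setReg_reg, if_neg (by omega)]
    exact h.var j
  ext := by
    intro j
    rw [Store.setReg_reg, if_neg (by omega)]
    exact h.ext j
  arr := h.arr
  earr := h.earr

theorem Rep.setA {σ : St} {s : Store} (h : Rep σ s) (A j n : ℕ) :
    Rep (σ.setA A j n) (s.setArr (ownArr A) j (n : ℤ)) where
  var := h.var
  ext := h.ext
  arr := by
    intro B k
    rw [Store.setArr_arr, St.setA_a]
    simp only [ownArr_inj]
    split_ifs
    · rfl
    · exact h.arr B k
  earr := by
    intro B k
    rw [Store.setArr_arr, if_neg fun e => ownArr_ne_extArr _ _ e.1.symm]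
    exact h.earr B k

theorem Rep.setExt {σ : St} {s : Store} (h : Rep σ s) (i : ℕ) (v : ℤ) :
    Rep (σ.setX (σ.x.setReg i v)) (s.setReg (3 * i + 1) v) where
  var := by
    intro j
    rw [Store.setReg_reg, if_neg (by omega)]
    exact h.var j
  ext := by
    intro j
    rw [Store.setReg_reg, St.setX_x, Store.setReg_reg]
    by_cases e : j = i
    · simp [e]
    · rw [if_neg (by omega), if_neg e, h.ext]
  arr := h.arr
  earr := h.earr

theorem Rep.setExtArr {σ : St} {s : Store} (h : Rep σ s) (A j : ℕ) (v : ℤ) :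
    Rep (σ.setX (σ.x.setArr A j v)) (s.setArr (extArr A) j v) where
  var := h.var
  ext := h.ext
  arr := by
    intro B k
    rw [Store.setArr_arr, if_neg fun e => ownArr_ne_extArr _ _ e.1]
    exact h.arr B k
  earr := by
    intro B k
    rw [Store.setArr_arr, St.setX_x, Store.setArr_arr]
    simp only [extArr_inj]
    split_ifs
    · rfl
    · exact h.earr B k

/-- Expressions: constants, variables, array entries, and operations. -/
inductive Ex
  | c (k : ℕ)
  | v (x : ℕ)
  | add (e f : Ex)
  | sub (e f : Ex)
  | mul (e f : Ex)
  | lt (e f : Ex)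
  | eq (e f : Ex)
  | shl (e f : Ex)
  | rd (A : ℕ) (e : Ex)

namespace Ex

instance : Add Ex := ⟨add⟩
instance : Sub Ex := ⟨sub⟩
instance : Mul Ex := ⟨mul⟩
instance (k : ℕ) : OfNat Ex k := ⟨c k⟩

/-- The value of an expression. -/
def eval (σ : St) : Ex → ℕ
  | c k => k
  | v x => σ.v x
  | add e f => e.eval σ + f.eval σ
  | sub e f => e.eval σ - f.eval σ
  | mul e f => e.eval σ * f.eval σ
  | lt e f => if e.eval σ < f.eval σ then 1 else 0
  | eq e f => if e.eval σ = f.eval σ then 1 else 0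
  | shl e f => e.eval σ * 2 ^ f.eval σ
  | rd A e => σ.a A (e.eval σ)

/-- All intermediate results of the evaluation are smaller than `2 ^ w`, and no subtraction has a
negative result. -/
def Safe (w : ℕ) (σ : St) : Ex → Prop
  | c k => k < 2 ^ w
  | v x => σ.v x < 2 ^ w
  | add e f => e.Safe w σ ∧ f.Safe w σ ∧ e.eval σ + f.eval σ < 2 ^ w
  | sub e f => e.Safe w σ ∧ f.Safe w σ ∧ f.eval σ ≤ e.eval σ
  | mul e f => e.Safe w σ ∧ f.Safe w σ ∧ e.eval σ * f.eval σ < 2 ^ w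
  | lt e f => e.Safe w σ ∧ f.Safe w σ
  | eq e f => e.Safe w σ ∧ f.Safe w σ
  | shl e f => e.Safe w σ ∧ f.Safe w σ ∧ e.eval σ * 2 ^ f.eval σ < 2 ^ w
  | rd A e => e.Safe w σ ∧ σ.a A (e.eval σ) < 2 ^ w

/-- The number of instructions that evaluate an expression. -/
def cost : Ex → ℕ
  | c _ => 1
  | v _ => 1
  | add e f => e.cost + f.cost + 1
  | sub e f => e.cost + f.cost + 1
  | mul e f => e.cost + f.cost + 1
  | lt e f => e.cost + f.cost + 1
  | eq e f => e.cost + f.cost + 1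
  | shl e f => e.cost + f.cost + 1
  | rd _ e => e.cost + 1

/-- The program that puts the value of an expression into the `d`-th free register, using only free
registers from the `d`-th on. -/
def code (d : ℕ) : Ex → Prog
  | c k => .const (3 * d + 2) k
  | v x => .copy (3 * d + 2) (3 * x)
  | add e f => .seq (e.code d) (.seq (f.code (d + 1))
      (.op .add (3 * d + 2) (3 * d + 2) (3 * (d + 1) + 2)))
  | sub e f => .seq (e.code d) (.seq (f.code (d + 1))
      (.op .sub (3 * d + 2) (3 * d + 2) (3 * (d + 1) + 2)))
  | mul e f => .seq (e.code d) (.seq (f.code (d + 1))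
      (.op .mul (3 * d + 2) (3 * d + 2) (3 * (d + 1) + 2)))
  | lt e f => .seq (e.code d) (.seq (f.code (d + 1))
      (.op .lt (3 * d + 2) (3 * d + 2) (3 * (d + 1) + 2)))
  | eq e f => .seq (e.code d) (.seq (f.code (d + 1))
      (.op .eq (3 * d + 2) (3 * d + 2) (3 * (d + 1) + 2)))
  | shl e f => .seq (e.code d) (.seq (f.code (d + 1))
      (.op .shl (3 * d + 2) (3 * d + 2) (3 * (d + 1) + 2)))
  | rd A e => .seq (e.code d) (.load (3 * d + 2) (ownArr A) (3 * d + 2))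

section simps
variable (w : ℕ) (σ : St) (e f : Ex) (k A : ℕ)
@[simp] theorem eval_ofNat : eval σ (no_index (OfNat.ofNat k)) = OfNat.ofNat k := rfl
@[simp] theorem eval_c : eval σ (c k) = k := rfl
@[simp] theorem eval_v : eval σ (v k) = σ.v k := rfl
@[simp] theorem eval_add : eval σ (e + f) = e.eval σ + f.eval σ := rfl
@[simp] theorem eval_sub : eval σ (e - f) = e.eval σ - f.eval σ := rfl
@[simp] theorem eval_mul : eval σ (e * f) = e.eval σ * f.eval σ := rfl
@[simp] theorem eval_lt : eval σ (lt e f) = if e.eval σ < f.eval σ then 1 else 0 := rfl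
@[simp] theorem eval_eq : eval σ (eq e f) = if e.eval σ = f.eval σ then 1 else 0 := rfl
@[simp] theorem eval_shl : eval σ (shl e f) = e.eval σ * 2 ^ f.eval σ := rfl
@[simp] theorem eval_rd : eval σ (rd A e) = σ.a A (e.eval σ) := rfl
@[simp] theorem safe_ofNat : Safe w σ (no_index (OfNat.ofNat k)) ↔ OfNat.ofNat k < 2 ^ w := Iff.rfl
@[simp] theorem safe_c : Safe w σ (c k) ↔ k < 2 ^ w := Iff.rfl
@[simp] theorem safe_v : Safe w σ (v k) ↔ σ.v k < 2 ^ w := Iff.rfl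
@[simp] theorem safe_add : Safe w σ (e + f) ↔
  e.Safe w σ ∧ f.Safe w σ ∧ e.eval σ + f.eval σ < 2 ^ w := Iff.rfl
@[simp] theorem safe_sub : Safe w σ (e - f) ↔
  e.Safe w σ ∧ f.Safe w σ ∧ f.eval σ ≤ e.eval σ := Iff.rfl
@[simp] theorem safe_mul : Safe w σ (e * f) ↔
  e.Safe w σ ∧ f.Safe w σ ∧ e.eval σ * f.eval σ < 2 ^ w := Iff.rfl
@[simp] theorem safe_lt : Safe w σ (lt e f) ↔ e.Safe w σ ∧ f.Safe w σ := Iff.rfl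
@[simp] theorem safe_eq : Safe w σ (eq e f) ↔ e.Safe w σ ∧ f.Safe w σ := Iff.rfl
@[simp] theorem safe_shl : Safe w σ (shl e f) ↔
  e.Safe w σ ∧ f.Safe w σ ∧ e.eval σ * 2 ^ f.eval σ < 2 ^ w := Iff.rfl
@[simp] theorem safe_rd : Safe w σ (rd A e) ↔ e.Safe w σ ∧ σ.a A (e.eval σ) < 2 ^ w := Iff.rfl
@[simp] theorem cost_ofNat : cost (no_index (OfNat.ofNat k)) = 1 := rfl
@[simp] theorem cost_c : cost (c k) = 1 := rfl
@[simp] theorem cost_v : cost (v k) = 1 := rfl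
@[simp] theorem cost_add : cost (e + f) = e.cost + f.cost + 1 := rfl
@[simp] theorem cost_sub : cost (e - f) = e.cost + f.cost + 1 := rfl
@[simp] theorem cost_mul : cost (e * f) = e.cost + f.cost + 1 := rfl
@[simp] theorem cost_lt : cost (lt e f) = e.cost + f.cost + 1 := rfl
@[simp] theorem cost_eq : cost (eq e f) = e.cost + f.cost + 1 := rfl
@[simp] theorem cost_shl : cost (shl e f) = e.cost + f.cost + 1 := rfl
@[simp] theorem cost_rd : cost (rd A e) = e.cost + 1 := rfl
end simps

theorem eval_lt_two_pow {w : ℕ} {σ : St} (hw : 1 ≤ w) {e : Ex} (h : e.Safe w σ) :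
    e.eval σ < 2 ^ w := by
  have h2 : 2 ^ 1 ≤ 2 ^ w := Nat.pow_le_pow_right (by norm_num) hw
  induction e with
  | c k => exact h
  | v x => exact h
  | add e f ihe ihf => exact h.2.2
  | sub e f ihe ihf => exact (Nat.sub_le _ _).trans_lt (ihe h.1)
  | mul e f ihe ihf => exact h.2.2
  | lt e f ihe ihf => simp only [eval]; split_ifs <;> omega
  | eq e f ihe ihf => simp only [eval]; split_ifs <;> omega
  | shl e f ihe ihf => exact h.2.2
  | rd A e ih => exact h.2

theorem fits_natCast {w v : ℕ} (h : v < 2 ^ w) : Fits w (v : ℤ) :=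
  ⟨le_trans (neg_nonpos.2 (by positivity)) (by positivity), by exact_mod_cast h⟩

theorem exec_bin {w d : ℕ} {e f : Ex} {σ : St} {o : Op} {r : ℕ}
    (ihe : ∀ s, Rep σ s → ∃ s', Exec w (e.code d) s e.cost s' ∧ Rep σ s' ∧
      s'.reg (3 * d + 2) = (e.eval σ : ℤ) ∧ ∀ k < d, s'.reg (3 * k + 2) = s.reg (3 * k + 2))
    (ihf : ∀ s, Rep σ s → ∃ s', Exec w (f.code (d + 1)) s f.cost s' ∧ Rep σ s' ∧
      s'.reg (3 * (d + 1) + 2) = (f.eval σ : ℤ) ∧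
        ∀ k < d + 1, s'.reg (3 * k + 2) = s.reg (3 * k + 2))
    (hr : o.eval (e.eval σ : ℤ) (f.eval σ : ℤ) = (r : ℤ)) (hw : r < 2 ^ w) (s : Store)
    (hs : Rep σ s) :
    ∃ s', Exec w (.seq (e.code d) (.seq (f.code (d + 1))
      (.op o (3 * d + 2) (3 * d + 2) (3 * (d + 1) + 2)))) s (e.cost + f.cost + 1) s' ∧
      Rep σ s' ∧ s'.reg (3 * d + 2) = (r : ℤ) ∧ ∀ k < d, s'.reg (3 * k + 2) = s.reg (3 * k + 2) := by
  obtain ⟨s1, h1, hs1, hv1, hk1⟩ := ihe s hs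
  obtain ⟨s2, h2, hs2, hv2, hk2⟩ := ihf s1 hs1
  have hd : s2.reg (3 * d + 2) = (e.eval σ : ℤ) := by rw [hk2 d (by omega), hv1]
  have hv : o.eval (s2.reg (3 * d + 2)) (s2.reg (3 * (d + 1) + 2)) = (r : ℤ) := by
    rw [hd, hv2, hr]
  have h3 := Exec.op s2 o (3 * d + 2) (3 * d + 2) (3 * (d + 1) + 2)
    (by rw [hv]; exact fits_natCast hw)
  rw [hv] at h3
  refine ⟨_, by rw [add_assoc]; exact .seq _ _ _ _ _ _ _ h1 (.seq _ _ _ _ _ _ _ h2 h3),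
    hs2.setScratch d _, by simp [Store.setReg_reg], fun k hk => ?_⟩
  rw [Store.setReg_reg, if_neg (by omega), hk2 k (by omega), hk1 k hk]

theorem exec_code {w : ℕ} (hw : 1 ≤ w) {σ : St} {e : Ex} (h : e.Safe w σ) (d : ℕ) (s : Store)
    (hs : Rep σ s) : ∃ s', Exec w (e.code d) s e.cost s' ∧ Rep σ s' ∧
      s'.reg (3 * d + 2) = (e.eval σ : ℤ) ∧
      ∀ k < d, s'.reg (3 * k + 2) = s.reg (3 * k + 2) := by
  have hlt := eval_lt_two_pow hw h
  induction e generalizing d s with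
  | c k =>
    refine ⟨_, .const _ _ _ (fits_natCast h), hs.setScratch d _,
      by simp [Store.setReg_reg], fun k hk => ?_⟩
    rw [Store.setReg_reg, if_neg (by omega)]
  | v x =>
    have e1 := hs.var x
    refine ⟨_, .copy _ _ _ (by rw [e1]; exact fits_natCast h), hs.setScratch d _, ?_,
      fun k hk => ?_⟩
    · rw [Store.setReg_reg, if_pos rfl, e1]; rfl
    · rw [Store.setReg_reg, if_neg (by omega)]
  | add e f ihe ihf =>
    exact exec_bin (ihe h.1 d · · (eval_lt_two_pow hw h.1))
      (ihf h.2.1 (d + 1) · · (eval_lt_two_pow hw h.2.1)) (by simp [Op.eval, eval]) hlt s hs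
  | sub e f ihe ihf =>
    exact exec_bin (ihe h.1 d · · (eval_lt_two_pow hw h.1))
      (ihf h.2.1 (d + 1) · · (eval_lt_two_pow hw h.2.1))
      (by simp [Op.eval, eval, Nat.cast_sub h.2.2]) hlt s hs
  | mul e f ihe ihf =>
    exact exec_bin (ihe h.1 d · · (eval_lt_two_pow hw h.1))
      (ihf h.2.1 (d + 1) · · (eval_lt_two_pow hw h.2.1)) (by simp [Op.eval, eval]) hlt s hs
  | lt e f ihe ihf =>
    exact exec_bin (ihe h.1 d · · (eval_lt_two_pow hw h.1))
      (ihf h.2 (d + 1) · · (eval_lt_two_pow hw h.2)) (by simp [Op.eval, eval]) hlt s hs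
  | eq e f ihe ihf =>
    exact exec_bin (ihe h.1 d · · (eval_lt_two_pow hw h.1))
      (ihf h.2 (d + 1) · · (eval_lt_two_pow hw h.2)) (by simp [Op.eval, eval]) hlt s hs
  | shl e f ihe ihf =>
    exact exec_bin (ihe h.1 d · · (eval_lt_two_pow hw h.1))
      (ihf h.2.1 (d + 1) · · (eval_lt_two_pow hw h.2.1)) (by simp [Op.eval, eval]) hlt s hs
  | rd A e ih =>
    obtain ⟨s1, h1, hs1, hv1, hk1⟩ := ih h.1 d s hs (eval_lt_two_pow hw h.1)
    have e1 := hs1.arr A (e.eval σ)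
    refine ⟨_, .seq _ _ _ _ _ _ _ h1 (.load s1 (3 * d + 2) (ownArr A) (3 * d + 2) (e.eval σ) hv1
      (by rw [e1]; exact fits_natCast h.2)), hs1.setScratch d _, ?_, fun k hk => ?_⟩
    · rw [Store.setReg_reg, if_pos rfl, e1]; rfl
    · rw [Store.setReg_reg, if_neg (by omega), hk1 k hk]

end Ex

/-! ### Program constructs and their proof rules -/

/-- Started in any representation of `σ`, the program halts in a representation of some `σ'` after
`t` steps, where `R σ' t`. -/
def HT (w : ℕ) (P : Prog) (σ : St) (R : St → ℕ → Prop) : Prop :=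
  ∀ s, Rep σ s → ∃ t s' σ', Exec w P s t s' ∧ Rep σ' s' ∧ R σ' t

/-- `x := e` -/
def asg (x : ℕ) (e : Ex) : Prog := .seq (e.code 0) (.copy (3 * x) 2)

/-- `A[i] := e` -/
def put (A : ℕ) (i e : Ex) : Prog :=
  .seq (i.code 0) (.seq (e.code 1) (.store (ownArr A) 2 5))

/-- if `e ≠ 0` then `P` else `Q` -/
def ite (e : Ex) (P Q : Prog) : Prog := .seq (e.code 0) (.cond 2 P Q)

/-- while `e ≠ 0` do `P` -/
def whl (e : Ex) (P : Prog) : Prog := .seq (e.code 0) (.loop 2 (.seq P (e.code 0)))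

/-- while `i < b` do `P; i := i + 1` -/
def forUp (i : ℕ) (b : Ex) (P : Prog) : Prog := whl (.lt (.v i) b) (.seq P (asg i (.v i + 1)))

/-- Register `i` of the embedded store `:= e`. -/
def setExt (i : ℕ) (e : Ex) : Prog := .seq (e.code 0) (.copy (3 * i + 1) 2)

/-- Entry `i` of array `A` of the embedded store `:= e`. -/
def putExt (A : ℕ) (i e : Ex) : Prog :=
  .seq (i.code 0) (.seq (e.code 1) (.store (extArr A) 2 5))

/-- `x := ` register `i` of the embedded store `+ y` -/
def getExt (x i y : ℕ) : Prog := .op .add (3 * x) (3 * i + 1) (3 * y)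

/-- The program `P`, running on the embedded store. -/
def onExt : Prog → Prog
  | .skip => .skip
  | .const x v => .const (3 * x + 1) v
  | .copy x y => .copy (3 * x + 1) (3 * y + 1)
  | .op o x y z => .op o (3 * x + 1) (3 * y + 1) (3 * z + 1)
  | .load x A y => .load (3 * x + 1) (extArr A) (3 * y + 1)
  | .store A x y => .store (extArr A) (3 * x + 1) (3 * y + 1)
  | .seq P Q => .seq (onExt P) (onExt Q)
  | .cond x P Q => .cond (3 * x + 1) (onExt P) (onExt Q)
  | .loop x P => .loop (3 * x + 1) (onExt P)

section rules

variable {w : ℕ} {σ : St} {R R' : St → ℕ → Prop} {P Q : Prog} {e f : Ex}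

theorem HT.mono (h : HT w P σ R) (hR : ∀ σ' t, R σ' t → R' σ' t) : HT w P σ R' := by
  intro s hs
  obtain ⟨t, s', σ', h1, h2, h3⟩ := h s hs
  exact ⟨t, s', σ', h1, h2, hR _ _ h3⟩

theorem HT.skip (h : R σ 1) : HT w .skip σ R := fun s hs => ⟨1, s, σ, .skip s, hs, h⟩

theorem HT.seq (h : HT w P σ fun σ1 t1 => HT w Q σ1 fun σ2 t2 => R σ2 (t1 + t2)) :
    HT w (.seq P Q) σ R := by
  intro s hs
  obtain ⟨t1, s1, σ1, h1, hs1, h2⟩ := h s hs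
  obtain ⟨t2, s2, σ2, h3, hs2, h4⟩ := h2 s1 hs1
  exact ⟨_, _, _, .seq _ _ _ _ _ _ _ h1 h3, hs2, h4⟩

theorem HT.asg (hw : 1 ≤ w) {x : ℕ} (he : e.Safe w σ)
    (h : R (σ.setV x (e.eval σ)) (e.cost + 1)) : HT w (asg x e) σ R := by
  intro s hs
  obtain ⟨s1, h1, hs1, hv, -⟩ := Ex.exec_code hw he 0 s hs
  have h2 := Exec.copy (w := w) s1 (3 * x) 2
    (by rw [show 2 = 3 * 0 + 2 by rfl, hv]; exact Ex.fits_natCast (Ex.eval_lt_two_pow hw he))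
  rw [show s1.reg 2 = (e.eval σ : ℤ) from hv] at h2
  exact ⟨_, _, _, .seq _ _ _ _ _ _ _ h1 h2, hs1.setV x _, h⟩

theorem exec_two (hw : 1 ≤ w) (hi : e.Safe w σ) (he : f.Safe w σ) (s : Store) (hs : Rep σ s)
    (B : ℕ) : ∃ s2, Rep σ s2 ∧ Exec w (.seq (e.code 0) (.seq (f.code 1) (.store B 2 5))) s
      (e.cost + (f.cost + 1)) (s2.setArr B (e.eval σ) (f.eval σ : ℤ)) := by
  obtain ⟨s1, h1, hs1, hv1, -⟩ := Ex.exec_code hw hi 0 s hs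
  obtain ⟨s2, h2, hs2, hv2, hk⟩ := Ex.exec_code hw he 1 s1 hs1
  have e2 : s2.reg 2 = (e.eval σ : ℤ) := by
    have := hk 0 (by omega)
    rw [show 2 = 3 * 0 + 2 by rfl, this, hv1]
  have e5 : s2.reg 5 = (f.eval σ : ℤ) := hv2
  have h3 := Exec.store (w := w) s2 B 2 5 (e.eval σ) e2
    (by rw [e5]; exact Ex.fits_natCast (Ex.eval_lt_two_pow hw he))
  rw [e5] at h3
  exact ⟨s2, hs2, .seq _ _ _ _ _ _ _ h1 (.seq _ _ _ _ _ _ _ h2 h3)⟩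

theorem HT.put (hw : 1 ≤ w) {A : ℕ} (hi : e.Safe w σ) (he : f.Safe w σ)
    (h : R (σ.setA A (e.eval σ) (f.eval σ)) (e.cost + (f.cost + 1))) : HT w (put A e f) σ R := by
  intro s hs
  obtain ⟨s2, hs2, h2⟩ := exec_two hw hi he s hs (ownArr A)
  exact ⟨_, _, _, h2, hs2.setA A _ _, h⟩

theorem HT.putExt (hw : 1 ≤ w) {A : ℕ} (hi : e.Safe w σ) (he : f.Safe w σ)
    (h : R (σ.setX (σ.x.setArr A (e.eval σ) (f.eval σ : ℤ))) (e.cost + (f.cost + 1))) :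
    HT w (putExt A e f) σ R := by
  intro s hs
  obtain ⟨s2, hs2, h2⟩ := exec_two hw hi he s hs (extArr A)
  exact ⟨_, _, _, h2, hs2.setExtArr A _ _, h⟩

theorem HT.setExt (hw : 1 ≤ w) {x : ℕ} (he : e.Safe w σ)
    (h : R (σ.setX (σ.x.setReg x (e.eval σ : ℤ))) (e.cost + 1)) : HT w (setExt x e) σ R := by
  intro s hs
  obtain ⟨s1, h1, hs1, hv, -⟩ := Ex.exec_code hw he 0 s hs
  have h2 := Exec.copy (w := w) s1 (3 * x + 1) 2
    (by rw [show 2 = 3 * 0 + 2 by rfl, hv]; exact Ex.fits_natCast (Ex.eval_lt_two_pow hw he))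
  rw [show s1.reg 2 = (e.eval σ : ℤ) from hv] at h2
  exact ⟨_, _, _, .seq _ _ _ _ _ _ _ h1 h2, hs1.setExt x _, h⟩

theorem HT.getExt {x i y r : ℕ} (hr : σ.x.reg i + σ.v y = (r : ℤ)) (hlt : r < 2 ^ w)
    (h : R (σ.setV x r) 1) : HT w (getExt x i y) σ R := by
  intro s hs
  have e1 : Op.add.eval (s.reg (3 * i + 1)) (s.reg (3 * y)) = (r : ℤ) := by
    rw [hs.ext, hs.var]; exact hr
  have h1 := Exec.op (w := w) s .add (3 * x) (3 * i + 1) (3 * y)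
    (by rw [e1]; exact Ex.fits_natCast hlt)
  rw [e1] at h1
  exact ⟨_, _, _, h1, hs.setV x _, h⟩

theorem HT.onExt {t : ℕ} {x' : Store} (hP : Exec w P σ.x t x') (h : R (σ.setX x') t) :
    HT w (onExt P) σ R := by
  suffices key : ∀ s, Rep σ s → ∃ s', Exec w (WordRAM.onExt P) s t s' ∧ Rep (σ.setX x') s' by
    intro s hs
    obtain ⟨s', h1, h2⟩ := key s hs
    exact ⟨_, _, _, h1, h2, h⟩
  clear h
  obtain ⟨y, hy⟩ : ∃ y, σ.x = y := ⟨_, rfl⟩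
  rw [hy] at hP
  induction hP generalizing σ with
  | skip s =>
    intro S hS
    exact ⟨S, .skip S, by rw [← hy]; exact hS⟩
  | const s x v h =>
    intro S hS
    exact ⟨_, .const _ _ _ h, by rw [← hy]; exact hS.setExt _ _⟩
  | copy s x z h =>
    intro S hS
    have e1 : S.reg (3 * z + 1) = s.reg z := by rw [hS.ext, hy]
    have h1 := Exec.copy (w := w) S (3 * x + 1) (3 * z + 1) (by rw [e1]; exact h)
    rw [e1] at h1
    exact ⟨_, h1, by rw [← hy]; exact hS.setExt _ _⟩
  | op s o x z u h =>
    intro S hS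
    have e1 : S.reg (3 * z + 1) = s.reg z := by rw [hS.ext, hy]
    have e2 : S.reg (3 * u + 1) = s.reg u := by rw [hS.ext, hy]
    have h1 := Exec.op (w := w) S o (3 * x + 1) (3 * z + 1) (3 * u + 1) (by rw [e1, e2]; exact h)
    rw [e1, e2] at h1
    exact ⟨_, h1, by rw [← hy]; exact hS.setExt _ _⟩
  | load s x A z a ha h =>
    intro S hS
    have e1 : S.reg (3 * z + 1) = s.reg z := by rw [hS.ext, hy]
    have e2 : S.arr (extArr A) a = s.arr A a := by rw [hS.earr, hy]
    have h1 := Exec.load (w := w) S (3 * x + 1) (extArr A) (3 * z + 1) a (by rw [e1]; exact ha)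
      (by rw [e2]; exact h)
    rw [e2] at h1
    exact ⟨_, h1, by rw [← hy]; exact hS.setExt _ _⟩
  | store s A x z a ha h =>
    intro S hS
    have e1 : S.reg (3 * x + 1) = s.reg x := by rw [hS.ext, hy]
    have e2 : S.reg (3 * z + 1) = s.reg z := by rw [hS.ext, hy]
    have h1 := Exec.store (w := w) S (extArr A) (3 * x + 1) (3 * z + 1) a (by rw [e1]; exact ha)
      (by rw [e2]; exact h)
    rw [e2] at h1
    exact ⟨_, h1, by rw [← hy]; exact hS.setExtArr _ _ _⟩
  | seq P Q s s' s'' t t' _ _ ih1 ih2 =>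
    intro S hS
    obtain ⟨S1, h1, hS1⟩ := ih1 hy S hS
    obtain ⟨S2, h2, hS2⟩ := ih2 (σ := σ.setX s') rfl S1 hS1
    exact ⟨S2, .seq _ _ _ _ _ _ _ h1 h2, hS2⟩
  | cond_true x P Q s s' t hx _ ih =>
    intro S hS
    obtain ⟨S1, h1, hS1⟩ := ih hy S hS
    exact ⟨S1, .cond_true _ _ _ _ _ _ (by rw [hS.ext, hy]; exact hx) h1, hS1⟩
  | cond_false x P Q s s' t hx _ ih =>
    intro S hS
    obtain ⟨S1, h1, hS1⟩ := ih hy S hS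
    exact ⟨S1, .cond_false _ _ _ _ _ _ (by rw [hS.ext, hy]; exact hx) h1, hS1⟩
  | loop_exit x P s hx =>
    intro S hS
    exact ⟨S, .loop_exit _ _ _ (by rw [hS.ext, hy]; exact hx), by rw [← hy]; exact hS⟩
  | loop_step x P s s' s'' t t' hx _ _ ih1 ih2 =>
    intro S hS
    obtain ⟨S1, h1, hS1⟩ := ih1 hy S hS
    obtain ⟨S2, h2, hS2⟩ := ih2 (σ := σ.setX s') rfl S1 hS1
    exact ⟨S2, .loop_step _ _ _ _ _ _ _ (by rw [hS.ext, hy]; exact hx) h1 h2, hS2⟩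

theorem HT.ite (hw : 1 ≤ w) (he : e.Safe w σ)
    (h1 : e.eval σ ≠ 0 → HT w P σ fun σ' t => R σ' (e.cost + 1 + t))
    (h0 : e.eval σ = 0 → HT w Q σ fun σ' t => R σ' (e.cost + 1 + t)) :
    HT w (ite e P Q) σ R := by
  intro s hs
  obtain ⟨s1, g1, hs1, hv, -⟩ := Ex.exec_code hw he 0 s hs
  have hv : s1.reg 2 = (e.eval σ : ℤ) := hv
  by_cases hz : e.eval σ = 0
  · obtain ⟨t, s', σ', k1, k2, k3⟩ := h0 hz s1 hs1
    exact ⟨_, _, _, .seq _ _ _ _ _ _ _ g1 (.cond_false _ _ _ _ _ _ (by rw [hv, hz]; rfl) k1), k2,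
      by rw [← add_assoc]; exact k3⟩
  · obtain ⟨t, s', σ', k1, k2, k3⟩ := h1 hz s1 hs1
    exact ⟨_, _, _, .seq _ _ _ _ _ _ _ g1
      (.cond_true _ _ _ _ _ _ (by rw [hv]; exact_mod_cast hz) k1), k2,
      by rw [← add_assoc]; exact k3⟩

/-- Rule for while loops. The invariant `I B σ` includes a time budget `B`, which pays for each
test of the loop condition and each run of the body. -/
theorem HT.whl (hw : 1 ≤ w) (I : ℕ → St → Prop)
    (hI : ∀ B σ, I B σ → e.Safe w σ ∧ e.cost + 1 ≤ B ∧
      (e.eval σ ≠ 0 → HT w P σ fun σ' t => ∃ B', I B' σ' ∧ e.cost + 1 + t + B' ≤ B))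
    {B : ℕ} (hσ : I B σ) :
    HT w (whl e P) σ fun σ' t => ∃ B', I B' σ' ∧ e.eval σ' = 0 ∧ t + B' ≤ B + (e.cost + 1) := by
  induction B using Nat.strong_induction_on generalizing σ with
  | _ B ih =>
    intro s hs
    obtain ⟨he, hB, hbody⟩ := hI B σ hσ
    obtain ⟨s1, g1, hs1, hv, -⟩ := Ex.exec_code hw he 0 s hs
    have hv : s1.reg 2 = (e.eval σ : ℤ) := hv
    by_cases hz : e.eval σ = 0
    · exact ⟨_, s1, σ, .seq _ _ _ _ _ _ _ g1 (.loop_exit _ _ _ (by rw [hv, hz]; rfl)), hs1,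
        B, hσ, hz, by omega⟩
    · obtain ⟨t, s2, σ2, k1, hs2, B', hB', hle⟩ := hbody hz s1 hs1
      obtain ⟨t', s3, σ3, k2, hs3, B'', hB'', hz', hle'⟩ := ih B' (by omega) hB' s2 hs2
      cases k2 with
      | seq _ _ _ s2' _ ta tb hc hl =>
        refine ⟨_, s3, σ3, .seq _ _ _ _ _ _ _ g1 (.loop_step _ _ _ _ _ _ _
          (by rw [hv]; exact_mod_cast hz) (.seq _ _ _ _ _ _ _ k1 hc) hl), hs3, B'', hB'', hz', ?_⟩
        omega

/-- Rule for counting loops, with a time budget in the invariant. -/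
theorem HT.forUp (hw : 1 ≤ w) {i b : ℕ} (I : ℕ → ℕ → St → Prop)
    (hI : ∀ k B σ, I k B σ → σ.v i = k → k ≤ b → e.Safe w σ ∧ e.eval σ = b ∧
      (k < b → HT w P σ fun σ' t => σ'.v i = k ∧
        ∃ B', I (k + 1) B' (σ'.setV i (k + 1)) ∧ t + B' + (e.cost + 7) ≤ B))
    (hb : b < 2 ^ w) {a B : ℕ} (hab : a ≤ b) (hσ : I a B σ) (hi : σ.v i = a) :
    HT w (forUp i e P) σ fun σ' t => σ'.v i = b ∧
      ∃ B', I b B' σ' ∧ t + B' ≤ B + (e.cost + 3) := by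
  refine (HT.whl (I := fun C σ => ∃ k B, I k B σ ∧ σ.v i = k ∧ k ≤ b ∧ C = B + (e.cost + 3)) hw
    ?_ ⟨a, B, hσ, hi, hab, rfl⟩).mono ?_
  · rintro C σ ⟨k, B, h1, h2, h3, rfl⟩
    obtain ⟨h4, h5, h6⟩ := hI k B σ h1 h2 h3
    have hwk : 2 ^ 1 ≤ 2 ^ w := Nat.pow_le_pow_right (by norm_num) hw
    refine ⟨⟨by simp only [Ex.safe_v]; omega, h4⟩, by simp only [Ex.cost_lt, Ex.cost_v]; omega,
      fun hlt => ?_⟩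
    simp only [Ex.eval_lt, Ex.eval_v, h2, h5, ne_eq, ite_eq_right_iff, one_ne_zero, imp_false,
      not_not] at hlt
    refine HT.seq ((h6 hlt).mono ?_)
    rintro σ' t ⟨g1, B', g2, g3⟩
    refine HT.asg hw (by simp only [Ex.safe_add, Ex.safe_v, Ex.safe_ofNat, Ex.eval_v,
      Ex.eval_ofNat, g1]; omega) ?_
    refine ⟨_, ⟨k + 1, B', ?_, ?_, hlt, rfl⟩, ?_⟩
    · simpa [g1] using g2
    · simp [g1]
    · simp only [Ex.cost_lt, Ex.cost_v, Ex.cost_add, Ex.cost_ofNat]; omega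
  · rintro σ' t ⟨B', ⟨k, B1, h1, h2, h3, rfl⟩, h4, h5⟩
    obtain ⟨h7, h8, h9⟩ := hI k B1 σ' h1 h2 h3
    simp only [Ex.eval_lt, Ex.eval_v, h2, h8, ite_eq_right_iff, one_ne_zero, imp_false,
      not_lt, Ex.cost_lt, Ex.cost_v] at h4 h5
    obtain rfl : k = b := le_antisymm h3 h4
    exact ⟨h2, B1, h1, by omega⟩

end rules

end WordRAM

/-! ### Climbing in the forest of representatives -/

namespace LevelSystem

variable {n : ℕ} {rel : ℕ → ℕ → ℕ → Prop}

theorem dep_par_le (h : LevelSystem n rel) (x : ℕ) : dep rel (par rel x) ≤ dep rel x := by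
  rcases Nat.eq_zero_or_pos (dep rel x) with e | e
  · rw [par, if_pos e, h.dep_zero]; omega
  · exact (h.dep_par_lt e).le

theorem par_le_pred (h : LevelSystem n rel) (x : ℕ) : par rel x ≤ x - 1 := by
  rcases Nat.eq_zero_or_pos (dep rel x) with e | e
  · rw [par, if_pos e]; omega
  · have := h.par_lt e; omega

theorem iterate_par_le (h : LevelSystem n rel) (j x : ℕ) : (par rel)^[j] x ≤ x - j := by
  induction j with
  | zero => simp
  | succ j ih =>
    rw [Function.iterate_succ_apply']
    have := h.par_le_pred ((par rel)^[j] x)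
    omega

theorem rp_iterate_par (h : LevelSystem n rel) {L x j : ℕ}
    (hj : L < dep rel ((par rel)^[j] x)) : rp rel L ((par rel)^[j] x) = rp rel L x := by
  induction j with
  | zero => rfl
  | succ j ih =>
    rw [Function.iterate_succ_apply'] at hj ⊢
    have := h.dep_par_le ((par rel)^[j] x)
    rw [h.rp_par (by omega), ih (by omega)]

end LevelSystem

/-- Entries of a two-dimensional array of width `M` have different addresses. -/
theorem mul_add_inj {M a b a' b' : ℕ} (hb : b < M) (hb' : b' < M) :
    a * M + b = a' * M + b' ↔ a = a' ∧ b = b' := by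
  constructor
  · intro e
    have h1 := congrArg (· / M) e
    have h2 := congrArg (· % M) e
    have hM : 0 < M := by omega
    simp only [Nat.mul_add_mod', Nat.mod_eq_of_lt hb, Nat.mod_eq_of_lt hb'] at h2
    simp only [mul_comm _ M, Nat.mul_add_div hM, Nat.div_eq_of_lt hb, Nat.div_eq_of_lt hb',
      add_zero] at h1
    exact ⟨h1, h2⟩
  · rintro ⟨rfl, rfl⟩; rfl

theorem mul_add_lt {M a b : ℕ} (ha : a < M) (hb : b < M) : a * M + b < M * M := by
  have : (a + 1) * M ≤ M * M := Nat.mul_le_mul_right M ha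
  rw [add_mul, one_mul] at this
  omega

namespace WordRAM

/-- The word length `w` suffices for inputs of length `n`: here `M = n + 1` is the width of
two-dimensional arrays, `C` exceeds all codes, and `K` is the number of bits of `n`. -/
structure Env (w n M C K : ℕ) : Prop where
  hw : 1 ≤ w
  hn : 1 ≤ n
  hM : M = n + 1
  hK1 : 1 ≤ K
  hK2 : K ≤ n
  hK : n < 2 ^ K
  hC : M ≤ C
  hbig : 4 * (M * M * C) ≤ 2 ^ w

namespace Env

variable {w n M C K : ℕ}

theorem sq_lt (h : Env w n M C K) : 4 * (M * M) < 2 ^ w := by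
  have h1 := h.hM
  have h2 := h.hC
  have h3 := h.hbig
  have h4 := h.hn
  have h5 : M * M * 2 ≤ M * M * C := Nat.mul_le_mul_left _ (by omega)
  have h6 : 1 * 1 ≤ M * M := Nat.mul_le_mul (by omega) (by omega)
  omega

theorem le_sq (h : Env w n M C K) : 2 * M ≤ M * M := by
  have h1 := h.hM
  have h4 := h.hn
  exact Nat.mul_le_mul_right M (by omega)

theorem four_le_sq (h : Env w n M C K) : 4 ≤ M * M := by
  have h1 := h.hM
  have h4 := h.hn
  exact Nat.mul_le_mul (show 2 ≤ M by omega) (show 2 ≤ M by omega)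

end Env

/-- Variables `0, …, 3` hold the parameters of the computation. -/
structure Cfg (n M C K : ℕ) (σ : St) : Prop where
  v0 : σ.v 0 = n
  v1 : σ.v 1 = M
  v2 : σ.v 2 = C
  v3 : σ.v 3 = K

theorem Cfg.of_eq {n M C K : ℕ} {σ σ' : St} (h : Cfg n M C K σ)
    (he : ∀ i < 10, σ'.v i = σ.v i) : Cfg n M C K σ' :=
  ⟨by rw [he 0 (by omega), h.v0], by rw [he 1 (by omega), h.v1], by rw [he 2 (by omega), h.v2],
    by rw [he 3 (by omega), h.v3]⟩

/-- Array `o` holds the depths of the positions up to `m`, and array `o + 1` their `2 ^ k`-th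
ancestors. -/
structure TreeData (rel : ℕ → ℕ → ℕ → Prop) (M K o m : ℕ) (σ : St) : Prop where
  dep : ∀ x ≤ m, σ.a o x = dep rel x
  anc : ∀ x ≤ m, ∀ k < K, σ.a (o + 1) (x * M + k) = (par rel)^[2 ^ k] x

theorem TreeData.of_eq {rel : ℕ → ℕ → ℕ → Prop} {M K o m : ℕ} {σ σ' : St}
    (h : TreeData rel M K o m σ) (h1 : σ'.a o = σ.a o) (h2 : σ'.a (o + 1) = σ.a (o + 1)) :
    TreeData rel M K o m σ' := ⟨by rw [h1]; exact h.dep, by rw [h2]; exact h.anc⟩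

/-- Replaces `x` in variable `20` by the least position equivalent to `x` at the level `L` given in
variable `21`, by binary lifting. -/
def climb (o : ℕ) : Prog :=
  ite (.lt (.v 21) (.rd o (.v 20)))
    (.seq (asg 22 (.v 3))
    (.seq (whl (.v 22)
      (.seq (asg 22 (.v 22 - 1))
        (ite (.lt (.v 21) (.rd o (.rd (o + 1) (.v 20 * .v 1 + .v 22))))
          (asg 20 (.rd (o + 1) (.v 20 * .v 1 + .v 22)))
          .skip)))
    (asg 20 (.rd (o + 1) (.v 20 * .v 1)))))
    .skip

section climb

variable {w n M C K : ℕ} {rel : ℕ → ℕ → ℕ → Prop}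

theorem climb_spec (hE : Env w n M C K) (h : LevelSystem n rel) {o m x L : ℕ} {σ : St}
    (hc : Cfg n M C K σ) (hT : TreeData rel M K o m σ) (hm : m ≤ n) (hx : σ.v 20 = x)
    (hxm : x ≤ m) (hL : σ.v 21 = L) (hLn : L ≤ n) :
    HT w (climb o) σ fun σ' t => t ≤ 30 * K + 30 ∧ σ'.v 20 = rp rel L x ∧
      (∀ i, i ≠ 20 → i ≠ 22 → σ'.v i = σ.v i) ∧ σ'.a = σ.a ∧ σ'.x = σ.x := by
  have hw := hE.hw
  have hM := hE.hM
  have hK2 := hE.hK2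
  have b1 := hE.sq_lt
  have b2 := hE.le_sq
  have b3 := h.dep_le_succ
  have b4 : ∀ j y, y ≤ m → (par rel)^[j] y ≤ m := fun j y hy => by
    have := h.iterate_par_le j y; omega
  have b5 : ∀ a b, a ≤ n → b ≤ n → a * M + b < M * M := fun a b ha hb =>
    mul_add_lt (by omega) (by omega)
  refine HT.ite hw ?_ (fun hlt => ?_) (fun hlt => ?_)
  · simp only [Ex.safe_lt, Ex.safe_v, Ex.safe_rd, Ex.eval_v, hx, hL, hT.dep x hxm]
    have := b3 x
    omega
  · simp only [Ex.eval_lt, Ex.eval_v, Ex.eval_rd, hx, hL, hT.dep x hxm, ne_eq, ite_eq_right_iff,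
      one_ne_zero, imp_false, not_not] at hlt
    refine HT.seq (HT.asg hw (by simp only [Ex.safe_v, hc.v3]; omega) ?_)
    refine HT.seq ?_
    refine (HT.whl hw (I := fun B σ' => ∃ k y, B = 28 * k + 2 ∧ σ'.v 22 = k ∧ σ'.v 20 = y ∧
      k ≤ K ∧ y ≤ m ∧ L < dep rel y ∧ rp rel L y = rp rel L x ∧
      dep rel ((par rel)^[2 ^ k] y) ≤ L ∧
      (∀ i, i ≠ 20 → i ≠ 22 → σ'.v i = σ.v i) ∧ σ'.a = σ.a ∧ σ'.x = σ.x) (B := 28 * K + 2)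
      ?_ ?_).mono ?_
    · rintro B σ1 ⟨k, y, rfl, h22, h20, hk, hy, hLy, hrp, hdep, hv, ha, hσx⟩
      refine ⟨by simp only [Ex.safe_v, h22]; omega, by simp only [Ex.cost_v]; omega, fun hne => ?_⟩
      simp only [Ex.eval_v, h22, ne_eq] at hne
      obtain ⟨k, rfl⟩ := Nat.exists_eq_succ_of_ne_zero hne
      refine HT.seq (HT.asg hw ?_ ?_)
      · simp only [Ex.safe_sub, Ex.safe_v, Ex.safe_ofNat, Ex.eval_v, Ex.eval_ofNat, h22]
        omega
      have e1 : σ1.v 1 = M := by rw [hv 1 (by omega) (by omega), hc.v1]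
      have e21 : σ1.v 21 = L := by rw [hv 21 (by omega) (by omega), hL]
      have eu := hT.anc y hy k (by omega)
      have hu := b4 (2 ^ k) y hy
      have bu := b3 ((par rel)^[2 ^ k] y)
      have ba := b5 y k (by omega) (by omega)
      have bm : y * M ≤ y * M + k := by omega
      have hsafe : (Ex.rd (o + 1) (.v 20 * .v 1 + .v 22)).Safe w (σ1.setV 22 k) := by
        simp [h20, e1, ha, eu]
        omega
      have hev : (Ex.rd (o + 1) (.v 20 * .v 1 + .v 22)).eval (σ1.setV 22 k) =
          (par rel)^[2 ^ k] y := by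
        simp [h20, e1, ha, eu]
      have e22 : (Ex.v 22 - 1).eval σ1 = k := by simp [h22]
      rw [e22]
      refine HT.ite hw ?_ (fun hlt' => ?_) (fun hlt' => ?_)
      · rw [Ex.safe_lt]
        refine ⟨by simp [e21]; omega, ?_⟩
        rw [Ex.safe_rd]
        refine ⟨hsafe, ?_⟩
        rw [hev, St.setV_a, ha, hT.dep _ hu]
        omega
      · rw [Ex.eval_lt, Ex.eval_rd, hev, St.setV_a, ha, hT.dep _ hu] at hlt'
        simp [e21] at hlt'
        refine HT.asg hw hsafe ?_
        refine ⟨28 * k + 2, ⟨k, (par rel)^[2 ^ k] y, rfl, by simp, by simp [hev],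
          by omega, hu, hlt', (h.rp_iterate_par hlt').trans hrp, ?_, ?_, ha, hσx⟩, ?_⟩
        · rw [← Function.iterate_add_apply]
          rwa [← Nat.two_mul, ← pow_succ']
        · intro i h1 h2
          simp [h1, h2, hv i h1 h2]
        · simp only [Ex.cost_v, Ex.cost_sub, Ex.cost_ofNat, Ex.cost_lt, Ex.cost_rd, Ex.cost_add,
            Ex.cost_mul]
          omega
      · rw [Ex.eval_lt, Ex.eval_rd, hev, St.setV_a, ha, hT.dep _ hu] at hlt'
        simp [e21] at hlt'
        refine HT.skip ⟨28 * k + 2, ⟨k, y, rfl, by simp, by simp [h20], by omega, hy, hLy, hrp,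
          hlt', ?_, ha, hσx⟩, ?_⟩
        · intro i h1 h2
          simp [h2, hv i h1 h2]
        · simp only [Ex.cost_v, Ex.cost_sub, Ex.cost_ofNat, Ex.cost_lt, Ex.cost_rd, Ex.cost_add,
            Ex.cost_mul]
          omega
    · refine ⟨K, x, rfl, by simp [hc.v3], by simp [hx], le_rfl, hxm, hlt, rfl, ?_, ?_, rfl, rfl⟩
      · have h1 := h.iterate_par_le (2 ^ K) x
        have h2 := hE.hK
        rw [show (par rel)^[2 ^ K] x = 0 by omega, h.dep_zero]
        omega
      · intro i h1 h2
        simp [h2]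
    · rintro σ1 t ⟨B, ⟨k, y, rfl, h22, h20, hk, hy, hLy, hrp, hdep, hv, ha, hσx⟩, h0, ht⟩
      simp only [Ex.eval_v, h22] at h0
      subst h0
      have e1 : σ1.v 1 = M := by rw [hv 1 (by omega) (by omega), hc.v1]
      have eu := hT.anc y hy 0 hE.hK1
      have hu := b4 (2 ^ 0) y hy
      have ba := b5 y 0 (by omega) (by omega)
      simp only [add_zero, pow_zero, Function.iterate_one] at eu hu ba
      have hsafe : (Ex.rd (o + 1) (.v 20 * .v 1)).Safe w σ1 := by
        simp only [Ex.safe_rd, Ex.safe_mul, Ex.safe_v, Ex.eval_mul, Ex.eval_v, h20, e1, ha, eu]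
        omega
      refine HT.asg hw hsafe ⟨?_, ?_, ?_, ha, hσx⟩
      · simp only [Ex.cost_v, Ex.cost_lt, Ex.cost_rd, Ex.cost_mul] at ht ⊢
        omega
      · simp only [pow_zero, Function.iterate_one] at hdep
        simp only [St.setV_v, if_true, Ex.eval_rd, Ex.eval_mul, Ex.eval_v, h20, e1, ha, eu]
        rw [← hrp, ← h.rp_par hLy, h.rp_eq_self_iff.2 hdep]
      · intro i h1 h2
        simp [h1, hv i h1 h2]
  · simp only [Ex.eval_lt, Ex.eval_v, Ex.eval_rd, hx, hL, hT.dep x hxm, ite_eq_right_iff,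
      one_ne_zero, imp_false, not_lt] at hlt
    refine HT.skip ⟨by simp, ?_, fun i _ _ => rfl, rfl, rfl⟩
    rw [hx, h.rp_eq_self_iff.2 hlt]

end climb

end WordRAM

/-! ### Construction of the forest -/

/-- `code` is a family of codes below `C` for the level system `rel`: two positions that are
equivalent at level `L` are equivalent at level `L + 1` if and only if their codes for the
length `L + 1` agree. -/
structure CodeFn (n C : ℕ) (rel : ℕ → ℕ → ℕ → Prop) (code : ℕ → ℕ → ℕ) : Prop where
  lt : ∀ x L, 1 ≤ x → 1 ≤ L → x + L ≤ n + 1 → code x L < C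
  iff : ∀ L x y, 1 ≤ x → x + L ≤ n → 1 ≤ y → y + L ≤ n →
    (rel (L + 1) x y ↔ rel L x y ∧ code x (L + 1) = code y (L + 1))

/-- The position `j` is stored in the dictionary under the key `(l, v, c)`: it branches off at
depth `l` from the class of `v`, and `c` is the code of its first continuation. -/
def IsKey (n : ℕ) (rel : ℕ → ℕ → ℕ → Prop) (code : ℕ → ℕ → ℕ) (j l v c : ℕ) : Prop :=
  dep rel j = l + 1 ∧ par rel j = v ∧ j + l ≤ n ∧ code j (l + 1) = c

namespace LevelSystem

variable {n C : ℕ} {rel : ℕ → ℕ → ℕ → Prop} {code : ℕ → ℕ → ℕ}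

theorem dep_par_eq (h : LevelSystem n rel) {i l : ℕ} (hr : rel l i (rp rel l i))
    (hlt : rp rel l i < i) (hne : ∀ j < i, ¬ rel (l + 1) i j) :
    dep rel i = l + 1 ∧ par rel i = rp rel l i := by
  have h1 : dep rel i ≤ l + 1 := h.dep_le_iff.2 hne
  have h2 : l < dep rel i := h.lt_dep_iff.2 ⟨_, hlt, hr⟩
  have h3 : dep rel i = l + 1 := by omega
  refine ⟨h3, ?_⟩
  rw [h.par_of_pos (by omega), h3, Nat.add_sub_cancel]

theorem rp_succ_of_code_eq (h : LevelSystem n rel) (hc : CodeFn n C rel code) {i l : ℕ}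
    (hi : 1 ≤ i) (hin : i + l ≤ n) (he : code i (l + 1) = code (rp rel l i) (l + 1)) :
    rp rel (l + 1) i = rp rel l i := by
  have h1 := h.rel_rp (L := l) hi (by omega)
  have h2 := h.rp_le l i
  have h3 := (hc.iff l i (rp rel l i) hi hin (h.valid_right h1).1 (by omega)).2 ⟨h1, he⟩
  apply le_antisymm (h.rp_le_of_rel h3)
  exact h.rp_le_of_rel (h.mono (h.rel_rp hi (by omega)))

theorem rp_succ_of_isKey (h : LevelSystem n rel) (hc : CodeFn n C rel code) {i l u : ℕ}
    (hi : 1 ≤ i) (hin : i + l ≤ n) (hu : 1 ≤ u)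
    (hk : IsKey n rel code u l (rp rel l i) (code i (l + 1))) : rp rel (l + 1) i = u := by
  obtain ⟨h1, h2, h3, h4⟩ := hk
  have r1 := h.rel_rp (L := l) hi (by omega)
  have r2 := h.rel_par (x := u) (by omega)
  rw [h1, h2, Nat.add_sub_cancel] at r2
  have r3 := (hc.iff l i u hi hin hu h3).2 ⟨h.trans r1 (h.symm r2), h4.symm⟩
  rw [h.rp_eq_of_rel r3, h.rp_eq_self_iff, h1]

/-- If position `i` has neither the continuation of its class representative nor one that is stored in
the dictionary, then it branches off. -/
theorem dep_par_eq_of_miss (h : LevelSystem n rel) (hc : CodeFn n C rel code) {i l : ℕ}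
    (hi : 1 ≤ i) (hin : i + l ≤ n) (hlt : rp rel l i < i)
    (hne : code i (l + 1) ≠ code (rp rel l i) (l + 1))
    (hk : ∀ j, 2 ≤ j → j < i → ¬ IsKey n rel code j l (rp rel l i) (code i (l + 1))) :
    dep rel i = l + 1 ∧ par rel i = rp rel l i := by
  refine h.dep_par_eq (h.rel_rp hi (by omega)) hlt fun j hj hr => ?_
  -- It suffices to consider the least position `u` equivalent to `i` at level `l + 1`.
  have hu := h.rel_rp (L := l + 1) hi (by omega)
  have hui := (h.rp_le_of_rel hr).trans_lt hj
  generalize hue : rp rel (l + 1) i = u at hu hui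
  have v := h.valid_right hu
  obtain ⟨g1, g2⟩ := (hc.iff l i u hi hin v.1 (by omega)).1 hu
  have g3 : dep rel u ≤ l + 1 := hue ▸ h.dep_rp_le i (l + 1)
  rcases Nat.lt_or_ge l (dep rel u) with g4 | g4
  · have g5 : dep rel u = l + 1 := by omega
    have g6 : u ≠ 1 := fun e => by rw [e, h.dep_one] at g5; omega
    refine hk u (by omega) hui ⟨g5, ?_, by omega, g2.symm⟩
    rw [h.par_of_pos (by omega), g5, Nat.add_sub_cancel, h.rp_eq_of_rel g1]
  · have g5 := h.rp_eq_self_iff.2 g4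
    rw [← h.rp_eq_of_rel g1] at g5
    rw [g5] at hne
    exact hne g2

/-- The shift property gives an equivalence for `i` from the one between `i - 1` and its parent. -/
theorem start_rel (h : LevelSystem n rel) {i : ℕ} (hi : 2 ≤ i) (hin : i ≤ n) :
    rel (dep rel (i - 1) - 2) i (par rel (i - 1) + 1) ∧ par rel (i - 1) + 1 < i := by
  have h1 := h.par_le_pred (i - 1)
  refine ⟨?_, by omega⟩
  rcases Nat.lt_or_ge (dep rel (i - 1)) 2 with h2 | h2
  · rw [show dep rel (i - 1) - 2 = 0 by omega]
    exact h.zero (by omega) (by omega) (by omega) (by omega)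
  · have h3 := h.rel_par (x := i - 1) (by omega)
    rw [show dep rel (i - 1) - 1 = dep rel (i - 1) - 2 + 1 by omega] at h3
    have h4 := h.shift h3
    rwa [show i - 1 + 1 = i by omega] at h4

end LevelSystem

namespace WordRAM

/-- The program `Q` computes `code x L` into variable `12` from `x` and `L` in the variables `10` and
`11`, in time `τ`, whenever the condition `QI` holds, which depends on the
embedded store, on the variables below `10` and on arrays outside of `[lo, hi)` only. -/
structure Query (w n : ℕ) (code : ℕ → ℕ → ℕ) (τ : ℕ) (Q : Prog) (QI : St → Prop) (lo hi : ℕ) :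
    Prop where
  run : ∀ σ x L, QI σ → σ.v 10 = x → σ.v 11 = L → 1 ≤ x → 1 ≤ L → x + L ≤ n + 1 →
    HT w Q σ fun σ' t => t ≤ τ ∧ QI σ' ∧ σ'.v 12 = code x L ∧
      (∀ i, i < 10 ∨ 30 ≤ i → σ'.v i = σ.v i) ∧ σ'.a = σ.a
  stable : ∀ σ σ', QI σ → σ'.x = σ.x → (∀ i < 10, σ'.v i = σ.v i) →
    (∀ A, A < lo ∨ hi ≤ A → σ'.a A = σ.a A) → QI σ'

/-- The dictionary in array `o + 2` contains exactly the positions up to `m`. -/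
def DictOK (n M C : ℕ) (rel : ℕ → ℕ → ℕ → Prop) (code : ℕ → ℕ → ℕ) (o m : ℕ) (σ : St) : Prop :=
  ∀ l ≤ n, ∀ v ≤ n, ∀ c < C,
    (σ.a (o + 2) ((l * M + v) * C + c) ≠ 0 →
      2 ≤ σ.a (o + 2) ((l * M + v) * C + c) ∧ σ.a (o + 2) ((l * M + v) * C + c) ≤ m ∧
      IsKey n rel code (σ.a (o + 2) ((l * M + v) * C + c)) l v c) ∧
    ∀ j, 2 ≤ j → j ≤ m → IsKey n rel code j l v c → σ.a (o + 2) ((l * M + v) * C + c) ≠ 0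

theorem DictOK.of_eq {n M C : ℕ} {rel : ℕ → ℕ → ℕ → Prop} {code : ℕ → ℕ → ℕ} {o m : ℕ} {σ σ' : St}
    (h : DictOK n M C rel code o m σ) (ha : σ'.a (o + 2) = σ.a (o + 2)) :
    DictOK n M C rel code o m σ' := by
  unfold DictOK
  rw [ha]
  exact h

/-- Inserting a position that ends at its branching point, hence has no continuation. -/
theorem DictOK.succ_of_not {n M C : ℕ} {rel : ℕ → ℕ → ℕ → Prop} {code : ℕ → ℕ → ℕ} {o i l : ℕ}
    {σ : St} (hi : 1 ≤ i) (h : DictOK n M C rel code o (i - 1) σ) (hd : dep rel i = l + 1)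
    (hn : n < i + l) : DictOK n M C rel code o i σ := by
  intro l' hl v hv c hc
  obtain ⟨h1, h2⟩ := h l' hl v hv c hc
  refine ⟨fun hne => ?_, fun j hj hji hk => ?_⟩
  · obtain ⟨g1, g2, g3⟩ := h1 hne
    exact ⟨g1, by omega, g3⟩
  · rcases Nat.lt_or_ge j i with g | g
    · exact h2 j hj (by omega) hk
    · obtain rfl : j = i := by omega
      have := hk.1
      have := hk.2.2.1
      omega

theorem DictOK.insert {n M C : ℕ} {rel : ℕ → ℕ → ℕ → Prop} {code : ℕ → ℕ → ℕ} {o i l v c : ℕ}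
    {σ σ' : St} (hi : 2 ≤ i) (hMn : M = n + 1) (h : DictOK n M C rel code o (i - 1) σ)
    (hk : IsKey n rel code i l v c) (hv : v ≤ n) (hc : c < C)
    (ha : ∀ j, σ'.a (o + 2) j = if j = (l * M + v) * C + c then i else σ.a (o + 2) j) :
    DictOK n M C rel code o i σ' := by
  intro l' hl v' hv' c' hc'
  have hiff : (l' * M + v') * C + c' = (l * M + v) * C + c ↔ l' = l ∧ v' = v ∧ c' = c := by
    rw [mul_add_inj hc' hc, mul_add_inj (by omega) (by omega), and_assoc]
  rw [ha]
  simp only [hiff]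
  by_cases he : l' = l ∧ v' = v ∧ c' = c
  · rw [if_pos he]
    obtain ⟨rfl, rfl, rfl⟩ := he
    exact ⟨fun _ => ⟨hi, le_rfl, hk⟩, fun _ _ _ _ => by omega⟩
  · rw [if_neg he]
    obtain ⟨h1, h2⟩ := h l' hl v' hv' c' hc'
    refine ⟨fun hne => ?_, fun j hj hji hk' => ?_⟩
    · obtain ⟨g1, g2, g3⟩ := h1 hne
      exact ⟨g1, by omega, g3⟩
    · rcases Nat.lt_or_ge j i with g | g
      · exact h2 j hj (by omega) hk'
      · obtain rfl : j = i := by omega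
        exact absurd ⟨by have := hk.1; have := hk'.1; omega, hk'.2.1.symm.trans hk.2.1,
          hk'.2.2.2.symm.trans ((congrArg _ (by have := hk.1; have := hk'.1; omega)).trans
            hk.2.2.2)⟩ he

/-- One step of the descent of position `i` (variable `30`) from the class of `v` (variable `32`) at
level `l` (variable `31`): continue with `v`, or with the position found in the dictionary,
or else insert `i` into the dictionary and stop by clearing variable `33`. -/
def descendStep (o : ℕ) (Q : Prog) : Prog :=
  .seq (asg 10 (.v 30)) (.seq (asg 11 (.v 31 + 1)) (.seq Q (.seq (asg 34 (.v 12))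
  (.seq (asg 10 (.v 32)) (.seq (asg 11 (.v 31 + 1)) (.seq Q
  (ite (.eq (.v 34) (.v 12))
    (.seq (asg 31 (.v 31 + 1)) (asg 33 (.lt (.v 30 + .v 31) (.v 1))))
    (.seq (asg 35 ((.v 31 * .v 1 + .v 32) * .v 2 + .v 34))
    (ite (.rd (o + 2) (.v 35))
      (.seq (asg 32 (.rd (o + 2) (.v 35)))
        (.seq (asg 31 (.v 31 + 1)) (asg 33 (.lt (.v 30 + .v 31) (.v 1)))))
      (.seq (put (o + 2) (.v 35) (.v 30)) (asg 33 0)))))))))))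

/-- The state of the descent of position `i`: either it is still going on in the class of
`v = rp l i`, or the depth of `i` and its parent have been found and `i` has been inserted. -/
def Descent (n M C : ℕ) (rel : ℕ → ℕ → ℕ → Prop) (code : ℕ → ℕ → ℕ) (o i l v flag : ℕ) (σ : St) :
    Prop :=
  (flag = 1 ∧ i + l ≤ n ∧ rp rel l i = v ∧ v < i ∧ DictOK n M C rel code o (i - 1) σ) ∨
  (flag = 0 ∧ dep rel i = l + 1 ∧ par rel i = v ∧ DictOK n M C rel code o i σ)

section phase1

variable {w n M C K : ℕ} {rel : ℕ → ℕ → ℕ → Prop} {code : ℕ → ℕ → ℕ} {τ : ℕ} {Q : Prog}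
  {QI : St → Prop} {o : ℕ}

theorem Descent.enter (h : LevelSystem n rel) (hM : M = n + 1) {i l v : ℕ} {σ : St} (hi : 1 ≤ i)
    (hin : i + l ≤ n + 1) (hrp : rp rel l i = v) (hv : v < i)
    (hD : DictOK n M C rel code o (i - 1) σ) :
    Descent n M C rel code o i l v (if i + l < M then 1 else 0) σ := by
  by_cases hlt : i + l < M
  · exact Or.inl ⟨if_pos hlt, by omega, hrp, hv, hD⟩
  · obtain ⟨h1, h2⟩ := h.dep_par_eq (h.rel_rp hi hin) (hrp ▸ hv) fun j _ hr => by
      have := h.valid hr; omega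
    exact Or.inr ⟨if_neg hlt, h1, h2.trans hrp, hD.succ_of_not hi h1 (by omega)⟩

theorem descendStep_spec (hE : Env w n M C K) (h : LevelSystem n rel) (hc : CodeFn n C rel code)
    (hQ : Query w n code τ Q QI o (o + 10)) {i l v : ℕ} {σ : St} (hcfg : Cfg n M C K σ)
    (hqi : QI σ) (h30 : σ.v 30 = i) (h31 : σ.v 31 = l) (h32 : σ.v 32 = v) (hi2 : 2 ≤ i)
    (hin : i + l ≤ n) (hrp : rp rel l i = v) (hvi : v < i)
    (hD : DictOK n M C rel code o (i - 1) σ) :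
    HT w (descendStep o Q) σ fun σ' t => t ≤ 2 * τ + 60 ∧ QI σ' ∧
      (∃ l' v' f', σ'.v 31 = l' ∧ σ'.v 32 = v' ∧ σ'.v 33 = f' ∧ l ≤ l' ∧ (f' = 1 → l < l') ∧
        Descent n M C rel code o i l' v' f' σ') ∧
      (∀ j, j < 10 ∨ j = 30 → σ'.v j = σ.v j) ∧
      (∀ A, A ≠ o + 2 → σ'.a A = σ.a A) := by
  have hw := hE.hw
  have hM := hE.hM
  have b1 := hE.sq_lt
  have b2 := hE.le_sq
  have b3 : ∀ a b c, a ≤ n → b ≤ n → c < C → (a * M + b) * C + c < M * M * C := by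
    intro a b c ha hb hcc
    have h1 : a * M + b < M * M := mul_add_lt (by omega) (by omega)
    have h2 : (a * M + b + 1) * C ≤ M * M * C := Nat.mul_le_mul_right C h1
    rw [add_mul (a * M + b), one_mul] at h2
    omega
  have b4 := hE.hbig
  have b5 : C ≤ M * M * C := Nat.le_mul_of_pos_left C (by omega)
  have hv1 : 1 ≤ v := hrp ▸ h.one_le_rp (by omega)
  have hci := hc.lt i (l + 1) (by omega) (by omega) (by omega)
  have hcv := hc.lt v (l + 1) (by omega) (by omega) (by omega)
  have ba0 : l * M + v < M * M := mul_add_lt (by omega) (by omega)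
  have ba := b3 l v (code i (l + 1)) (by omega) (by omega) hci
  have he : ∀ σ', σ'.v 30 = i → σ'.v 31 = l + 1 → σ'.v 1 = M →
      Ex.eval σ' (.lt (.v 30 + .v 31) (.v 1)) = if i + (l + 1) < M then 1 else 0 := by
    intro σ' e1 e2 e3
    simp [e1, e2, e3]
  unfold descendStep
  refine HT.seq (HT.asg hw (by simp [h30]; omega) (HT.seq (HT.asg hw (by simp [h31]; omega) ?_)))
  refine HT.seq ((hQ.run _ i (l + 1) ?_ ?_ ?_ ?_ ?_ ?_).mono ?_)
  · refine hQ.stable σ _ hqi rfl ?_ fun A _ => rfl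
    intro j hj; simp [show j ≠ 10 by omega, show j ≠ 11 by omega]
  · simp [h30]
  · simp [h31]
  · omega
  · omega
  · omega
  rintro σ1 t1 ⟨ht1, hqi1, h12, hv', ha'⟩
  have hv1' : ∀ j, j < 10 ∨ 30 ≤ j → σ1.v j = σ.v j := fun j hj => by
    rw [hv' j hj]; simp [show j ≠ 10 by omega, show j ≠ 11 by omega]
  clear hv'
  have ha1 : σ1.a = σ.a := ha'
  clear ha'
  have k30 := (hv1' 30 (by omega)).trans h30
  have k31 := (hv1' 31 (by omega)).trans h31
  have k32 := (hv1' 32 (by omega)).trans h32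
  refine HT.seq (HT.asg hw (by simp [h12]; omega) ?_)
  refine HT.seq (HT.asg hw (by simp [k32]; omega) (HT.seq (HT.asg hw (by simp [k31]; omega) ?_)))
  refine HT.seq ((hQ.run _ v (l + 1) ?_ ?_ ?_ hv1 ?_ ?_).mono ?_)
  · refine hQ.stable σ1 _ hqi1 rfl ?_ fun A _ => rfl
    intro j hj; simp [show j ≠ 10 by omega, show j ≠ 11 by omega, show j ≠ 34 by omega]
  · simp [k32]
  · simp [k31]
  · omega
  · omega
  rintro σ2 t2 ⟨ht2, hqi2, h12', hv', ha'⟩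
  have k34 : σ2.v 34 = code i (l + 1) := by rw [hv' 34 (by omega)]; simp [h12]
  have hv2 : ∀ j, j < 10 ∨ 30 ≤ j ∧ j ≠ 34 → σ2.v j = σ.v j := fun j hj => by
    rw [hv' j (by omega)]
    simp [show j ≠ 10 by omega, show j ≠ 11 by omega, show j ≠ 34 by omega, hv1' j (by omega)]
  clear hv'
  have ha2 : σ2.a = σ.a := ha'.trans ha1
  clear ha'
  replace k30 := (hv2 30 (by omega)).trans h30
  replace k31 := (hv2 31 (by omega)).trans h31
  replace k32 := (hv2 32 (by omega)).trans h32
  have m1 : σ2.v 1 = M := (hv2 1 (by omega)).trans hcfg.v1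
  have m2 : σ2.v 2 = C := (hv2 2 (by omega)).trans hcfg.v2
  have hD2 : DictOK n M C rel code o (i - 1) σ2 := hD.of_eq (by rw [ha2])
  refine HT.ite hw (by simp [k34, h12']; omega) (fun heq => ?_) (fun hne => ?_)
  · simp [k34, h12'] at heq
    refine HT.seq (HT.asg hw (by simp [k31]; omega) ?_)
    refine HT.asg hw (by simp [k30, k31, m1]; omega) ⟨?_, ?_, ⟨l + 1, v, _, ?_, ?_, rfl, by omega,
      fun _ => by omega, ?_⟩, ?_, ?_⟩
    · simp; omega
    · refine hQ.stable σ2 _ hqi2 rfl (fun j hj => ?_) (fun A _ => rfl)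
      simp [show j ≠ 31 by omega, show j ≠ 33 by omega]
    · simp [k31]
    · simp [k32]
    · rw [he _ (by simp [k30]) (by simp [k31]) (by simp [m1])]
      exact Descent.enter h hM (by omega) (by omega)
        ((h.rp_succ_of_code_eq hc (by omega) hin (by rw [heq, hrp])).trans hrp) hvi
        (hD2.of_eq rfl)
    · intro j hj
      simp [show j ≠ 31 by omega, show j ≠ 33 by omega, hv2 j (by omega)]
    · intro A _
      simp [ha2]
  · simp [k34, h12'] at hne
    refine HT.seq (HT.asg hw (by simp [k31, m1, k32, m2, k34]; omega) ?_)
    have e35 : Ex.eval σ2 ((.v 31 * .v 1 + .v 32) * .v 2 + .v 34) =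
        (l * M + v) * C + code i (l + 1) := by simp [k31, m1, k32, m2, k34]
    rw [e35]
    obtain ⟨hd1, hd2⟩ := hD2 l (by omega) v (by omega) _ hci
    have hu : σ2.a (o + 2) ((l * M + v) * C + code i (l + 1)) ≤ n := by
      by_cases e : σ2.a (o + 2) ((l * M + v) * C + code i (l + 1)) = 0
      · omega
      · have := (hd1 e).2.1; omega
    refine HT.ite hw (by simp; omega) (fun hnz => ?_) (fun hz => ?_)
    · simp at hnz
      obtain ⟨g1, g2, g3⟩ := hd1 hnz
      generalize hue : σ2.a (o + 2) ((l * M + v) * C + code i (l + 1)) = u at *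
      refine HT.seq (HT.asg hw (by simp [hue]; omega) ?_)
      refine HT.seq (HT.asg hw (by simp [k31]; omega) ?_)
      refine HT.asg hw (by simp [k30, k31, m1]; omega) ⟨?_, ?_, ⟨l + 1, u, _, ?_, ?_, rfl,
        by omega, fun _ => by omega, ?_⟩, ?_, ?_⟩
      · simp; omega
      · refine hQ.stable σ2 _ hqi2 rfl (fun j hj => ?_) (fun A _ => rfl)
        simp [show j ≠ 31 by omega, show j ≠ 33 by omega, show j ≠ 32 by omega,
          show j ≠ 35 by omega]
      · simp [k31]
      · simp [hue]
      · rw [he _ (by simp [k30]) (by simp [k31]) (by simp [m1])]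
        exact Descent.enter h hM (by omega) (by omega)
          (h.rp_succ_of_isKey hc (by omega) hin (by omega) (hrp ▸ g3)) (by omega) (hD2.of_eq rfl)
      · intro j hj
        simp [show j ≠ 31 by omega, show j ≠ 33 by omega, show j ≠ 32 by omega,
          show j ≠ 35 by omega, hv2 j (by omega)]
      · intro A _
        simp [ha2]
    · simp at hz
      obtain ⟨g1, g2⟩ := h.dep_par_eq_of_miss hc (by omega) hin (hrp ▸ hvi)
        (by rw [hrp]; exact hne) (fun j hj hji hk => hd2 j hj (by omega) (hrp ▸ hk) hz)
      refine HT.seq (HT.put hw (by simp; omega) (by simp [k30]; omega) ?_)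
      refine HT.asg hw (by simp) ⟨?_, ?_, ⟨l, v, 0, ?_, ?_, ?_, le_rfl, by omega,
        Or.inr ⟨rfl, g1, g2.trans hrp, ?_⟩⟩, ?_, ?_⟩
      · simp; omega
      · refine hQ.stable σ2 _ hqi2 rfl (fun j hj => ?_) (fun A hA => ?_)
        · simp [show j ≠ 33 by omega, show j ≠ 35 by omega]
        · funext j
          simp [show A ≠ o + 2 by omega]
      · simp [k31]
      · simp [k32]
      · simp
      · refine hD2.insert hi2 hM ⟨g1, g2.trans hrp, hin, rfl⟩ (by omega) hci fun j => ?_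
        simp [k30]
      · intro j hj
        simp [show j ≠ 33 by omega, show j ≠ 35 by omega, hv2 j (by omega)]
      · intro A hA
        funext j
        simp [hA, ha2]

end phase1

end WordRAM

namespace WordRAM

/-- Stores the ancestors of position `i` (variable `30`), given that those of smaller positions and
the parent of `i` are known. -/
def storeAncestors (o : ℕ) : Prog :=
  .seq (asg 36 1) (forUp 36 (.v 3)
    (put (o + 1) (.v 30 * .v 1 + .v 36)
      (.rd (o + 1) (.rd (o + 1) (.v 30 * .v 1 + (.v 36 - 1)) * .v 1 + (.v 36 - 1)))))

/-- Inserts position `i` (variable `30`) into the forest, given that the smaller positions have been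
inserted. The descent starts at the class of `par (i - 1) + 1`, one level above the depth at
which `i - 1` branched off. -/
def insertPos (o : ℕ) (Q : Prog) : Prog :=
  .seq (asg 20 (.rd (o + 1) ((.v 30 - 1) * .v 1) + 1))
  (.seq (asg 21 (.rd o (.v 30 - 1) - (.lt 0 (.rd o (.v 30 - 1)) + .lt 1 (.rd o (.v 30 - 1)))))
  (.seq (climb o)
  (.seq (asg 31 (.v 21)) (.seq (asg 32 (.v 20)) (.seq (asg 33 (.lt (.v 30 + .v 31) (.v 1)))
  (.seq (whl (.v 33) (descendStep o Q))
  (.seq (put o (.v 30) (.v 31 + 1)) (.seq (put (o + 1) (.v 30 * .v 1) (.v 32))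
  (storeAncestors o)))))))))

/-- Computes the depths, the parents and all `2 ^ k`-th ancestors of all positions. -/
def buildForest (o : ℕ) (Q : Prog) : Prog :=
  .seq (asg 30 2) (forUp 30 (.v 1) (insertPos o Q))

section phase1

variable {w n M C K : ℕ} {rel : ℕ → ℕ → ℕ → Prop} {code : ℕ → ℕ → ℕ} {τ : ℕ} {Q : Prog}
  {QI : St → Prop} {o : ℕ}

theorem descend_spec (hE : Env w n M C K) (h : LevelSystem n rel) (hc : CodeFn n C rel code)
    (hQ : Query w n code τ Q QI o (o + 10)) {i l v f : ℕ} {σ : St} (hcfg : Cfg n M C K σ)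
    (hqi : QI σ) (h30 : σ.v 30 = i) (h31 : σ.v 31 = l) (h32 : σ.v 32 = v) (h33 : σ.v 33 = f)
    (hi2 : 2 ≤ i) (hD : Descent n M C rel code o i l v f σ) :
    HT w (whl (.v 33) (descendStep o Q)) σ fun σ' t =>
      t ≤ (dep rel i - l) * (2 * τ + 70) + 4 ∧ QI σ' ∧ σ'.v 31 + 1 = dep rel i ∧
      σ'.v 32 = par rel i ∧ DictOK n M C rel code o i σ' ∧
      (∀ j, j < 10 ∨ j = 30 → σ'.v j = σ.v j) ∧ (∀ A, A ≠ o + 2 → σ'.a A = σ.a A) := by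
  have hw := hE.hw
  have b1 := hE.sq_lt
  have b2 := hE.four_le_sq
  refine (HT.whl hw (I := fun B σ' => ∃ l' v' f', B = f' * ((dep rel i - l') * (2 * τ + 70)) + 2 ∧
    σ'.v 31 = l' ∧ σ'.v 32 = v' ∧ σ'.v 33 = f' ∧ Descent n M C rel code o i l' v' f' σ' ∧ QI σ' ∧
      (∀ j, j < 10 ∨ j = 30 → σ'.v j = σ.v j) ∧ (∀ A, A ≠ o + 2 → σ'.a A = σ.a A))
    ?_ ⟨l, v, f, rfl, h31, h32, h33, hD, hqi, fun _ _ => rfl, fun _ _ => rfl⟩).mono ?_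
  · rintro B σ1 ⟨l', v', f', rfl, g31, g32, g33, hD', hqi', hv, ha⟩
    refine ⟨?_, by simp only [Ex.cost_v]; omega, fun hne => ?_⟩
    · simp only [Ex.safe_v, g33]
      rcases hD' with h1 | h1 <;> omega
    · simp only [Ex.eval_v, g33] at hne
      rcases hD' with ⟨e1, e2, e3, e4, e5⟩ | ⟨e1, -⟩
      · refine (descendStep_spec hE h hc hQ (hcfg.of_eq fun j hj => hv j (Or.inl hj)) hqi'
          ((hv 30 (by omega)).trans h30) g31 g32 hi2 e2 e3 e4 e5).mono ?_
        rintro σ2 t ⟨ht, hqi2, ⟨l2, v2, f2, k1, k2, k3, k4, k5, k6⟩, hv2, ha2⟩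
        refine ⟨_, ⟨l2, v2, f2, rfl, k1, k2, k3, k6, hqi2,
          fun j hj => (hv2 j hj).trans (hv j hj), fun A hA => (ha2 A hA).trans (ha A hA)⟩, ?_⟩
        have hlt : l' < dep rel i := by
          have := h.rel_rp (L := l') (x := i) (by omega) (by omega)
          exact h.lt_dep_iff.2 ⟨_, e3 ▸ e4, this⟩
        have h4 : 1 * (2 * τ + 70) ≤ (dep rel i - l') * (2 * τ + 70) :=
          Nat.mul_le_mul_right _ (by omega)
        rcases k6 with ⟨rfl, -⟩ | ⟨rfl, -⟩
        · have h3 : dep rel i - l2 + 1 ≤ dep rel i - l' := by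
            have := k5 rfl
            omega
          have h5 := Nat.mul_le_mul_right (2 * τ + 70) h3
          rw [add_mul] at h5
          simp only [Ex.cost_v, e1]
          omega
        · simp only [Ex.cost_v, e1]
          omega
      · omega
  · rintro σ1 t ⟨B, ⟨l', v', f', rfl, g31, g32, g33, hD', hqi', hv, ha⟩, h0, ht⟩
    simp only [Ex.eval_v, g33] at h0
    subst h0
    rcases hD' with ⟨e, -⟩ | ⟨-, e2, e3, e4⟩
    · omega
    · have hf : f * ((dep rel i - l) * (2 * τ + 70)) ≤ 1 * ((dep rel i - l) * (2 * τ + 70)) :=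
        Nat.mul_le_mul_right _ (by rcases hD with h1 | h1 <;> omega)
      simp only [Ex.cost_v] at ht
      exact ⟨by omega, hqi', by omega, by omega, e4, hv, ha⟩

theorem storeAncestors_spec (hE : Env w n M C K) (h : LevelSystem n rel) {i : ℕ} {σ : St}
    (hcfg : Cfg n M C K σ) (h30 : σ.v 30 = i) (hi2 : 2 ≤ i) (hin : i ≤ n)
    (hanc : ∀ x ≤ i - 1, ∀ k < K, σ.a (o + 1) (x * M + k) = (par rel)^[2 ^ k] x)
    (hpar : σ.a (o + 1) (i * M) = par rel i) :
    HT w (storeAncestors o) σ fun σ' t => t ≤ 40 * K + 10 ∧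
      (∀ x ≤ i, ∀ k < K, σ'.a (o + 1) (x * M + k) = (par rel)^[2 ^ k] x) ∧
      (∀ j, j ≠ 36 → σ'.v j = σ.v j) ∧ (∀ A, A ≠ o + 1 → σ'.a A = σ.a A) ∧ σ'.x = σ.x := by
  have hw := hE.hw
  have hM := hE.hM
  have hK1 := hE.hK1
  have hK2 := hE.hK2
  have b1 := hE.sq_lt
  have b2 := hE.le_sq
  have b5 : ∀ a b, a ≤ n → b ≤ n → a * M + b < M * M := fun a b ha hb =>
    mul_add_lt (by omega) (by omega)
  refine HT.seq (HT.asg hw (by simp; omega) ?_)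
  refine HT.mono (HT.forUp hw (b := K) (a := 1) (B := 35 * (K - 1)) (fun k B σ' => B = 35 * (K - k) ∧
    (∀ x ≤ i - 1, ∀ k < K, σ'.a (o + 1) (x * M + k) = (par rel)^[2 ^ k] x) ∧
    (∀ k' < k, σ'.a (o + 1) (i * M + k') = (par rel)^[2 ^ k'] i) ∧
    (∀ j, j ≠ 36 → σ'.v j = σ.v j) ∧ (∀ A, A ≠ o + 1 → σ'.a A = σ.a A) ∧ σ'.x = σ.x ∧ 1 ≤ k)
    ?_ (by omega) hK1 ⟨rfl, hanc, ?_, ?_, fun _ _ => rfl, rfl, le_rfl⟩ ?_) ?_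
  · rintro k B σ1 ⟨rfl, g1, g2, g3, g4, g5, g6⟩ hk hkb
    have e1 : σ1.v 1 = M := (g3 1 (by omega)).trans hcfg.v1
    have e3 : σ1.v 3 = K := (g3 3 (by omega)).trans hcfg.v3
    have e30 : σ1.v 30 = i := (g3 30 (by omega)).trans h30
    refine ⟨by simp [e3]; omega, by simp [e3], fun hlt => ?_⟩
    obtain ⟨k, rfl⟩ := Nat.exists_eq_succ_of_ne_zero (show k ≠ 0 by omega)
    have hu : (par rel)^[2 ^ k] i ≤ i - 1 := by
      have := h.iterate_par_le (2 ^ k) i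
      have : 1 ≤ 2 ^ k := Nat.one_le_two_pow
      omega
    have a1 := g2 k (by omega)
    have a2 := g1 _ hu k (by omega)
    have hu2 : (par rel)^[2 ^ k] ((par rel)^[2 ^ k] i) ≤ n := by
      exact (h.iterate_par_le (2 ^ k) ((par rel)^[2 ^ k] i)).trans (by
        have := Nat.sub_le ((par rel)^[2 ^ k] i) (2 ^ k)
        omega)
    have c1 := b5 i k hin (by omega)
    have c2 := b5 i (k + 1) hin (by omega)
    have c3 := b5 ((par rel)^[2 ^ k] i) k (by omega) (by omega)
    have hval : Ex.eval σ1 (.rd (o + 1) (.rd (o + 1) (.v 30 * .v 1 + (.v 36 - 1)) * .v 1 +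
        (.v 36 - 1))) = (par rel)^[2 ^ (k + 1)] i := by
      simp only [Ex.eval_rd, Ex.eval_add, Ex.eval_mul, Ex.eval_sub, Ex.eval_v, Ex.eval_ofNat, e1,
        e30, hk, Nat.succ_sub_one, a1, a2]
      rw [← Function.iterate_add_apply, ← Nat.two_mul, ← pow_succ']
    refine HT.put hw ?_ ?_ ⟨hk, 35 * (K - (k + 1 + 1)), ⟨rfl, ?_, ?_, ?_, ?_, g5, by omega⟩, ?_⟩
    · simp [e30, e1, hk]; omega
    · simp [e30, e1, hk, a1, a2]; omega
    · intro x hx k' hk'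
      have hne : ¬ x * M + k' = i * M + (k + 1) := by
        rw [mul_add_inj (by omega) (by omega)]; omega
      simp [e30, e1, hk, hne, g1 x hx k' hk']
    · intro k' hk'
      simp only [St.setV_a, St.setA_a, hval]
      by_cases hkk : k' = k + 1
      · subst hkk; simp [e30, e1, hk]
      · simp [e30, e1, hk, hkk, g2 k' (by omega)]
    · intro j hj; simp [hj, g3 j hj]
    · intro A hA; funext j; simp [hA, g4 A hA]
    · simp; omega
  · intro k' hk'
    obtain rfl : k' = 0 := by omega
    simpa using hpar
  · intro j hj; simp [hj]
  · simp
  · rintro σ1 t ⟨-, B', ⟨-, g1, g2, g3, g4, g5, -⟩, ht⟩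
    simp only [Ex.cost_v] at ht
    refine ⟨by simp; omega, ?_, g3, g4, g5⟩
    intro x hx k hk
    rcases Nat.lt_or_ge x i with hx' | hx'
    · exact g1 x (by omega) k hk
    · obtain rfl : x = i := by omega
      exact g2 k hk

/-- Each level of the descent takes at most two queries. -/
theorem insertPos_spec (hE : Env w n M C K) (h : LevelSystem n rel) (hc : CodeFn n C rel code)
    (hQ : Query w n code τ Q QI o (o + 10)) {i : ℕ} {σ : St} (hcfg : Cfg n M C K σ)
    (hqi : QI σ) (h30 : σ.v 30 = i) (hi2 : 2 ≤ i) (hin : i ≤ n)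
    (hT : TreeData rel M K o (i - 1) σ) (hD : DictOK n M C rel code o (i - 1) σ) :
    HT w (insertPos o Q) σ fun σ' t =>
      t ≤ (dep rel i - (dep rel (i - 1) - 2)) * (2 * τ + 70) + 70 * K + 140 ∧ QI σ' ∧
      TreeData rel M K o i σ' ∧ DictOK n M C rel code o i σ' ∧
      (∀ j, j < 10 ∨ j = 30 → σ'.v j = σ.v j) ∧ (∀ A, A < o ∨ o + 3 ≤ A → σ'.a A = σ.a A) := by
  have hw := hE.hw
  have hM := hE.hM
  have hK1 := hE.hK1
  have b1 := hE.sq_lt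
  have b2 := hE.le_sq
  have b3 := h.dep_le_succ
  have b6 := hE.four_le_sq
  have b5 : ∀ a b, a ≤ n → b ≤ n → a * M + b < M * M := fun a b ha hb =>
    mul_add_lt (by omega) (by omega)
  have v1 := hcfg.v1
  have a1 := hT.dep (i - 1) le_rfl
  have a2 := hT.anc (i - 1) le_rfl 0 hK1
  simp only [add_zero, pow_zero, Function.iterate_one] at a2
  have a3 := h.par_le_pred (i - 1)
  have d1 := b3 (i - 1)
  have d2 := h.dep_le (x := i) (by omega)
  have c1 := b5 (i - 1) 0 (by omega) (by omega)
  have c2 := b5 i 0 hin (by omega)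
  obtain ⟨s1, s2⟩ := h.start_rel hi2 hin
  have s3 := h.valid s1
  unfold insertPos
  refine HT.seq (HT.asg hw (by simp [h30, v1, a2]; omega) ?_)
  refine HT.seq (HT.asg hw ?_ ?_)
  · simp [h30, a1]
    split_ifs <;> omega
  have e20 : Ex.eval σ (.rd (o + 1) ((.v 30 - 1) * .v 1) + 1) = par rel (i - 1) + 1 := by
    simp [h30, v1, a2]
  rw [e20]
  generalize hσ1 : St.setV _ 21 _ = σ1
  have f20 : σ1.v 20 = par rel (i - 1) + 1 := by rw [← hσ1]; simp
  have f21 : σ1.v 21 = dep rel (i - 1) - 2 := by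
    rw [← hσ1]; simp [h30, a1]
    split_ifs <;> omega
  have fv : ∀ j, j < 10 ∨ j = 30 → σ1.v j = σ.v j := by
    intro j hj
    rw [← hσ1]; simp [show j ≠ 20 by omega, show j ≠ 21 by omega]
  have fa : σ1.a = σ.a := by rw [← hσ1]; rfl
  have fx : σ1.x = σ.x := by rw [← hσ1]; rfl
  clear hσ1
  have hcfg1 : Cfg n M C K σ1 := hcfg.of_eq fun j hj => fv j (Or.inl hj)
  refine HT.seq ((climb_spec hE h hcfg1 (hT.of_eq (by rw [fa]) (by rw [fa])) (by omega) f20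
    (by omega) f21 (by omega)).mono ?_)
  rintro σ2 t2 ⟨ht2, g20, gv, ga, gx⟩
  rw [← h.rp_eq_of_rel s1] at g20
  have hlt : rp rel (dep rel (i - 1) - 2) i < i := (h.rp_le_of_rel s1).trans_lt s2
  generalize hl : dep rel (i - 1) - 2 = l at *
  have g21 : σ2.v 21 = l := (gv 21 (by omega) (by omega)).trans f21
  have gv' : ∀ j, j < 10 ∨ j = 30 → σ2.v j = σ.v j := fun j hj =>
    (gv j (by omega) (by omega)).trans (fv j hj)
  have g30 := (gv' 30 (by omega)).trans h30
  have g1 := (gv' 1 (by omega)).trans v1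
  refine HT.seq (HT.asg hw (by simp [g21]; omega) ?_)
  refine HT.seq (HT.asg hw (by simp [g20]; omega) ?_)
  refine HT.seq (HT.asg hw (by simp [g21, g30, g1]; omega) ?_)
  generalize hσ3 : St.setV _ 33 _ = σ3
  have k31 : σ3.v 31 = l := by rw [← hσ3]; simp [g21]
  have k32 : σ3.v 32 = rp rel l i := by rw [← hσ3]; simp [g20]
  have k33 : σ3.v 33 = if i + l < M then 1 else 0 := by rw [← hσ3]; simp [g30, g21, g1]
  have kv : ∀ j, j < 10 ∨ j = 30 → σ3.v j = σ.v j := by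
    intro j hj
    rw [← hσ3]
    simp [show j ≠ 31 by omega, show j ≠ 32 by omega, show j ≠ 33 by omega, gv' j hj]
  have ka : σ3.a = σ.a := by rw [← hσ3]; exact ga.trans fa
  have kx : σ3.x = σ.x := by rw [← hσ3]; exact gx.trans fx
  clear hσ3
  have hcfg3 : Cfg n M C K σ3 := hcfg.of_eq fun j hj => kv j (Or.inl hj)
  have hqi3 : QI σ3 := hQ.stable σ σ3 hqi kx (fun j hj => kv j (Or.inl hj)) fun A _ => by rw [ka]
  refine HT.seq ((descend_spec hE h hc hQ hcfg3 hqi3 ((kv 30 (by omega)).trans h30) k31 k32 k33 hi2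
    (Descent.enter h hM (by omega) (by omega) rfl hlt (hD.of_eq (by rw [ka])))).mono ?_)
  rintro σ4 t4 ⟨ht4, hqi4, p31, p32, hD4, pv, pa⟩
  have pv' : ∀ j, j < 10 ∨ j = 30 → σ4.v j = σ.v j := fun j hj => (pv j hj).trans (kv j hj)
  have pa' : ∀ A, A ≠ o + 2 → σ4.a A = σ.a A := fun A hA => (pa A hA).trans (by rw [ka])
  have p30 := (pv' 30 (by omega)).trans h30
  have p1 := (pv' 1 (by omega)).trans v1
  have q1 : par rel i ≤ n := by have := h.par_le_pred i; omega
  refine HT.seq (HT.put hw (by simp [p30]; omega) (by simp [p31]; omega) ?_)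
  refine HT.seq (HT.put hw (by simp [p30, p1]; omega) (by simp [p32]; omega) ?_)
  generalize hσ5 : St.setA _ (o + 1) _ _ = σ5
  have rv : σ5.v = σ4.v := by rw [← hσ5]; rfl
  have rx : σ5.x = σ4.x := by rw [← hσ5]; rfl
  have ro : ∀ j, σ5.a o j = if j = i then dep rel i else σ.a o j := by
    intro j; rw [← hσ5]; simp [p30, p31, pa' o (by omega)]
  have ro1 : ∀ j, σ5.a (o + 1) j = if j = i * M then par rel i else σ.a (o + 1) j := by
    intro j; rw [← hσ5]; simp [p30, p1, p32, pa' (o + 1) (by omega)]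
  have ra : ∀ A, A ≠ o → A ≠ o + 1 → σ5.a A = σ4.a A := by
    intro A h1 h2; funext j; rw [← hσ5]; simp [h1, h2]
  clear hσ5
  have hcfg5 : Cfg n M C K σ5 := hcfg.of_eq fun j hj => by rw [rv]; exact pv' j (Or.inl hj)
  refine (storeAncestors_spec hE h hcfg5 (by rw [rv, p30]) hi2 hin ?_ ?_).mono ?_
  · intro x hx k hk
    have hne : ¬ x * M + k = i * M := by
      have := hE.hK2
      rw [← add_zero (i * M), mul_add_inj (by omega) (by omega)]; omega
    rw [ro1, if_neg hne, hT.anc x hx k hk]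
  · rw [ro1, if_pos rfl]
  · rintro σ6 t6 ⟨ht6, w1, w2, w3, w4⟩
    refine ⟨?_, ?_, ⟨?_, w1⟩, ?_, ?_, ?_⟩
    · simp; omega
    · refine hQ.stable σ4 σ6 hqi4 (w4.trans rx) (fun j hj => ?_) (fun A hA => ?_)
      · rw [w2 j (by omega), rv]
      · rw [w3 A (by omega), ra A (by omega) (by omega)]
    · intro x hx
      rw [w3 o (by omega), ro]
      split_ifs with e
      · rw [e]
      · exact hT.dep x (by omega)
    · refine hD4.of_eq ?_
      rw [w3 _ (by omega), ra _ (by omega) (by omega)]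
    · intro j hj
      rw [w2 j (by omega), rv, pv' j hj]
    · intro A hA
      rw [w3 A (by omega), ra A (by omega) (by omega), pa' A (by omega)]

/-- The number of queries is linear: a descent ends at depth `dep i`, and the next one starts at most
two levels above. -/
theorem buildForest_spec (hE : Env w n M C K) (h : LevelSystem n rel) (hc : CodeFn n C rel code)
    (hQ : Query w n code τ Q QI o (o + 10)) {σ : St} (hcfg : Cfg n M C K σ) (hqi : QI σ)
    (h0 : ∀ A, o ≤ A → A < o + 3 → ∀ j, σ.a A j = 0) :
    HT w (buildForest o Q) σ fun σ' t =>
      t ≤ (n + 1) * (6 * τ + 70 * K + 400) ∧ QI σ' ∧ TreeData rel M K o n σ' ∧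
      (∀ j, j < 10 → σ'.v j = σ.v j) ∧ (∀ A, A < o ∨ o + 3 ≤ A → σ'.a A = σ.a A) := by
  have hw := hE.hw
  have hM := hE.hM
  have hn := hE.hn
  have b1 := hE.sq_lt
  have b2 := hE.le_sq
  refine HT.seq (HT.asg hw (by simp; omega) ?_)
  -- The budget contains, besides a fixed amount for each position still to be inserted, an amount
  -- for each level above the current depth, since the depth drops by at most one per position.
  refine HT.mono (HT.forUp hw (b := M) (a := 2) (B := (M - 2) * (4 * τ + 70 * K + 300) +
      (n + 1 - dep rel (2 - 1)) * (2 * τ + 70))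
    (fun i B σ' => B = (M - i) * (4 * τ + 70 * K + 300) +
        (n + 1 - dep rel (i - 1)) * (2 * τ + 70) ∧ 2 ≤ i ∧ QI σ' ∧
      TreeData rel M K o (i - 1) σ' ∧ DictOK n M C rel code o (i - 1) σ' ∧
      (∀ j, j < 10 → σ'.v j = σ.v j) ∧ (∀ A, A < o ∨ o + 3 ≤ A → σ'.a A = σ.a A))
    ?_ (by omega) (by omega) ⟨rfl, le_rfl, ?_, ⟨?_, ?_⟩, ?_, ?_, fun _ _ => rfl⟩ ?_) ?_
  · rintro i B σ1 ⟨rfl, hi2, hqi1, hT1, hD1, hv, ha⟩ hi hib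
    have v1 := (hv 1 (by omega)).trans hcfg.v1
    refine ⟨by simp [v1]; omega, by simp [v1], fun hlt => ?_⟩
    refine (insertPos_spec hE h hc hQ (hcfg.of_eq hv) hqi1 hi hi2 (by omega) hT1 hD1).mono ?_
    rintro σ2 t ⟨ht, g1, g2, g3, g4, g5⟩
    refine ⟨(g4 30 (by omega)).trans hi, _, ⟨rfl, by omega, ?_, g2.of_eq rfl rfl, g3.of_eq rfl, ?_,
      fun A hA => (g5 A hA).trans (ha A hA)⟩, ?_⟩
    · refine hQ.stable σ2 _ g1 rfl (fun j hj => ?_) fun _ _ => rfl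
      simp [show j ≠ 30 by omega]
    · intro j hj
      simp [show j ≠ 30 by omega, g4 j (Or.inl hj), hv j hj]
    · rw [Nat.add_sub_cancel]
      have d1 := h.dep_le_succ i
      have d2 := h.dep_le_succ (i - 1)
      have d3 : dep rel (i - 1) - 2 ≤ dep rel i := by
        have := h.dep_le_iff.not.2 (fun hno => hno _ (h.start_rel hi2 (by omega)).2
          (h.start_rel hi2 (by omega)).1)
        omega
      have e1 : (dep rel i - (dep rel (i - 1) - 2)) + (n + 1 - dep rel i) ≤
          (n + 1 - dep rel (i - 1)) + 2 := by omega
      have e2 := Nat.mul_le_mul_right (2 * τ + 70) e1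
      rw [add_mul, add_mul (n + 1 - _)] at e2
      have e3 : M - i = (M - (i + 1)) + 1 := by omega
      rw [e3, add_mul (M - (i + 1))]
      simp only [Ex.cost_v]
      omega
  · refine hQ.stable σ _ hqi rfl (fun j hj => ?_) fun _ _ => rfl
    simp [show j ≠ 30 by omega]
  · intro x hx
    rw [St.setV_a, h0 o le_rfl (by omega)]
    have : x = 0 ∨ x = 1 := by omega
    rcases this with rfl | rfl
    · rw [h.dep_zero]
    · rw [h.dep_one]
  · intro x hx k _
    rw [St.setV_a, h0 (o + 1) (by omega) (by omega)]
    have := h.iterate_par_le (2 ^ k) x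
    have : 1 ≤ 2 ^ k := Nat.one_le_two_pow
    omega
  · intro l _ v _ c _
    rw [St.setV_a, h0 (o + 2) (by omega) (by omega)]
    exact ⟨fun h => absurd rfl h, fun j _ _ _ => by omega⟩
  · intro j hj
    simp [show j ≠ 30 by omega]
  · simp
  · rintro σ1 t ⟨-, B', ⟨-, -, g1, g2, -, g3, g4⟩, ht⟩
    refine ⟨?_, g1, ?_, g3, g4⟩
    · simp only [Ex.cost_v] at ht
      simp only [Ex.cost_ofNat]
      have e1 : (M - 2) * (4 * τ + 70 * K + 300) ≤ n * (4 * τ + 70 * K + 300) :=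
        Nat.mul_le_mul_right _ (by omega)
      have e2 : (n + 1 - dep rel (2 - 1)) * (2 * τ + 70) ≤ (n + 1) * (2 * τ + 70) :=
        Nat.mul_le_mul_right _ (by omega)
      have e3 : (n + 1) * (6 * τ + 70 * K + 400) = n * (4 * τ + 70 * K + 300) +
        (n + 1) * (2 * τ + 70) + (4 * τ + 70 * K + 300) + (n + 1) * 30 := by ring
      omega
    · rwa [show M - 1 = n by omega] at g2

end phase1

end WordRAM

/-! ### Lists in two-dimensional arrays -/

namespace WordRAM

/-- Row `k` of the two-dimensional array `A` starts with the list `f k`, whose length is entry `k` of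
the array `B`. -/
def Rows (M A B : ℕ) (f : ℕ → List ℕ) (σ : St) : Prop :=
  ∀ k, σ.a B k = (f k).length ∧ ∀ (m : ℕ) (hm : m < (f k).length), σ.a A (k * M + m) = (f k)[m]

theorem Rows.of_eq {M A B : ℕ} {f : ℕ → List ℕ} {σ σ' : St} (h : Rows M A B f σ)
    (h1 : σ'.a A = σ.a A) (h2 : σ'.a B = σ.a B) : Rows M A B f σ' := by
  unfold Rows
  rw [h1, h2]
  exact h

/-- Appends the value of variable `y` to the row given by variable `x`. -/
def push (A B x y : ℕ) : Prog :=
  .seq (put A (.v x * .v 1 + .rd B (.v x)) (.v y)) (put B (.v x) (.rd B (.v x) + 1))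

section push

variable {w n M C K : ℕ}

theorem HT.push (hE : Env w n M C K) {A B x y k z : ℕ} {f : ℕ → List ℕ} {σ : St}
    {R : St → ℕ → Prop} (hAB : A ≠ B) (h1 : σ.v 1 = M) (hf : Rows M A B f σ)
    (hl : ∀ k, (f k).length ≤ n) (hx : σ.v x = k) (hk : k ≤ n) (hy : σ.v y = z) (hz : z ≤ n)
    (hR : ∀ σ', Rows M A B (Function.update f k (f k ++ [z])) σ' → σ'.v = σ.v → σ'.x = σ.x →
      (∀ D, D ≠ A → D ≠ B → σ'.a D = σ.a D) → R σ' 14) : HT w (push A B x y) σ R := by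
  have hw := hE.hw
  have hM := hE.hM
  have b1 := hE.sq_lt
  have b2 := hE.le_sq
  have hlk := hl k
  have b3 : k * M + (f k).length < M * M := mul_add_lt (by omega) (by omega)
  have e1 := (hf k).1
  refine HT.seq (HT.put hw (by simp [hx, h1, e1]; omega) (by simp [hy]; omega) ?_)
  refine HT.put hw (by simp [hx]; omega) (by simp [hx, hAB.symm, e1]; omega) ?_
  simp only [Ex.cost_add, Ex.cost_mul, Ex.cost_v, Ex.cost_rd, Ex.cost_ofNat]
  refine hR _ (fun k' => ?_) rfl rfl (fun D h2 h3 => ?_)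
  · by_cases hk' : k' = k
    · subst hk'
      simp only [Function.update_self, List.length_append, List.length_singleton]
      refine ⟨by simp [hx, hAB.symm, e1], fun m hm => ?_⟩
      by_cases hm' : m < (f k').length
      · simp [hx, h1, hAB, e1, (hf k').2 m hm', List.getElem_append_left hm',
          show m ≠ (f k').length by omega]
      · obtain rfl : m = (f k').length := by omega
        simp [hx, h1, hAB, e1, hy]
    · rw [Function.update_of_ne hk']
      refine ⟨by simp [hx, hk', hAB.symm, (hf k').1], fun m hm => ?_⟩
      have hlk' := hl k'
      have hne : ¬ k' * M + m = k * M + (f k).length := by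
        rw [mul_add_inj (by omega) (by omega)]
        omega
      simp [hx, h1, hAB, e1, hne, (hf k').2 m hm]
  · funext j
    simp [h2, h3]

end push

/-! ### Joining two classes -/

open Classical in
/-- Appends `p` to the lists with index in `E`. -/
noncomputable def appendOn (E : ℕ → Prop) (p : ℕ) (g : ℕ → List ℕ) (x : ℕ) : List ℕ :=
  if E x then g x ++ [p] else g x

theorem update_appendOn {E : ℕ → Prop} {p y : ℕ} {g : ℕ → List ℕ} (hy : ¬ E y) :
    Function.update (appendOn E p g) y (appendOn E p g y ++ [p]) =
      appendOn (fun x => E x ∨ x = y) p g := by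
  funext x
  by_cases hx : x = y
  · subst hx
    simp [appendOn, hy]
  · by_cases hE : E x <;> simp [appendOn, hx, hE]

theorem appendOn_congr {E E' : ℕ → Prop} (p : ℕ) (g : ℕ → List ℕ) (h : ∀ x, E x ↔ E' x) :
    appendOn E p g = appendOn E' p g := by
  rw [show E = E' from funext fun x => propext (h x)]

theorem length_appendOn_le {E : ℕ → Prop} {p n : ℕ} {g : ℕ → List ℕ}
    (h : ∀ x, (g x).length < n) (x : ℕ) : (appendOn E p g x).length ≤ n := by
  have := h x
  unfold appendOn
  split_ifs
  · simp; omega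
  · omega

/-- Array `o + 3` holds class labels for the partition of `1, …, n` into the fibres of `F`, and the
rows `f` of array `o + 4` list the members of the classes. Rows of labels that are no longer
in use are arbitrary. -/
structure ClassData (n M o : ℕ) (F : ℕ → ℕ) (f : ℕ → List ℕ) (σ : St) : Prop where
  rows : Rows M (o + 4) (o + 5) f σ
  lab_pos : ∀ x, 1 ≤ x → x ≤ n → 1 ≤ σ.a (o + 3) x ∧ σ.a (o + 3) x ≤ n
  lab_out : ∀ x, x = 0 ∨ n < x → σ.a (o + 3) x = 0
  lab_iff : ∀ x y, 1 ≤ x → x ≤ n → 1 ≤ y → y ≤ n → (σ.a (o + 3) x = σ.a (o + 3) y ↔ F x = F y)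
  mem : ∀ x, 1 ≤ x → x ≤ n → ∀ y, y ∈ f (σ.a (o + 3) x) ↔
    1 ≤ y ∧ y ≤ n ∧ σ.a (o + 3) y = σ.a (o + 3) x
  nodup : ∀ k, (f k).Nodup
  range : ∀ k, ∀ y ∈ f k, 1 ≤ y ∧ y ≤ n

theorem ClassData.of_eq {n M o : ℕ} {F : ℕ → ℕ} {f : ℕ → List ℕ} {σ σ' : St}
    (h : ClassData n M o F f σ) (h3 : σ'.a (o + 3) = σ.a (o + 3))
    (h4 : σ'.a (o + 4) = σ.a (o + 4)) (h5 : σ'.a (o + 5) = σ.a (o + 5)) :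
    ClassData n M o F f σ' where
  rows := h.rows.of_eq h4 h5
  lab_pos := by rw [h3]; exact h.lab_pos
  lab_out := by rw [h3]; exact h.lab_out
  lab_iff := by rw [h3]; exact h.lab_iff
  mem := by rw [h3]; exact h.mem
  nodup := h.nodup
  range := h.range

theorem length_le_of_nodup {n : ℕ} {l : List ℕ} (hl : l.Nodup) (h : ∀ y ∈ l, 1 ≤ y ∧ y ≤ n) :
    l.length ≤ n := by
  have h1 : l.toFinset ⊆ Finset.Icc 1 n := fun y hy => by
    simpa using h y (List.mem_toFinset.1 hy)
  have := Finset.card_le_card h1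
  rwa [List.toFinset_card_of_nodup hl, Nat.card_Icc, Nat.add_sub_cancel] at this

theorem ClassData.length_le {n M o : ℕ} {F : ℕ → ℕ} {f : ℕ → List ℕ} {σ : St}
    (h : ClassData n M o F f σ) (k : ℕ) : (f k).length ≤ n :=
  length_le_of_nodup (h.nodup k) (h.range k)

theorem ClassData.length_eq {n M o : ℕ} {F : ℕ → ℕ} {f : ℕ → List ℕ} {σ : St}
    (h : ClassData n M o F f σ) {x : ℕ} (hx : 1 ≤ x) (hxn : x ≤ n) :
    (f (σ.a (o + 3) x)).length = classSize n F x := by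
  classical
  rw [← List.toFinset_card_of_nodup (h.nodup _), classSize]
  congr 1
  ext y
  rw [List.mem_toFinset, h.mem x hx hxn, Finset.mem_filter, Finset.mem_Icc]
  constructor
  · rintro ⟨h1, h2, h3⟩
    exact ⟨⟨h1, h2⟩, (h.lab_iff y x h1 h2 hx hxn).1 h3⟩
  · rintro ⟨⟨h1, h2⟩, h3⟩
    exact ⟨h1, h2, (h.lab_iff y x h1 h2 hx hxn).2 h3⟩

/-- For the `m`-th member `x` of the class `a` (`m`, `a` in the variables `43`, `40`), records the
pairs `(x, x + p)` and `(x - p, x)` (`p` in variable `38`) whose other position is in the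
class given by variable `41`. -/
def scanMember (o : ℕ) : Prog :=
  .seq (asg 44 (.rd (o + 4) (.v 40 * .v 1 + .v 43))) (.seq (asg 45 (.v 44 + .v 38))
  (.seq (ite (.eq (.rd (o + 3) (.v 45)) (.v 41)) (push (o + 8) (o + 9) 44 38) .skip)
  (ite (.lt (.v 38) (.v 44))
    (.seq (asg 45 (.v 44 - .v 38))
      (ite (.eq (.rd (o + 3) (.v 45)) (.v 41)) (push (o + 8) (o + 9) 45 38) .skip))
    .skip)))

/-- Moves the `m`-th member of the class `a` (`m`, `a` in the variables `43`, `40`) to the class given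
by variable `41`. -/
def moveMember (o : ℕ) : Prog :=
  .seq (asg 44 (.rd (o + 4) (.v 40 * .v 1 + .v 43))) (.seq (put (o + 3) (.v 44) (.v 41))
  (push (o + 4) (o + 5) 41 44))

/-- Joins the classes of `i` (variable `30`) and of its parent, by moving the members of the smaller
class, and records the pairs at distance `p` (variable `38`) that become equivalent. -/
def joinClasses (o : ℕ) : Prog :=
  .seq (asg 40 (.rd (o + 3) (.v 30))) (.seq (asg 41 (.rd (o + 3) (.rd (o + 1) (.v 30 * .v 1))))
  (.seq (ite (.lt (.rd (o + 5) (.v 41)) (.rd (o + 5) (.v 40)))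
    (.seq (asg 42 (.v 40)) (.seq (asg 40 (.v 41)) (asg 41 (.v 42)))) .skip)
  (.seq (asg 43 0) (.seq (forUp 43 (.rd (o + 5) (.v 40)) (scanMember o))
  (.seq (asg 43 0) (forUp 43 (.rd (o + 5) (.v 40)) (moveMember o)))))))

section join

variable {w n M C K o : ℕ} {F : ℕ → ℕ} {f g : ℕ → List ℕ}

/-- The pair `(x, x + p)` is recorded when the first `m` members of `l` have been scanned against the
class with label `b`. -/
def Scanned (n : ℕ) (lab : ℕ → ℕ) (p b : ℕ) (l : List ℕ) (x : ℕ) : Prop :=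
  1 ≤ x ∧ x + p ≤ n ∧ ((x ∈ l ∧ lab (x + p) = b) ∨ (x + p ∈ l ∧ lab x = b))

theorem scanMember_spec (hE : Env w n M C K) {a b p m : ℕ} {σ : St}
    (h1 : σ.v 1 = M) (hf : ClassData n M o F f σ) (h40 : σ.v 40 = a) (h41 : σ.v 41 = b)
    (h38 : σ.v 38 = p) (h43 : σ.v 43 = m) (hp : 1 ≤ p) (hpn : p ≤ n) (ha : a ≤ n) (hb : 1 ≤ b)
    (hb' : b ≤ n) (hab : a ≠ b)
    (hmem : ∀ y, y ∈ f a ↔ 1 ≤ y ∧ y ≤ n ∧ σ.a (o + 3) y = a) (hm : m < (f a).length)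
    (hgn : ∀ x, (g x).length < n)
    (hg : Rows M (o + 8) (o + 9)
      (appendOn (Scanned n (σ.a (o + 3)) p b ((f a).take m)) p g) σ) :
    HT w (scanMember o) σ fun σ' t => t ≤ 70 ∧
      Rows M (o + 8) (o + 9) (appendOn (Scanned n (σ.a (o + 3)) p b ((f a).take (m + 1))) p g) σ' ∧
      (∀ j, j < 44 → σ'.v j = σ.v j) ∧ σ'.x = σ.x ∧
      (∀ D, D ≠ o + 8 → D ≠ o + 9 → σ'.a D = σ.a D) := by
  have hw := hE.hw
  have hM := hE.hM
  have b1 := hE.sq_lt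
  have b2 := hE.le_sq
  have bl := hf.length_le a
  have b3 : a * M + m < M * M := mul_add_lt (by omega) (by omega)
  have e1 := (hf.rows a).2 m hm
  obtain ⟨y, hy⟩ : ∃ y, (f a)[m] = y := ⟨_, rfl⟩
  rw [hy] at e1
  have hya : y ∈ f a := hy ▸ List.getElem_mem hm
  obtain ⟨y1, y2, y3⟩ := (hmem y).1 hya
  have hytake : y ∉ (f a).take m := by
    rw [List.mem_take_iff_getElem]
    rintro ⟨i, hi, he⟩
    have := (hf.nodup a).getElem_inj_iff.1 (he.trans hy.symm)
    omega
  have htake : ∀ z, z ∈ (f a).take (m + 1) ↔ z ∈ (f a).take m ∨ z = y := by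
    intro z
    rw [List.take_succ_eq_append_getElem hm, List.mem_append, List.mem_singleton, hy]
  have htakea : ∀ z, z ∈ (f a).take m → σ.a (o + 3) z = a := fun z hz =>
    ((hmem z).1 (List.mem_of_mem_take hz)).2.2
  have hlab : ∀ z, σ.a (o + 3) z ≤ n := by
    intro z
    by_cases hz : z = 0 ∨ n < z
    · rw [hf.lab_out z hz]; omega
    · exact (hf.lab_pos z (by omega) (by omega)).2
  have hin : ∀ z, σ.a (o + 3) z = b → 1 ≤ z ∧ z ≤ n := by
    intro z hz
    by_contra hc
    rw [hf.lab_out z (by omega)] at hz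
    omega
  have hl1 := hlab (y + p)
  have hl2 := hlab (y - p)
  generalize hlb : σ.a (o + 3) = lab at *
  unfold scanMember
  refine HT.seq (HT.asg hw (by simp [h40, h1, h43, e1]; omega) ?_)
  refine HT.seq (HT.asg hw (by simp [h40, h1, h43, e1, h38]; omega) ?_)
  generalize hσ1 : St.setV _ 45 _ = σ1
  have v44 : σ1.v 44 = y := by rw [← hσ1]; simp [h40, h1, h43, e1]
  have v45 : σ1.v 45 = y + p := by rw [← hσ1]; simp [h40, h1, h43, e1, h38]
  have vj : ∀ j, j < 44 → σ1.v j = σ.v j := by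
    intro j hj; rw [← hσ1]; simp [show j ≠ 44 by omega, show j ≠ 45 by omega]
  have va : σ1.a = σ.a := by rw [← hσ1]; rfl
  have vx : σ1.x = σ.x := by rw [← hσ1]; rfl
  clear hσ1
  have v41 := (vj 41 (by omega)).trans h41
  have v38 := (vj 38 (by omega)).trans h38
  have v1 := (vj 1 (by omega)).trans h1
  have hlb1 : σ1.a (o + 3) = lab := by rw [va, hlb]
  refine HT.seq ?_
  -- `E1` describes the pairs recorded after the first of the two tests.
  let E1 : ℕ → Prop := fun x => Scanned n lab p b ((f a).take m) x ∨ (x = y ∧ lab (y + p) = b)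
  have step1 : HT w (ite (.eq (.rd (o + 3) (.v 45)) (.v 41)) (push (o + 8) (o + 9) 44 38) .skip)
      σ1 fun σ' t => t ≤ 20 ∧ Rows M (o + 8) (o + 9) (appendOn E1 p g) σ' ∧ σ'.v = σ1.v ∧
        σ'.x = σ1.x ∧ (∀ D, D ≠ o + 8 → D ≠ o + 9 → σ'.a D = σ1.a D) := by
    refine HT.ite hw (by simp [v45, v41, hlb1]; omega) (fun hne => ?_) (fun hz => ?_)
    · simp [v45, v41, hlb1] at hne
      refine HT.push hE (by omega) v1 (hg.of_eq (by rw [va]) (by rw [va]))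
        (length_appendOn_le hgn) v44 (by omega) v38 hpn ?_
      intro σ' q1 q2 q3 q4
      rw [update_appendOn] at q1
      · refine ⟨by simp, ?_, q2, q3, q4⟩
        rwa [appendOn_congr (E' := E1)] at q1
        intro x
        simp only [E1, hne, and_true]
      · rintro ⟨-, -, ⟨h2, -⟩ | ⟨h2, -⟩⟩
        · exact hytake h2
        · exact hab ((htakea _ h2).symm.trans hne)
    · simp [v45, v41, hlb1] at hz
      refine HT.skip ⟨by simp, ?_, rfl, rfl, fun _ _ _ => rfl⟩
      have := hg.of_eq (σ' := σ1) (by rw [va]) (by rw [va])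
      rwa [appendOn_congr (E' := E1)] at this
      intro x
      simp only [E1, hz, and_false, or_false]
  refine step1.mono ?_
  rintro σ2 t2 ⟨ht2, hg2, q2, q3, q4⟩
  have hlb2 : σ2.a (o + 3) = lab := by rw [q4 _ (by omega) (by omega), hlb1]
  have hfin : ∀ x, Scanned n lab p b ((f a).take (m + 1)) x ↔
      (E1 x ∨ (x + p = y ∧ lab x = b)) := by
    intro x
    simp only [Scanned, E1, htake]
    constructor
    · rintro ⟨g1, g2, ⟨g3 | g3, g4⟩ | ⟨g3 | g3, g4⟩⟩
      · exact Or.inl (Or.inl ⟨g1, g2, Or.inl ⟨g3, g4⟩⟩)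
      · subst g3; exact Or.inl (Or.inr ⟨rfl, g4⟩)
      · exact Or.inl (Or.inl ⟨g1, g2, Or.inr ⟨g3, g4⟩⟩)
      · exact Or.inr ⟨g3, g4⟩
    · rintro ((⟨g1, g2, ⟨g3, g4⟩ | ⟨g3, g4⟩⟩ | ⟨rfl, g4⟩) | ⟨g3, g4⟩)
      · exact ⟨g1, g2, Or.inl ⟨Or.inl g3, g4⟩⟩
      · exact ⟨g1, g2, Or.inr ⟨Or.inl g3, g4⟩⟩
      · have := hin _ g4
        exact ⟨y1, this.2, Or.inl ⟨Or.inr rfl, g4⟩⟩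
      · have := hin _ g4
        exact ⟨this.1, by omega, Or.inr ⟨Or.inr g3, g4⟩⟩
  rw [appendOn_congr p g hfin]
  refine HT.ite hw (by simp [q2, v38, v44]; omega) (fun hlt => ?_) (fun hge => ?_)
  · simp [q2, v38, v44] at hlt
    refine HT.seq (HT.asg hw (by simp [q2, v38, v44]; omega) ?_)
    refine HT.ite hw (by simp [q2, v38, v44, v41, hlb2]; omega) (fun hne => ?_) (fun hz => ?_)
    · simp [q2, v38, v44, v41, hlb2] at hne
      refine HT.push hE (k := y - p) (z := p) (by omega) (by simp [q2, v1]) (hg2.of_eq rfl rfl)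
        (length_appendOn_le hgn) (by simp [q2, v38, v44]) (by omega) (by simp [q2, v38]) hpn ?_
      intro σ' r1 r2 r3 r4
      rw [update_appendOn] at r1
      · refine ⟨by simp; omega, ?_, ?_, ?_, ?_⟩
        · rwa [appendOn_congr (E' := fun x => E1 x ∨ (x + p = y ∧ lab x = b))] at r1
          intro x
          constructor
          · rintro (h | rfl)
            · exact Or.inl h
            · exact Or.inr ⟨by omega, hne⟩
          · rintro (h | ⟨h, -⟩)
            · exact Or.inl h
            · exact Or.inr (by omega)
        · intro j hj
          rw [r2]
          simp [show j ≠ 45 by omega, q2, vj j hj]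
        · rw [r3]
          exact q3.trans vx
        · intro D d1 d2
          rw [r4 D d1 d2, St.setV_a, q4 D d1 d2, va]
      · rintro (⟨-, -, ⟨h2, -⟩ | ⟨h2, -⟩⟩ | ⟨h2, -⟩)
        · exact hab ((htakea _ h2).symm.trans hne)
        · rw [show y - p + p = y by omega] at h2
          exact hytake h2
        · omega
    · simp [q2, v38, v44, v41, hlb2] at hz
      refine HT.skip ⟨by simp; omega, ?_, ?_, ?_, ?_⟩
      · rw [← appendOn_congr (E := E1)]
        · exact hg2.of_eq rfl rfl
        · intro x
          constructor
          · exact Or.inl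
          · rintro (h | ⟨h, h'⟩)
            · exact h
            · rw [← h, Nat.add_sub_cancel] at hz
              exact absurd h' hz
      · intro j hj
        simp [show j ≠ 45 by omega, q2, vj j hj]
      · exact q3.trans vx
      · intro D d1 d2
        rw [St.setV_a, q4 D d1 d2, va]
  · simp [q2, v38, v44] at hge
    refine HT.skip ⟨by simp; omega, ?_, ?_, ?_, ?_⟩
    · rw [← appendOn_congr (E := E1)]
      · exact hg2
      · intro x
        constructor
        · exact Or.inl
        · rintro (h | ⟨h, h'⟩)
          · exact h
          · have := hin x h'
            omega
    · intro j hj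
      rw [q2, vj j hj]
    · exact q3.trans vx
    · intro D d1 d2
      rw [q4 D d1 d2, va]

end join

end WordRAM

/-- Joining the class of `u` to a class that is at least as large increases the potential by at least
the size of the class of `u`. -/
theorem potential_join {n : ℕ} {F F' : ℕ → ℕ} {u v : ℕ}
    (hF : ∀ a ∈ Finset.Icc 1 n, ∀ b ∈ Finset.Icc 1 n, F a = F b → F' a = F' b)
    (hu : u ∈ Finset.Icc 1 n) (hv : v ∈ Finset.Icc 1 n) (hne : F u ≠ F v) (he : F' u = F' v)
    (hle : classSize n F u ≤ classSize n F v) :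
    potential n F + classSize n F u ≤ potential n F' := by
  classical
  have h1 : ∀ x ∈ Finset.Icc 1 n, Nat.log 2 (classSize n F x) + (if F x = F u then 1 else 0) ≤
      Nat.log 2 (classSize n F' x) := by
    intro x hx
    split_ifs with hxu
    · refine log_classSize_join hF hx hv (by rwa [hxu]) ((hF x hx u hu hxu).trans he) ?_
      have : classSize n F x = classSize n F u := by simp only [classSize, hxu]
      omega
    · rw [add_zero]
      exact Nat.log_mono_right (classSize_mono hF hx)
  have h2 := Finset.sum_le_sum h1
  rw [Finset.sum_add_distrib, ← Finset.card_filter] at h2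
  exact h2

namespace WordRAM

section join

variable {w n M C K o : ℕ} {F : ℕ → ℕ} {f g : ℕ → List ℕ}

theorem scanLoop_spec (hE : Env w n M C K) {a b p : ℕ} {σ : St}
    (h1 : σ.v 1 = M) (hf : ClassData n M o F f σ) (h40 : σ.v 40 = a) (h41 : σ.v 41 = b)
    (h38 : σ.v 38 = p) (hp : 1 ≤ p) (hpn : p ≤ n) (ha : a ≤ n) (hb : 1 ≤ b)
    (hb' : b ≤ n) (hab : a ≠ b)
    (hmem : ∀ y, y ∈ f a ↔ 1 ≤ y ∧ y ≤ n ∧ σ.a (o + 3) y = a)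
    (hgn : ∀ x, (g x).length < n) (hg : Rows M (o + 8) (o + 9) g σ) :
    HT w (.seq (asg 43 0) (forUp 43 (.rd (o + 5) (.v 40)) (scanMember o))) σ fun σ' t =>
      t ≤ 80 * (f a).length + 10 ∧
      Rows M (o + 8) (o + 9) (appendOn (Scanned n (σ.a (o + 3)) p b (f a)) p g) σ' ∧
      (∀ j, j < 43 → σ'.v j = σ.v j) ∧ σ'.x = σ.x ∧
      (∀ D, D ≠ o + 8 → D ≠ o + 9 → σ'.a D = σ.a D) := by
  have hw := hE.hw
  have hM := hE.hM
  have b1 := hE.sq_lt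
  have b2 := hE.le_sq
  have b3 := hE.four_le_sq
  have hl := hf.length_le a
  refine HT.seq (HT.asg hw (by simp) ?_)
  refine HT.mono (HT.forUp hw (b := (f a).length) (a := 0) (B := 80 * (f a).length)
    (fun m B σ' => B = 80 * ((f a).length - m) ∧
      Rows M (o + 8) (o + 9) (appendOn (Scanned n (σ.a (o + 3)) p b ((f a).take m)) p g) σ' ∧
      (∀ j, j < 43 → σ'.v j = σ.v j) ∧ σ'.x = σ.x ∧
      (∀ D, D ≠ o + 8 → D ≠ o + 9 → σ'.a D = σ.a D)) ?_ (by omega) (Nat.zero_le _)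
      ⟨rfl, ?_, ?_, rfl, fun _ _ _ => rfl⟩ ?_) ?_
  · rintro m B σ1 ⟨rfl, g1, g2, g3, g4⟩ hm hml
    have v40 := (g2 40 (by omega)).trans h40
    have e5 : σ1.a (o + 5) a = (f a).length := by
      rw [g4 _ (by omega) (by omega), (hf.rows a).1]
    refine ⟨by simp [v40, e5]; omega, by simp [v40, e5], fun hlt => ?_⟩
    have e3 : σ1.a (o + 3) = σ.a (o + 3) := g4 _ (by omega) (by omega)
    refine HT.mono (scanMember_spec hE ((g2 1 (by omega)).trans h1)
      (hf.of_eq e3 (g4 _ (by omega) (by omega)) (g4 _ (by omega) (by omega))) v40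
      ((g2 41 (by omega)).trans h41) ((g2 38 (by omega)).trans h38) hm hp hpn ha hb hb' hab
      (by rw [e3]; exact hmem) hlt hgn (by rw [e3]; exact g1)) ?_
    rintro σ2 t ⟨ht, k1, k2, k3, k4⟩
    rw [e3] at k1
    refine ⟨(k2 43 (by omega)).trans hm, _, ⟨rfl, k1.of_eq rfl rfl, ?_, k3.trans g3, ?_⟩, ?_⟩
    · intro j hj
      simp [show j ≠ 43 by omega, k2 j (by omega), g2 j hj]
    · intro D d1 d2
      rw [St.setV_a, k4 D d1 d2, g4 D d1 d2]
    · simp only [Ex.cost_rd, Ex.cost_v]; omega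
  · rw [List.take_zero, appendOn_congr (E' := fun _ => False)]
    · have e : appendOn (fun _ => False) p g = g := by
        funext x; simp [appendOn]
      rw [e]
      exact hg.of_eq rfl rfl
    · intro x; simp [Scanned]
  · intro j hj
    simp [show j ≠ 43 by omega]
  · simp
  · rintro σ1 t ⟨-, B', ⟨-, g1, g2, g3, g4⟩, ht⟩
    rw [List.take_length] at g1
    refine ⟨?_, g1, g2, g3, g4⟩
    simp only [Ex.cost_rd, Ex.cost_v, Ex.cost_ofNat] at ht ⊢
    omega

theorem moveLoop_spec (hE : Env w n M C K) {a b : ℕ} {σ : St}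
    (h1 : σ.v 1 = M) (hf : ClassData n M o F f σ) (h40 : σ.v 40 = a) (h41 : σ.v 41 = b)
    (ha : a ≤ n) (hb' : b ≤ n) (hab : a ≠ b) (hbl : (f b).length + (f a).length ≤ n) :
    HT w (.seq (asg 43 0) (forUp 43 (.rd (o + 5) (.v 40)) (moveMember o))) σ fun σ' t =>
      t ≤ 80 * (f a).length + 10 ∧
      Rows M (o + 4) (o + 5) (Function.update f b (f b ++ f a)) σ' ∧
      (∀ z, σ'.a (o + 3) z = if z ∈ f a then b else σ.a (o + 3) z) ∧
      (∀ j, j < 43 → σ'.v j = σ.v j) ∧ σ'.x = σ.x ∧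
      (∀ D, D ≠ o + 3 → D ≠ o + 4 → D ≠ o + 5 → σ'.a D = σ.a D) := by
  have hw := hE.hw
  have hM := hE.hM
  have b1 := hE.sq_lt
  have b2 := hE.le_sq
  have b3 := hE.four_le_sq
  have hl := hf.length_le a
  refine HT.seq (HT.asg hw (by simp) ?_)
  refine HT.mono (HT.forUp hw (b := (f a).length) (a := 0) (B := 80 * (f a).length)
    (fun m B σ' => B = 80 * ((f a).length - m) ∧
      Rows M (o + 4) (o + 5) (Function.update f b (f b ++ (f a).take m)) σ' ∧
      (∀ z, σ'.a (o + 3) z = if z ∈ (f a).take m then b else σ.a (o + 3) z) ∧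
      (∀ j, j < 43 → σ'.v j = σ.v j) ∧ σ'.x = σ.x ∧
      (∀ D, D ≠ o + 3 → D ≠ o + 4 → D ≠ o + 5 → σ'.a D = σ.a D)) ?_ (by omega) (Nat.zero_le _)
      ⟨rfl, ?_, ?_, ?_, rfl, fun _ _ _ _ => rfl⟩ ?_) ?_
  · rintro m B σ1 ⟨rfl, g1, gl, g2, g3, g4⟩ hm hml
    have v40 := (g2 40 (by omega)).trans h40
    have v41 := (g2 41 (by omega)).trans h41
    have v1 := (g2 1 (by omega)).trans h1
    have ra := g1 a
    rw [Function.update_of_ne hab] at ra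
    refine ⟨by simp [v40, ra.1]; omega, by simp [v40, ra.1], fun hlt => ?_⟩
    have e4 := ra.2 m hlt
    have hya := List.getElem_mem hlt
    obtain ⟨y, hy⟩ : ∃ y, (f a)[m] = y := ⟨_, rfl⟩
    rw [hy] at e4 hya
    have hyr := hf.range a y hya
    have c1 : a * M + m < M * M := mul_add_lt (by omega) (by omega)
    have htk : (f a).take (m + 1) = (f a).take m ++ [y] := by
      rw [List.take_succ_eq_append_getElem hlt, hy]
    unfold moveMember
    refine HT.seq (HT.asg hw (by simp [v40, v1, hm, e4]; omega) ?_)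
    have e44 : Ex.eval σ1 (.rd (o + 4) (.v 40 * .v 1 + .v 43)) = y := by
      simp [v40, v1, hm, e4]
    rw [e44]
    refine HT.seq (HT.put hw (by simp; omega) (by simp [v41]; omega) ?_)
    refine HT.push hE (k := b) (z := y) (f := Function.update f b (f b ++ (f a).take m)) (by omega)
      (by simp [v1]) (g1.of_eq ?_ ?_) ?_ (by simp [v41]) hb' (by simp) hyr.2 ?_
    · funext j; simp
    · funext j; simp
    · intro k
      by_cases hk : k = b
      · subst hk
        simp; omega
      · rw [Function.update_of_ne hk]; exact hf.length_le k
    · intro σ2 k1 k2 k3 k4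
      refine ⟨by rw [k2]; simp [hm], _, ⟨rfl, ?_, ?_, ?_, ?_, ?_⟩, ?_⟩
      · rw [Function.update_idem, Function.update_self, List.append_assoc, ← htk] at k1
        exact k1.of_eq rfl rfl
      · intro z
        rw [St.setV_a, k4 _ (by omega) (by omega), htk]
        by_cases hz : z = y
        · simp [hz, v41]
        · simp [hz, gl z]
      · intro j hj
        simp [show j ≠ 43 by omega, show j ≠ 44 by omega, k2, g2 j hj]
      · exact k3.trans g3
      · intro D d1 d2 d3
        rw [St.setV_a, k4 D d2 d3, ← g4 D d1 d2 d3]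
        funext j
        simp [d1]
      · simp; omega
  · have := hf.rows.of_eq (σ' := σ.setV 43 0) rfl rfl
    simpa using this
  · intro z; simp
  · intro j hj
    simp [show j ≠ 43 by omega]
  · simp
  · rintro σ1 t ⟨-, B', ⟨-, g1, gl, g2, g3, g4⟩, ht⟩
    rw [List.take_length] at g1 gl
    refine ⟨?_, g1, gl, g2, g3, g4⟩
    simp only [Ex.cost_rd, Ex.cost_v, Ex.cost_ofNat] at ht ⊢
    omega

theorem ClassData.join {F' : ℕ → ℕ} {σ σ' : St} {u v : ℕ} (hf : ClassData n M o F f σ)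
    (hu : 1 ≤ u) (hun : u ≤ n) (hv : 1 ≤ v) (hvn : v ≤ n) (hne : F u ≠ F v)
    (hF : ∀ x y, F' x = F' y ↔ F x = F y ∨ (F x = F u ∧ F y = F v) ∨ (F x = F v ∧ F y = F u))
    (hr : Rows M (o + 4) (o + 5) (Function.update f (σ.a (o + 3) v)
      (f (σ.a (o + 3) v) ++ f (σ.a (o + 3) u))) σ')
    (hl : ∀ z, σ'.a (o + 3) z =
      if z ∈ f (σ.a (o + 3) u) then σ.a (o + 3) v else σ.a (o + 3) z) :
    ClassData n M o F' (Function.update f (σ.a (o + 3) v)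
      (f (σ.a (o + 3) v) ++ f (σ.a (o + 3) u))) σ' := by
  have mu := hf.mem u hu hun
  have mv := hf.mem v hv hvn
  have pv := hf.lab_pos v hv hvn
  have hab : σ.a (o + 3) u ≠ σ.a (o + 3) v := fun e => hne ((hf.lab_iff u v hu hun hv hvn).1 e)
  have li := hf.lab_iff
  have hin : ∀ z, 1 ≤ z → z ≤ n → (z ∈ f (σ.a (o + 3) u) ↔ σ.a (o + 3) z = σ.a (o + 3) u) :=
    fun z h1 h2 => by rw [mu z]; tauto
  refine ⟨hr, ?_, ?_, ?_, ?_, ?_, ?_⟩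
  · intro x h1 h2
    rw [hl]
    split_ifs
    · exact pv
    · exact hf.lab_pos x h1 h2
  · intro x hx
    rw [hl, if_neg (fun h => by have := (mu x).1 h; omega)]
    exact hf.lab_out x hx
  · intro x y h1 h2 h3 h4
    rw [hl, hl, hF, ← li x y h1 h2 h3 h4, ← li x u h1 h2 hu hun, ← li y v h3 h4 hv hvn,
      ← li x v h1 h2 hv hvn, ← li y u h3 h4 hu hun]
    simp only [hin x h1 h2, hin y h3 h4]
    split_ifs with g1 g2 g2
    · simp [g1, g2]
    · rw [g1]
      constructor
      · intro h; exact Or.inr (Or.inl ⟨rfl, h.symm⟩)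
      · rintro (h | ⟨-, h⟩ | ⟨-, h⟩)
        · exact absurd h.symm g2
        · exact h.symm
        · exact absurd h g2
    · rw [g2]
      constructor
      · intro h; exact Or.inr (Or.inr ⟨h, rfl⟩)
      · rintro (h | ⟨h, -⟩ | ⟨h, -⟩)
        · exact absurd h g1
        · exact absurd h g1
        · exact h
    · tauto
  · intro x h1 h2 y
    rw [hl x]
    have hy : 1 ≤ y → y ≤ n → (σ'.a (o + 3) y = σ.a (o + 3) v ↔
        σ.a (o + 3) y = σ.a (o + 3) v ∨ σ.a (o + 3) y = σ.a (o + 3) u) := by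
      intro k1 k2
      rw [hl y]
      simp only [hin y k1 k2]
      split_ifs with g
      · simp [g]
      · tauto
    by_cases hx : x ∈ f (σ.a (o + 3) u) ∨ σ.a (o + 3) x = σ.a (o + 3) v
    · have e : (if x ∈ f (σ.a (o + 3) u) then σ.a (o + 3) v else σ.a (o + 3) x) =
          σ.a (o + 3) v := by
        split_ifs with g
        · rfl
        · tauto
      rw [e, Function.update_self, List.mem_append, mu, mv]
      constructor
      · rintro (⟨k1, k2, k3⟩ | ⟨k1, k2, k3⟩)
        · exact ⟨k1, k2, (hy k1 k2).2 (Or.inl k3)⟩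
        · exact ⟨k1, k2, (hy k1 k2).2 (Or.inr k3)⟩
      · rintro ⟨k1, k2, k3⟩
        rcases (hy k1 k2).1 k3 with k | k
        · exact Or.inl ⟨k1, k2, k⟩
        · exact Or.inr ⟨k1, k2, k⟩
    · push Not at hx
      rw [if_neg hx.1, Function.update_of_ne hx.2, hf.mem x h1 h2]
      have hxu : σ.a (o + 3) x ≠ σ.a (o + 3) u := fun e => hx.1 ((hin x h1 h2).2 e)
      constructor
      · rintro ⟨k1, k2, k3⟩
        refine ⟨k1, k2, ?_⟩
        rw [hl y, if_neg, k3]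
        rw [hin y k1 k2, k3]
        exact hxu
      · rintro ⟨k1, k2, k3⟩
        refine ⟨k1, k2, ?_⟩
        rw [hl y] at k3
        split_ifs at k3 with g
        · exact absurd k3.symm hx.2
        · exact k3
  · intro k
    by_cases hk : k = σ.a (o + 3) v
    · subst hk
      rw [Function.update_self]
      refine List.Nodup.append (hf.nodup _) (hf.nodup _) ?_
      intro z z1 z2
      exact hab (((mu z).1 z2).2.2.symm.trans ((mv z).1 z1).2.2)
    · rw [Function.update_of_ne hk]
      exact hf.nodup k
  · intro k y hy
    by_cases hk : k = σ.a (o + 3) v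
    · subst hk
      rw [Function.update_self, List.mem_append] at hy
      rcases hy with hy | hy
      · exact hf.range _ y hy
      · exact hf.range _ y hy
    · rw [Function.update_of_ne hk] at hy
      exact hf.range k y hy

/-- The pair `(x, x + p)` consists of one position equivalent to `u` and one equivalent to `v`. -/
def Crosses (n : ℕ) (F : ℕ → ℕ) (u v p x : ℕ) : Prop :=
  1 ≤ x ∧ x + p ≤ n ∧ ((F x = F u ∧ F (x + p) = F v) ∨ (F x = F v ∧ F (x + p) = F u))

/-- Joining two classes takes time proportional to the increase of the potential. -/
theorem joinClasses_spec (hE : Env w n M C K) {F' : ℕ → ℕ} {i u p : ℕ} {σ : St}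
    (h1 : σ.v 1 = M) (hf : ClassData n M o F f σ) (h30 : σ.v 30 = i) (h38 : σ.v 38 = p)
    (hu : σ.a (o + 1) (i * M) = u) (hi1 : 1 ≤ i) (hin : i ≤ n) (hu1 : 1 ≤ u) (hun : u ≤ n)
    (hp : 1 ≤ p) (hpn : p ≤ n) (hne : F i ≠ F u)
    (hF : ∀ x y, F' x = F' y ↔ F x = F y ∨ (F x = F i ∧ F y = F u) ∨ (F x = F u ∧ F y = F i))
    (hgn : ∀ x, (g x).length < n) (hg : Rows M (o + 8) (o + 9) g σ) :
    HT w (joinClasses o) σ fun σ' t => t + 160 * potential n F ≤ 160 * potential n F' + 60 ∧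
      (∃ f', ClassData n M o F' f' σ') ∧
      Rows M (o + 8) (o + 9) (appendOn (Crosses n F i u p) p g) σ' ∧
      (∀ j, j < 40 → σ'.v j = σ.v j) ∧ σ'.x = σ.x ∧
      (∀ D, D < o + 3 ∨ o + 10 ≤ D ∨ D = o + 6 ∨ D = o + 7 → σ'.a D = σ.a D) := by
  have hw := hE.hw
  have hM := hE.hM
  have b1 := hE.sq_lt
  have b2 := hE.le_sq
  have b3 := hE.four_le_sq
  have c1 : i * M + 0 < M * M := mul_add_lt (by omega) (by omega)
  have pi := hf.lab_pos i hi1 hin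
  have pu := hf.lab_pos u hu1 hun
  have li := hf.length_le (σ.a (o + 3) i)
  have lu := hf.length_le (σ.a (o + 3) u)
  have si := (hf.rows (σ.a (o + 3) i)).1
  have su := (hf.rows (σ.a (o + 3) u)).1
  have zi := hf.length_eq hi1 hin
  have zu := hf.length_eq hu1 hun
  unfold joinClasses
  refine HT.seq (HT.asg hw (by simp [h30]; omega) ?_)
  refine HT.seq (HT.asg hw (by simp [h30, h1, hu]; omega) ?_)
  generalize hσ1 : St.setV _ 41 _ = σ1
  have v40 : σ1.v 40 = σ.a (o + 3) i := by rw [← hσ1]; simp [h30]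
  have v41 : σ1.v 41 = σ.a (o + 3) u := by rw [← hσ1]; simp [h30, h1, hu]
  have vj : ∀ j, j < 40 → σ1.v j = σ.v j := by
    intro j hj; rw [← hσ1]; simp [show j ≠ 40 by omega, show j ≠ 41 by omega]
  have va : σ1.a = σ.a := by rw [← hσ1]; rfl
  have vx : σ1.x = σ.x := by rw [← hσ1]; rfl
  clear hσ1
  -- After the exchange, variable `40` refers to the smaller class.
  have swap : HT w (ite (.lt (.rd (o + 5) (.v 41)) (.rd (o + 5) (.v 40)))
      (.seq (asg 42 (.v 40)) (.seq (asg 40 (.v 41)) (asg 41 (.v 42)))) .skip) σ1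
      fun σ' t => t ≤ 20 ∧ (∃ s l, (s = i ∧ l = u ∨ s = u ∧ l = i) ∧
        classSize n F s ≤ classSize n F l ∧ σ'.v 40 = σ.a (o + 3) s ∧ σ'.v 41 = σ.a (o + 3) l) ∧
        (∀ j, j < 40 → σ'.v j = σ.v j) ∧ σ'.a = σ.a ∧ σ'.x = σ.x := by
    refine HT.ite hw (by simp [v40, v41, va]; omega) (fun hlt => ?_) (fun hge => ?_)
    · simp [v40, v41, va, si, su, zi, zu] at hlt
      refine HT.seq (HT.asg hw (by simp [v40]; omega) ?_)
      refine HT.seq (HT.asg hw (by simp [v41]; omega) ?_)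
      refine HT.asg hw (by simp [v40]; omega) ?_
      refine ⟨by simp, ⟨u, i, Or.inr ⟨rfl, rfl⟩, hlt.le, by simp [v41], by simp [v40]⟩, ?_, va, vx⟩
      intro j hj
      simp [show j ≠ 40 by omega, show j ≠ 41 by omega, show j ≠ 42 by omega, vj j hj]
    · simp [v40, v41, va, si, su, zi, zu] at hge
      exact HT.skip ⟨by simp, ⟨i, u, Or.inl ⟨rfl, rfl⟩, hge, v40, v41⟩, vj, va, vx⟩
  refine HT.seq (HT.mono swap ?_)
  rintro σ2 t2 ⟨ht2, ⟨s, l, hsl, hle, w40, w41⟩, wj, wa, wx⟩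
  have hs : 1 ≤ s ∧ s ≤ n ∧ 1 ≤ l ∧ l ≤ n ∧ F s ≠ F l := by
    rcases hsl with ⟨rfl, rfl⟩ | ⟨rfl, rfl⟩
    · exact ⟨hi1, hin, hu1, hun, hne⟩
    · exact ⟨hu1, hun, hi1, hin, hne.symm⟩
  obtain ⟨hs1, hsn, hl1, hln, hsne⟩ := hs
  have hF2 : ∀ x y, F' x = F' y ↔
      F x = F y ∨ (F x = F s ∧ F y = F l) ∨ (F x = F l ∧ F y = F s) := by
    intro x y
    rcases hsl with ⟨rfl, rfl⟩ | ⟨rfl, rfl⟩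
    · exact hF x y
    · rw [hF]; tauto
  have hcr : ∀ x, Crosses n F i u p x ↔ Crosses n F s l p x := by
    intro x
    rcases hsl with ⟨rfl, rfl⟩ | ⟨rfl, rfl⟩
    · rfl
    · simp only [Crosses]; tauto
  have hf2 : ClassData n M o F f σ2 := hf.of_eq (by rw [wa]) (by rw [wa]) (by rw [wa])
  have ps := hf.lab_pos s hs1 hsn
  have pl := hf.lab_pos l hl1 hln
  have hab : σ.a (o + 3) s ≠ σ.a (o + 3) l := fun e => hsne ((hf.lab_iff s l hs1 hsn hl1 hln).1 e)
  have hms := hf.mem s hs1 hsn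
  have hml := hf.mem l hl1 hln
  have hdis : (f (σ.a (o + 3) l)).length + (f (σ.a (o + 3) s)).length ≤ n := by
    rw [← List.length_append]
    refine length_le_of_nodup (List.Nodup.append (hf.nodup _) (hf.nodup _) ?_) ?_
    · intro z z1 z2
      exact hab (((hms z).1 z2).2.2.symm.trans ((hml z).1 z1).2.2)
    · intro y hy
      rcases List.mem_append.1 hy with hy | hy
      · exact hf.range _ y hy
      · exact hf.range _ y hy
  have assoc : ∀ (P1 P2 P3 P4 : Prog) (σ : St) (R : St → ℕ → Prop),
      HT w (.seq P1 P2) σ (fun σ1 t1 => HT w (.seq P3 P4) σ1 fun σ2 t2 => R σ2 (t1 + t2)) →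
      HT w (.seq P1 (.seq P2 (.seq P3 P4))) σ R := by
    intro P1 P2 P3 P4 σ R h s hs
    obtain ⟨t1, s1, σ1, g1, g2, g3⟩ := h s hs
    obtain ⟨t2, s2, σ2, g4, g5, g6⟩ := g3 s1 g2
    cases g1 with
    | seq _ _ _ s' _ ta tb k1 k2 =>
      exact ⟨_, s2, σ2, .seq _ _ _ _ _ _ _ k1 (.seq _ _ _ _ _ _ _ k2 g4), g5,
        by rw [← add_assoc]; exact g6⟩
  refine assoc _ _ _ _ _ _ ?_
  refine HT.mono (scanLoop_spec (g := g) hE ((wj 1 (by omega)).trans h1) hf2 w40 w41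
    ((wj 38 (by omega)).trans h38) hp hpn ps.2 pl.1 pl.2 hab (by rw [wa]; exact hms) hgn
    (hg.of_eq (by rw [wa]) (by rw [wa]))) ?_
  rintro σ3 t3 ⟨ht3, r1, r2, r3, r4⟩
  have hf3 : ClassData n M o F f σ3 := hf2.of_eq (r4 _ (by omega) (by omega))
    (r4 _ (by omega) (by omega)) (r4 _ (by omega) (by omega))
  have e3 : σ3.a (o + 3) = σ.a (o + 3) := by rw [r4 _ (by omega) (by omega), wa]
  refine HT.mono (moveLoop_spec hE ((r2 1 (by omega)).trans ((wj 1 (by omega)).trans h1)) hf3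
    ((r2 40 (by omega)).trans w40) ((r2 41 (by omega)).trans w41) ps.2 pl.2 hab hdis) ?_
  rintro σ4 t4 ⟨ht4, q1, q2, q3, q4, q5⟩
  have hpot : potential n F + classSize n F s ≤ potential n F' :=
    potential_join (v := l) (fun a _ b _ e => (hF2 a b).2 (Or.inl e))
      (Finset.mem_Icc.2 ⟨hs1, hsn⟩) (Finset.mem_Icc.2 ⟨hl1, hln⟩) hsne
      ((hF2 s l).2 (Or.inr (Or.inl ⟨rfl, rfl⟩))) hle
  have zs := hf.length_eq hs1 hsn
  refine ⟨?_, ⟨_, ClassData.join (F' := F') hf3 hs1 hsn hl1 hln hsne hF2 (by rw [e3]; exact q1)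
    (by rw [e3]; intro z; rw [q2, e3])⟩, ?_, ?_, ?_, ?_⟩
  · simp only [Ex.cost_rd, Ex.cost_v, Ex.cost_mul]
    omega
  · rw [wa] at r1
    rw [appendOn_congr (E' := Scanned n (σ.a (o + 3)) p (σ.a (o + 3) l) (f (σ.a (o + 3) s)))]
    · exact r1.of_eq (q5 _ (by omega) (by omega) (by omega)) (q5 _ (by omega) (by omega) (by omega))
    · intro x
      rw [hcr x]
      simp only [Crosses, Scanned, hms]
      refine and_congr_right fun k1 => and_congr_right fun k2 => ?_
      rw [← hf.lab_iff x s k1 (by omega) hs1 hsn, ← hf.lab_iff x l k1 (by omega) hl1 hln,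
        ← hf.lab_iff (x + p) s (by omega) k2 hs1 hsn, ← hf.lab_iff (x + p) l (by omega) k2 hl1 hln]
      constructor
      · rintro (⟨k3, k4⟩ | ⟨k3, k4⟩)
        · exact Or.inl ⟨⟨k1, by omega, k3⟩, k4⟩
        · exact Or.inr ⟨⟨by omega, k2, k4⟩, k3⟩
      · rintro (⟨k3, k4⟩ | ⟨k3, k4⟩)
        · exact Or.inl ⟨k3.2.2, k4⟩
        · exact Or.inr ⟨k4, k3.2.2⟩
  · intro j hj
    rw [q3 j (by omega), r2 j (by omega), wj j hj]
  · rw [q4, r3, wx]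
  · intro D hD
    rw [q5 D (by omega) (by omega) (by omega), r4 D (by omega) (by omega), wa]

end join

end WordRAM

/-! ### Collecting all pairs of equivalent factors that cannot be extended -/

/-- The positions that branch off at level `k + 1`; at level `k` they are joined to their parents. -/
noncomputable def edges (n : ℕ) (rel : ℕ → ℕ → ℕ → Prop) (k : ℕ) : List ℕ :=
  (List.range' 2 (n - 1)).filter fun i => dep rel i = k + 1

theorem mem_edges {n : ℕ} {rel : ℕ → ℕ → ℕ → Prop} {k i : ℕ} :
    i ∈ edges n rel k ↔ 2 ≤ i ∧ i ≤ n ∧ dep rel i = k + 1 := by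
  simp only [edges, List.mem_filter, List.mem_range'_1, decide_eq_true_eq]
  omega

theorem nodup_edges {n : ℕ} {rel : ℕ → ℕ → ℕ → Prop} {k : ℕ} : (edges n rel k).Nodup :=
  (List.nodup_range' (step := 1)).filter _

theorem length_filter_le_succ (l : List ℕ) (d : ℕ → ℕ) (p : ℕ) :
    (l.filter fun i => d i = p + 1).length + (l.filter fun i => d i ≤ p).length =
      (l.filter fun i => d i ≤ p + 1).length := by
  induction l with
  | nil => rfl
  | cons a l ih =>
    simp only [List.filter_cons, decide_eq_true_eq]
    split_ifs <;> (try simp only [List.length_cons]) <;> omega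

/-- The class representatives between the levels `p + 1` and `p`: those in `s` have already been
replaced by their parents. -/
noncomputable def partialRp (rel : ℕ → ℕ → ℕ → Prop) (p : ℕ) (s : List ℕ) (x : ℕ) : ℕ :=
  if rp rel (p + 1) x ∈ s then par rel (rp rel (p + 1) x) else rp rel (p + 1) x

namespace LevelSystem

variable {n : ℕ} {rel : ℕ → ℕ → ℕ → Prop}

theorem rp_rp_succ (h : LevelSystem n rel) (p x : ℕ) :
    rp rel p (rp rel (p + 1) x) = rp rel p x := by
  rcases h.rp_mem (p + 1) x with e | e
  · rw [e]
  · exact (h.rp_eq_of_rel (h.mono e)).symm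

theorem partialRp_edges (h : LevelSystem n rel) {p : ℕ} (hp : 1 ≤ p) :
    partialRp rel p (edges n rel p) = rp rel p := by
  funext x
  have h1 := h.rp_rp_succ p x
  have h2 := h.dep_rp_le x (p + 1)
  unfold partialRp
  generalize rp rel (p + 1) x = u at *
  split_ifs with hu
  · have h3 := (mem_edges.1 hu).2.2
    rw [h.par_of_pos (by omega), h3, Nat.add_sub_cancel, h1]
  · rw [← h1, eq_comm, h.rp_eq_self_iff]
    by_contra hlt
    obtain ⟨y, hy, hr⟩ := h.lt_dep_iff.1 (not_le.1 hlt)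
    have h3 := h.valid hr
    have h4 := h.valid_right hr
    exact hu (mem_edges.2 ⟨by omega, by omega, by omega⟩)

theorem partialRp_of_mem (h : LevelSystem n rel) {p i : ℕ} {s : List ℕ}
    (hi : i ∈ edges n rel p) (his : i ∉ s) (hs : ∀ j ∈ s, j ∈ edges n rel p) :
    partialRp rel p s i = i ∧ partialRp rel p s (par rel i) = par rel i := by
  have hd := (mem_edges.1 hi).2.2
  have e1 : rp rel (p + 1) i = i := h.rp_eq_self_iff.2 hd.le
  have hlt := h.dep_par_lt (x := i) (by omega)
  have e2 : rp rel (p + 1) (par rel i) = par rel i := h.rp_eq_self_iff.2 (by omega)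
  unfold partialRp
  rw [e1, e2, if_neg his, if_neg fun hm => ?_]
  · exact ⟨rfl, rfl⟩
  · have := (mem_edges.1 (hs _ hm)).2.2
    omega

theorem partialRp_append (h : LevelSystem n rel) {p i : ℕ} {s : List ℕ}
    (hi : i ∈ edges n rel p) (hs : ∀ j ∈ s, j ∈ edges n rel p) (x : ℕ) :
    partialRp rel p (s ++ [i]) x =
      if partialRp rel p s x = i then par rel i else partialRp rel p s x := by
  have hd := (mem_edges.1 hi).2.2
  have hlt := h.dep_par_lt (x := i) (by omega)
  unfold partialRp
  generalize rp rel (p + 1) x = u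
  by_cases h1 : u ∈ s
  · have h2 := (mem_edges.1 (hs u h1)).2.2
    have h3 := h.dep_par_lt (x := u) (by omega)
    have h4 : par rel u ≠ i := fun e => by rw [e] at h3; omega
    simp [h1, h4]
  · by_cases h2 : u = i
    · subst h2
      simp [h1]
    · simp [h1, h2]

/-- Joining `i` to its parent identifies the classes of `i` and of its parent, and no others. -/
theorem partialRp_append_iff (h : LevelSystem n rel) {p i : ℕ} {s : List ℕ}
    (hi : i ∈ edges n rel p) (his : i ∉ s) (hs : ∀ j ∈ s, j ∈ edges n rel p) (x y : ℕ) :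
    partialRp rel p (s ++ [i]) x = partialRp rel p (s ++ [i]) y ↔
      partialRp rel p s x = partialRp rel p s y ∨
      (partialRp rel p s x = partialRp rel p s i ∧
        partialRp rel p s y = partialRp rel p s (par rel i)) ∨
      (partialRp rel p s x = partialRp rel p s (par rel i) ∧
        partialRp rel p s y = partialRp rel p s i) := by
  obtain ⟨e1, e2⟩ := h.partialRp_of_mem hi his hs
  rw [h.partialRp_append hi hs, h.partialRp_append hi hs, e1, e2]
  split_ifs with h1 h2 h2
  · simp [h1, h2]
  · rw [h1]
    constructor
    · intro e; exact Or.inr (Or.inl ⟨rfl, e.symm⟩)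
    · rintro (e | ⟨-, e⟩ | ⟨-, e⟩)
      · exact absurd e.symm h2
      · exact e.symm
      · exact absurd e h2
  · rw [h2]
    constructor
    · intro e; exact Or.inr (Or.inr ⟨e, rfl⟩)
    · rintro (e | ⟨e, -⟩ | ⟨e, -⟩)
      · exact absurd e h1
      · exact absurd e h1
      · exact e
  · constructor
    · exact Or.inl
    · rintro (e | ⟨e, -⟩ | ⟨-, e⟩)
      · exact e
      · exact absurd e h1
      · exact absurd e h2

theorem mem_newPairs_iff_rp (h : LevelSystem n rel) {p x : ℕ} (hp : 1 ≤ p) :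
    x ∈ newPairs n rel p ↔ 1 ≤ x ∧ x + p ≤ n ∧ rp rel (p + 1) x ≠ rp rel (p + 1) (x + p) ∧
      rp rel p x = rp rel p (x + p) := by
  rw [h.mem_newPairs hp, ne_eq, h.rp_eq_iff, h.rp_eq_iff]
  constructor
  · rintro ⟨h1, h2⟩
    have := h.valid h1
    have := h.valid_right h1
    exact ⟨by omega, by omega, not_or.2 ⟨by omega, h2⟩, Or.inr h1⟩
  · rintro ⟨h1, h2, h3, h4⟩
    exact ⟨h4.resolve_left (by omega), fun h5 => h3 (Or.inr h5)⟩

end LevelSystem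

/-- The list `g x` contains, without repetition, the distances `q > p` such that `(x, x + q)` is among
the pairs that become equivalent at level `q`. -/
structure Collected (n : ℕ) (rel : ℕ → ℕ → ℕ → Prop) (p : ℕ) (g : ℕ → List ℕ) : Prop where
  nodup : ∀ x, (g x).Nodup
  mem : ∀ x q, q ∈ g x ↔ p < q ∧ x ∈ newPairs n rel q

namespace Collected

variable {n : ℕ} {rel : ℕ → ℕ → ℕ → Prop} {p : ℕ} {g : ℕ → List ℕ}

theorem bound (hg : Collected n rel p g) (h : LevelSystem n rel) {x q : ℕ} (hq : q ∈ g x) :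
    1 ≤ x ∧ p < q ∧ x + q ≤ n := by
  obtain ⟨h1, h2⟩ := (hg.mem x q).1 hq
  have := (h.mem_newPairs_iff_rp (by omega)).1 h2
  exact ⟨this.1, h1, this.2.1⟩

theorem length_le (hg : Collected n rel p g) (h : LevelSystem n rel) (x : ℕ) :
    (g x).length ≤ n - 1 - p := by
  have h1 : (g x).toFinset ⊆ Finset.Ioo p n := fun q hq => by
    have := hg.bound h (List.mem_toFinset.1 hq)
    rw [Finset.mem_Ioo]
    omega
  have := Finset.card_le_card h1
  rw [List.toFinset_card_of_nodup (hg.nodup x), Nat.card_Ioo] at this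
  omega

end Collected

namespace WordRAM

theorem appendOn_appendOn {E E' : ℕ → Prop} (p : ℕ) (g : ℕ → List ℕ) (h : ∀ x, E x → ¬ E' x) :
    appendOn E' p (appendOn E p g) = appendOn (fun x => E x ∨ E' x) p g := by
  funext x
  by_cases h1 : E x
  · simp [appendOn, h1, h x h1]
  · by_cases h2 : E' x <;> simp [appendOn, h1, h2]

theorem Collected.appendOn {n : ℕ} {rel : ℕ → ℕ → ℕ → Prop} {p : ℕ} {g : ℕ → List ℕ}
    (hg : Collected n rel (p + 1) g) :
    Collected n rel p (appendOn (fun x => x ∈ newPairs n rel (p + 1)) (p + 1) g) where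
  nodup := by
    intro x
    unfold WordRAM.appendOn
    split_ifs
    · refine List.Nodup.append (hg.nodup x) (List.nodup_singleton _) ?_
      intro q h1 h2
      have := ((hg.mem x q).1 h1).1
      rw [List.mem_singleton.1 h2] at this
      omega
    · exact hg.nodup x
  mem := by
    intro x q
    unfold WordRAM.appendOn
    split_ifs with hx
    · rw [List.mem_append, hg.mem, List.mem_singleton]
      constructor
      · rintro (⟨h1, h2⟩ | rfl)
        · exact ⟨by omega, h2⟩
        · exact ⟨by omega, hx⟩
      · rintro ⟨h1, h2⟩
        by_cases e : q = p + 1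
        · exact Or.inr e
        · exact Or.inl ⟨by omega, h2⟩
    · rw [hg.mem]
      constructor
      · rintro ⟨h1, h2⟩
        exact ⟨by omega, h2⟩
      · rintro ⟨h1, h2⟩
        by_cases e : q = p + 1
        · exact absurd (e ▸ h2) hx
        · exact ⟨by omega, h2⟩

/-- Makes each position a class of its own. -/
def initClasses (o : ℕ) : Prog :=
  .seq (asg 30 1) (forUp 30 (.v 1)
    (.seq (put (o + 3) (.v 30) (.v 30)) (push (o + 4) (o + 5) 30 30)))

/-- Sorts the positions by the level at which they are joined to their parents. -/
def bucketEdges (o : ℕ) : Prog :=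
  .seq (asg 30 2) (forUp 30 (.v 1)
    (.seq (asg 31 (.rd o (.v 30) - 1)) (push (o + 6) (o + 7) 31 30)))

/-- Joins the classes from level `n` down to level `1`. -/
def joinLevels (o : ℕ) : Prog :=
  .seq (asg 37 0) (forUp 37 (.v 0)
    (.seq (asg 38 (.v 0 - .v 37)) (.seq (asg 39 0) (forUp 39 (.rd (o + 7) (.v 38))
      (.seq (asg 30 (.rd (o + 6) (.v 38 * .v 1 + .v 39))) (joinClasses o))))))

section levels

variable {w n M C K o : ℕ} {rel : ℕ → ℕ → ℕ → Prop}

theorem initClasses_spec (hE : Env w n M C K) (h : LevelSystem n rel) {σ : St}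
    (hcfg : Cfg n M C K σ) (h0 : ∀ A, o + 3 ≤ A → A < o + 6 → ∀ j, σ.a A j = 0) :
    HT w (initClasses o) σ fun σ' t => t ≤ 40 * (n + 1) ∧
      (∃ f, ClassData n M o (rp rel (n + 1)) f σ') ∧ (∀ j, j < 10 → σ'.v j = σ.v j) ∧
      σ'.x = σ.x ∧ (∀ A, A < o + 3 ∨ o + 6 ≤ A → σ'.a A = σ.a A) := by
  have hw := hE.hw
  have hM := hE.hM
  have hn := hE.hn
  have b1 := hE.sq_lt
  have b2 := hE.le_sq
  let f : ℕ → ℕ → List ℕ := fun m k => if 1 ≤ k ∧ k < m then [k] else []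
  have hf : ∀ m k, (f m k).length ≤ n := by
    intro m k; simp only [f]; split_ifs <;> simp; omega
  refine HT.seq (HT.asg hw (by simp; omega) ?_)
  refine HT.mono (HT.forUp hw (b := M) (a := 1) (B := 30 * n) (fun m B σ' => B = 30 * (M - m) ∧
    1 ≤ m ∧ (∀ x, σ'.a (o + 3) x = if 1 ≤ x ∧ x < m then x else 0) ∧
    Rows M (o + 4) (o + 5) (f m) σ' ∧ (∀ j, j < 10 → σ'.v j = σ.v j) ∧
      σ'.x = σ.x ∧ (∀ A, A < o + 3 ∨ o + 6 ≤ A → σ'.a A = σ.a A)) ?_ (by omega) (by omega)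
      ⟨by omega, le_rfl, ?_, ?_, ?_, rfl, fun _ _ => rfl⟩ ?_) ?_
  · rintro m B σ1 ⟨rfl, g0, g1, g2, g3, g4, g5⟩ hm hmM
    have v1 := (g3 1 (by omega)).trans hcfg.v1
    refine ⟨by simp [v1]; omega, by simp [v1], fun hlt => ?_⟩
    refine HT.seq (HT.put hw (by simp [hm]; omega) (by simp [hm]; omega) ?_)
    refine HT.push hE (k := m) (z := m) (f := f m) (by omega) v1 (g2.of_eq ?_ ?_) (hf m)
      hm (by omega) hm (by omega) ?_
    · funext j; simp
    · funext j; simp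
    · intro σ2 k1 k2 k3 k4
      refine ⟨by rw [k2]; simp [hm], _, ⟨rfl, by omega, ?_, ?_, ?_, ?_, ?_⟩, ?_⟩
      · intro x
        rw [St.setV_a, k4 _ (by omega) (by omega)]
        simp only [St.setA_a, Ex.eval_v, hm, true_and, g1]
        split_ifs <;> omega
      · have e : Function.update (f m) m (f m m ++ [m]) = f (m + 1) := by
          funext k
          by_cases hk : k = m
          · subst hk; simp [f, g0]
          · rw [Function.update_of_ne hk]
            simp only [f]
            have : (1 ≤ k ∧ k < m) ↔ (1 ≤ k ∧ k < m + 1) := by omega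
            simp only [this]
        rw [e] at k1
        exact k1.of_eq rfl rfl
      · intro j hj
        simp [show j ≠ 30 by omega, k2, g3 j hj]
      · exact k3.trans g4
      · intro D hD
        rw [St.setV_a, k4 D (by omega) (by omega), ← g5 D hD]
        funext j
        simp [show D ≠ o + 3 by omega]
      · simp; omega
  · intro x
    rw [St.setV_a, h0 _ (by omega) (by omega), if_neg (by omega)]
  · intro k
    have : f 1 k = [] := if_neg (by omega)
    simp [this, h0 (o + 5) (by omega) (by omega)]
  · intro j hj
    simp [show j ≠ 30 by omega]
  · simp
  · rintro σ1 t ⟨-, B', ⟨-, -, g1, g2, g3, g4, g5⟩, ht⟩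
    have e : ∀ x, 1 ≤ x → x ≤ n → σ1.a (o + 3) x = x := fun x h1 h2 => by
      rw [g1, if_pos (by omega)]
    refine ⟨by simp at ht ⊢; omega, ⟨f M, g2, ?_, ?_, ?_, ?_, ?_, ?_⟩, g3, g4, g5⟩
    · intro x h1 h2; rw [e x h1 h2]; omega
    · intro x hx; rw [g1, if_neg (by omega)]
    · intro x y h1 h2 h3 h4
      rw [e x h1 h2, e y h3 h4, h.rp_eq_self_iff.2 (h.dep_le_succ x),
        h.rp_eq_self_iff.2 (h.dep_le_succ y)]
    · intro x h1 h2 y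
      rw [e x h1 h2]
      simp only [f, if_pos (show 1 ≤ x ∧ x < M by omega), List.mem_singleton]
      constructor
      · rintro rfl; exact ⟨h1, h2, e y h1 h2⟩
      · rintro ⟨h3, h4, h5⟩; rwa [e y h3 h4] at h5
    · intro k; simp only [f]; split_ifs <;> simp
    · intro k y hy
      simp only [f] at hy
      split_ifs at hy with hk
      · rw [List.mem_singleton] at hy; omega
      · simp at hy

theorem bucketEdges_spec (hE : Env w n M C K) (h : LevelSystem n rel) {σ : St}
    (hcfg : Cfg n M C K σ) (hT : TreeData rel M K o n σ)
    (h0 : ∀ A, o + 6 ≤ A → A < o + 8 → ∀ j, σ.a A j = 0) :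
    HT w (bucketEdges o) σ fun σ' t => t ≤ 40 * (n + 1) ∧
      Rows M (o + 6) (o + 7) (edges n rel) σ' ∧ (∀ j, j < 10 → σ'.v j = σ.v j) ∧
      σ'.x = σ.x ∧ (∀ A, A < o + 6 ∨ o + 8 ≤ A → σ'.a A = σ.a A) := by
  have hw := hE.hw
  have hM := hE.hM
  have hn := hE.hn
  have b1 := hE.sq_lt
  have b2 := hE.le_sq
  let f : ℕ → ℕ → List ℕ := fun m k => (List.range' 2 (m - 2)).filter fun i => dep rel i = k + 1
  have hf : ∀ m, m ≤ M → ∀ k, (f m k).length ≤ n := by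
    intro m hm k
    refine (List.length_filter_le _ _).trans ?_
    rw [List.length_range']; omega
  refine HT.seq (HT.asg hw (by simp; omega) ?_)
  refine HT.mono (HT.forUp hw (b := M) (a := 2) (B := 35 * n) (fun m B σ' => B = 35 * (M - m) + 35 ∧
    2 ≤ m ∧
    Rows M (o + 6) (o + 7) (f m) σ' ∧ (∀ j, j < 10 → σ'.v j = σ.v j) ∧
      σ'.x = σ.x ∧ (∀ A, A < o + 6 ∨ o + 8 ≤ A → σ'.a A = σ.a A)) ?_ (by omega) (by omega)
      ⟨by omega, le_rfl, ?_, ?_, rfl, fun _ _ => rfl⟩ ?_) ?_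
  · rintro m B σ1 ⟨rfl, g0, g2, g3, g4, g5⟩ hm hmM
    have v1 := (g3 1 (by omega)).trans hcfg.v1
    refine ⟨by simp [v1]; omega, by simp [v1], fun hlt => ?_⟩
    have ea : σ1.a o m = dep rel m := by rw [g5 o (by omega), hT.dep m (by omega)]
    have d1 := h.dep_pos g0 (by omega)
    have d2 := h.dep_le (x := m) (by omega)
    refine HT.seq (HT.asg hw (by simp [hm, ea]; omega) ?_)
    refine HT.push hE (k := dep rel m - 1) (z := m) (f := f m) (by omega) (by simp [v1])
      (g2.of_eq rfl rfl) (hf m hmM) (by simp [hm, ea]) (by omega) (by simp [hm]) (by omega) ?_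
    intro σ2 k1 k2 k3 k4
    refine ⟨by rw [k2]; simp [hm], _, ⟨rfl, by omega, ?_, ?_, ?_, ?_⟩, ?_⟩
    · have e : Function.update (f m) (dep rel m - 1) (f m (dep rel m - 1) ++ [m]) = f (m + 1) := by
        have hr : List.range' 2 (m + 1 - 2) = List.range' 2 (m - 2) ++ [m] := by
          rw [show m + 1 - 2 = m - 2 + 1 by omega, List.range'_concat]
          congr 2
          omega
        funext k
        by_cases hk : k = dep rel m - 1
        · have hd : dep rel m = k + 1 := by omega
          rw [hk, Function.update_self, ← hk]
          simp only [f, hr, List.filter_append]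
          congr 1
          simp [hd]
        · have hd : dep rel m ≠ k + 1 := by omega
          rw [Function.update_of_ne hk]
          simp only [f, hr, List.filter_append]
          simp [hd]
      rw [e] at k1
      exact k1.of_eq rfl rfl
    · intro j hj
      simp [show j ≠ 30 by omega, show j ≠ 31 by omega, k2, g3 j hj]
    · exact k3.trans g4
    · intro D hD
      rw [St.setV_a, k4 D (by omega) (by omega), St.setV_a, g5 D hD]
    · simp; omega
  · intro k
    simp [f, h0 (o + 7) (by omega) (by omega)]
  · intro j hj
    simp [show j ≠ 30 by omega]
  · simp
  · rintro σ1 t ⟨-, B', ⟨-, -, g2, g3, g4, g5⟩, ht⟩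
    refine ⟨by simp at ht ⊢; omega, ?_, g3, g4, g5⟩
    have : f M = edges n rel := by
      funext k; simp only [f, edges, hM]; rfl
    rwa [this] at g2

/-- The pairs at distance `p` that are equivalent once the positions in `s` have been joined to their
parents, but not at level `p + 1`. -/
def Joined (n : ℕ) (rel : ℕ → ℕ → ℕ → Prop) (p : ℕ) (s : List ℕ) (x : ℕ) : Prop :=
  1 ≤ x ∧ x + p ≤ n ∧ rp rel (p + 1) x ≠ rp rel (p + 1) (x + p) ∧
    partialRp rel p s x = partialRp rel p s (x + p)

/-- Joining all positions that branch off at level `p + 1` turns the partition of level `p + 1` into that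
of level `p`, and records the new pairs at distance `p`. -/
theorem joinLevel_spec (hE : Env w n M C K) (h : LevelSystem n rel) {p : ℕ} {σ : St}
    {f g : ℕ → List ℕ} (hcfg : Cfg n M C K σ) (hT : TreeData rel M K o n σ) (hp : 1 ≤ p)
    (hpn : p ≤ n) (h38 : σ.v 38 = p) (he : Rows M (o + 6) (o + 7) (edges n rel) σ)
    (hf : ClassData n M o (rp rel (p + 1)) f σ) (hg : Collected n rel p g)
    (hr : Rows M (o + 8) (o + 9) g σ) :
    HT w (.seq (asg 39 0) (forUp 39 (.rd (o + 7) (.v 38))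
      (.seq (asg 30 (.rd (o + 6) (.v 38 * .v 1 + .v 39))) (joinClasses o)))) σ fun σ' t =>
      t + 160 * potential n (rp rel (p + 1)) ≤
        160 * potential n (rp rel p) + 100 * (edges n rel p).length + 10 ∧
      (∃ f', ClassData n M o (rp rel p) f' σ') ∧
      Rows M (o + 8) (o + 9) (appendOn (fun x => x ∈ newPairs n rel p) p g) σ' ∧
      (∀ j, j < 30 ∨ j = 37 ∨ j = 38 → σ'.v j = σ.v j) ∧ σ'.x = σ.x ∧
      (∀ D, D < o + 3 ∨ o + 10 ≤ D ∨ D = o + 6 ∨ D = o + 7 → σ'.a D = σ.a D) := by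
  have hw := hE.hw
  have hM := hE.hM
  have b1 := hE.sq_lt
  have b2 := hE.le_sq
  have b3 := hE.four_le_sq
  have hel : (edges n rel p).length ≤ n := by
    refine length_le_of_nodup nodup_edges fun i hi => ?_
    have := mem_edges.1 hi
    omega
  have hpot : ∀ F, potential n F ≤ n * Nat.log 2 n := potential_le n
  generalize n * Nat.log 2 n = X at hpot
  refine HT.seq (HT.asg hw (by simp) ?_)
  refine HT.mono (HT.forUp hw (b := (edges n rel p).length) (a := 0)
    (B := 160 * (X - potential n (rp rel (p + 1))) + 100 * (edges n rel p).length)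
    (fun m B σ' => B = 160 * (X - potential n (partialRp rel p ((edges n rel p).take m))) +
        100 * ((edges n rel p).length - m) ∧
      (∃ f', ClassData n M o (partialRp rel p ((edges n rel p).take m)) f' σ') ∧
      Rows M (o + 8) (o + 9) (appendOn (Joined n rel p ((edges n rel p).take m)) p g) σ' ∧
      (∀ j, j < 30 ∨ j = 37 ∨ j = 38 → σ'.v j = σ.v j) ∧ σ'.x = σ.x ∧
      (∀ D, D < o + 3 ∨ o + 10 ≤ D ∨ D = o + 6 ∨ D = o + 7 → σ'.a D = σ.a D))
      ?_ (by omega) (by omega) ?_ ?_) ?_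
  · rintro m B σ1 ⟨rfl, ⟨f1, g1⟩, g2, g3, g4, g5⟩ hm hml
    have v1 := (g3 1 (by omega)).trans hcfg.v1
    have v38 := (g3 38 (by omega)).trans h38
    have e7 : σ1.a (o + 7) p = (edges n rel p).length := by rw [g5 _ (by omega), (he p).1]
    refine ⟨by simp [v38, e7]; omega, by simp [v38, e7], fun hlt => ?_⟩
    obtain ⟨i, hi⟩ : ∃ i, (edges n rel p)[m] = i := ⟨_, rfl⟩
    have e6 : σ1.a (o + 6) (p * M + m) = i := by rw [g5 _ (by omega), (he p).2 m hlt, hi]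
    have hmem : i ∈ edges n rel p := hi ▸ List.getElem_mem hlt
    obtain ⟨i1, i2, i3⟩ := mem_edges.1 hmem
    have c1 : p * M + m < M * M := mul_add_lt (by omega) (by omega)
    have hnot : i ∉ (edges n rel p).take m := by
      rw [List.mem_take_iff_getElem]
      rintro ⟨j, hj, e⟩
      have := (nodup_edges (n := n) (rel := rel) (k := p)).getElem_inj_iff.1 (e.trans hi.symm)
      omega
    have htake : (edges n rel p).take (m + 1) = (edges n rel p).take m ++ [i] := by
      rw [List.take_succ_eq_append_getElem hlt, hi]
    have hsub : ∀ j ∈ (edges n rel p).take m, j ∈ edges n rel p := fun j hj =>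
      List.mem_of_mem_take hj
    obtain ⟨q1, q2⟩ := h.partialRp_of_mem hmem hnot hsub
    have hpl := h.par_lt (x := i) (by omega)
    have hp1 := h.one_le_par (x := i) (by omega)
    have hiff := h.partialRp_append_iff hmem hnot hsub
    rw [← htake] at hiff
    have hmono : ∀ x y, rp rel (p + 1) x = rp rel (p + 1) y →
        partialRp rel p ((edges n rel p).take m) x =
          partialRp rel p ((edges n rel p).take m) y := by
      intro x y e; unfold partialRp; rw [e]
    generalize (edges n rel p).take m = s at *
    generalize (edges n rel p).take (m + 1) = s' at *
    refine HT.seq (HT.asg hw (by simp [v38, v1, hm, e6]; omega) ?_)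
    have e30 : Ex.eval σ1 (.rd (o + 6) (.v 38 * .v 1 + .v 39)) = i := by simp [v38, v1, hm, e6]
    rw [e30]
    have hpar : σ1.a (o + 1) (i * M) = par rel i := by
      rw [g5 _ (by omega)]
      simpa using hT.anc i i2 0 hE.hK1
    refine HT.mono (joinClasses_spec hE (F := partialRp rel p s) (F' := partialRp rel p s')
      (g := appendOn (Joined n rel p s) p g) (i := i) (u := par rel i) (p := p)
      (by simp [v1]) (g1.of_eq rfl rfl rfl) (by simp) (by simp [v38]) (by simpa using hpar)
      (by omega) i2 hp1 (by omega) hp hpn (by rw [q1, q2]; omega) hiff ?_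
      (g2.of_eq rfl rfl)) ?_
    · intro x
      have := hg.length_le h x
      unfold appendOn
      split_ifs with hx
      · have := hx.1
        have := hx.2.1
        simp only [List.length_append, List.length_singleton]
        -- All distances in `g x` are between `p + 1` and `n - 1`, so there is room for one more.
        omega
      · omega
    · rintro σ2 t ⟨ht, hf2, k1, k2, k3, k4⟩
      refine ⟨(k2 39 (by omega)).trans (by simp [hm]), _, ⟨rfl, ?_, ?_, ?_, k3.trans g4, ?_⟩, ?_⟩
      · obtain ⟨f2, hf2⟩ := hf2
        exact ⟨f2, hf2.of_eq rfl rfl rfl⟩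
      · rw [appendOn_appendOn] at k1
        · rw [appendOn_congr (E' := Joined n rel p s')] at k1
          · exact k1.of_eq rfl rfl
          · intro x
            simp only [Joined, Crosses, hiff x (x + p)]
            constructor
            · rintro (⟨r1, r2, r3, r4⟩ | ⟨r1, r2, r3⟩)
              · exact ⟨r1, r2, r3, Or.inl r4⟩
              · refine ⟨r1, r2, fun e => ?_, Or.inr r3⟩
                have e1 := hmono _ _ e
                rw [q1, q2] at r3
                omega
            · rintro ⟨r1, r2, r3, r4 | r4⟩
              · exact Or.inl ⟨r1, r2, r3, r4⟩
              · exact Or.inr ⟨r1, r2, r4⟩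
        · rintro x ⟨r1, r2, r3, r4⟩ ⟨-, -, r5⟩
          rw [q1, q2] at r5
          omega
      · intro j hj
        rw [St.setV_v, if_neg (by omega), k2 j (by omega), St.setV_v, if_neg (by omega), g3 j hj]
      · intro D hD
        rw [St.setV_a, k4 D hD, St.setV_a, g5 D hD]
      · have a1 := hpot (partialRp rel p s)
        have a2 := hpot (partialRp rel p s')
        simp only [Ex.cost_rd, Ex.cost_v, Ex.cost_mul, Ex.cost_add]
        omega
  · have e0 : partialRp rel p ((edges n rel p).take 0) = rp rel (p + 1) := by
      funext x; simp [partialRp]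
    refine ⟨by rw [e0]; omega, ⟨f, by rw [e0]; exact hf.of_eq rfl rfl rfl⟩, ?_, ?_, rfl,
      fun _ _ => rfl⟩
    · have e : appendOn (Joined n rel p ((edges n rel p).take 0)) p g = g := by
        funext x
        refine if_neg ?_
        rintro ⟨-, -, r3, r4⟩
        rw [e0] at r4
        exact r3 r4
      rw [e]
      exact hr.of_eq rfl rfl
    · intro j hj
      rw [St.setV_v, if_neg (by omega)]
  · simp
  · rintro σ1 t ⟨-, B', ⟨rfl, g1, g2, g3, g4, g5⟩, ht⟩
    rw [List.take_length, h.partialRp_edges hp] at g1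
    rw [List.take_length] at g2
    rw [List.take_length, h.partialRp_edges hp] at ht
    have a1 := hpot (rp rel p)
    have a2 := hpot (rp rel (p + 1))
    refine ⟨?_, g1, ?_, g3, g4, g5⟩
    · simp only [Ex.cost_rd, Ex.cost_v, Ex.cost_ofNat] at ht ⊢
      omega
    · rwa [appendOn_congr (E' := fun x => x ∈ newPairs n rel p)] at g2
      intro x
      rw [h.mem_newPairs_iff_rp hp, Joined, h.partialRp_edges hp]

theorem joinLevels_spec (hE : Env w n M C K) (h : LevelSystem n rel) {σ : St} {f : ℕ → List ℕ}
    (hcfg : Cfg n M C K σ) (hT : TreeData rel M K o n σ)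
    (he : Rows M (o + 6) (o + 7) (edges n rel) σ) (hf : ClassData n M o (rp rel (n + 1)) f σ)
    (h0 : ∀ A, o + 8 ≤ A → A < o + 10 → ∀ j, σ.a A j = 0) :
    HT w (joinLevels o) σ fun σ' t => t ≤ 160 * (n * Nat.log 2 n) + 200 * (n + 1) ∧
      (∃ g, Collected n rel 0 g ∧ Rows M (o + 8) (o + 9) g σ') ∧
      (∀ j, j < 10 → σ'.v j = σ.v j) ∧ σ'.x = σ.x ∧
      (∀ D, D < o + 3 ∨ o + 10 ≤ D → σ'.a D = σ.a D) := by
  have hw := hE.hw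
  have hM := hE.hM
  have hn := hE.hn
  have b1 := hE.sq_lt
  have b2 := hE.le_sq
  have b3 := hE.four_le_sq
  have hpot : ∀ F, potential n F ≤ n * Nat.log 2 n := potential_le n
  generalize n * Nat.log 2 n = X at hpot
  let cnt : ℕ → ℕ := fun p => ((List.range' 2 (n - 1)).filter fun i => dep rel i ≤ p).length
  have hcnt : ∀ p, (edges n rel p).length + cnt p = cnt (p + 1) := fun p =>
    length_filter_le_succ _ (dep rel) p
  have hcn : cnt (n + 1) ≤ n := by
    refine (List.length_filter_le _ _).trans ?_
    rw [List.length_range']; omega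
  refine HT.seq (HT.asg hw (by simp) ?_)
  refine HT.mono (HT.forUp hw (b := n) (a := 0)
    (B := 160 * X + 100 * n + 50 * n)
    (fun m B σ' => 160 * (X - potential n (rp rel (n + 1 - m))) + 100 * cnt (n + 1 - m) +
        50 * (n - m) ≤ B ∧
      (∃ f', ClassData n M o (rp rel (n + 1 - m)) f' σ') ∧
      (∃ g, Collected n rel (n - m) g ∧ Rows M (o + 8) (o + 9) g σ') ∧
      (∀ j, j < 10 → σ'.v j = σ.v j) ∧ σ'.x = σ.x ∧
      (∀ D, D < o + 3 ∨ o + 10 ≤ D ∨ D = o + 6 ∨ D = o + 7 → σ'.a D = σ.a D))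
      ?_ (by omega) (by omega) ⟨?_, ?_, ?_, ?_, rfl, fun _ _ => rfl⟩ ?_) ?_
  · rintro m B σ1 ⟨hB, ⟨f1, g1⟩, ⟨g, g2, g2'⟩, g3, g4, g5⟩ hm hmn
    have v0 := (g3 0 (by omega)).trans hcfg.v0
    refine ⟨by simp [v0]; omega, by simp [v0], fun hlt => ?_⟩
    obtain ⟨p, hp⟩ : ∃ p, n - m = p + 1 := ⟨n - m - 1, by omega⟩
    have e1 : n + 1 - m = p + 1 + 1 := by omega
    have e2 : n + 1 - (m + 1) = p + 1 := by omega
    have e3 : n - (m + 1) = p := by omega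
    rw [e1] at g1 hB
    rw [hp] at g2 hB
    refine HT.seq (HT.asg hw (by simp [v0, hm]; omega) ?_)
    have e38 : Ex.eval σ1 (.v 0 - .v 37) = p + 1 := by simp [v0, hm, hp]
    rw [e38]
    refine HT.mono (joinLevel_spec hE h (p := p + 1) (f := f1) (g := g)
      (Cfg.of_eq (σ' := St.setV σ1 38 (p + 1)) hcfg fun j hj => ?_)
      (hT.of_eq ?_ ?_) (by omega) (by omega) (by simp) (he.of_eq ?_ ?_)
      (g1.of_eq rfl rfl rfl) g2 (g2'.of_eq rfl rfl)) ?_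
    · rw [St.setV_v, if_neg (by omega), g3 j hj]
    · rw [St.setV_a, g5 _ (by omega)]
    · rw [St.setV_a, g5 _ (by omega)]
    · rw [St.setV_a, g5 _ (by omega)]
    · rw [St.setV_a, g5 _ (by omega)]
    · rintro σ2 t ⟨ht, ⟨f2, hf2⟩, k1, k2, k3, k4⟩
      refine ⟨?_, B - (t + 20), ⟨?_, ?_, ?_, ?_, ?_, ?_⟩, ?_⟩
      · rw [k2 37 (by omega), St.setV_v, if_neg (by omega), hm]
      · have a1 := hpot (rp rel (p + 1))
        have a2 := hpot (rp rel (p + 1 + 1))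
        have a3 := hcnt (p + 1)
        rw [e2, e3]
        omega
      · rw [e2]
        exact ⟨f2, hf2.of_eq rfl rfl rfl⟩
      · rw [e3]
        exact ⟨_, Collected.appendOn g2, k1.of_eq rfl rfl⟩
      · intro j hj
        rw [St.setV_v, if_neg (by omega), k2 j (by omega), St.setV_v, if_neg (by omega), g3 j hj]
      · exact k3.trans g4
      · intro D hD
        rw [St.setV_a, k4 D hD, St.setV_a, g5 D hD]
      · have a1 := hpot (rp rel (p + 1))
        have a2 := hpot (rp rel (p + 1 + 1))
        have a3 := hcnt (p + 1)
        simp only [Ex.cost_sub, Ex.cost_v]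
        omega
  · have e : n + 1 - 0 = n + 1 := rfl
    rw [e]
    omega
  · exact ⟨f, hf.of_eq rfl rfl rfl⟩
  · refine ⟨fun _ => [], ⟨by simp, fun x q => ?_⟩, fun k => ?_⟩
    · simp only [List.not_mem_nil, false_iff, not_and]
      intro hq hx
      have := (h.mem_newPairs_iff_rp (by omega)).1 hx
      omega
    · simp [h0 (o + 9) (by omega) (by omega)]
  · intro j hj
    rw [St.setV_v, if_neg (by omega)]
  · simp
  · rintro σ1 t ⟨-, B', ⟨-, -, g2, g3, g4, g5⟩, ht⟩
    rw [Nat.sub_self] at g2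
    refine ⟨?_, g2, g3, g4, fun D hD => g5 D (by omega)⟩
    simp only [Ex.cost_v, Ex.cost_ofNat] at ht ⊢
    omega

/-- Computes all pairs `(x, x + p)` of positions that are equivalent at level `p`, but not at level
`p + 1`, given the forest. -/
def collectPairs (o : ℕ) : Prog := .seq (initClasses o) (.seq (bucketEdges o) (joinLevels o))

theorem collectPairs_spec (hE : Env w n M C K) (h : LevelSystem n rel) {σ : St}
    (hcfg : Cfg n M C K σ) (hT : TreeData rel M K o n σ)
    (h0 : ∀ A, o + 3 ≤ A → A < o + 10 → ∀ j, σ.a A j = 0) :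
    HT w (collectPairs o) σ fun σ' t => t ≤ 160 * (n * Nat.log 2 n) + 280 * (n + 1) ∧
      (∃ g, Collected n rel 0 g ∧ Rows M (o + 8) (o + 9) g σ') ∧
      (∀ j, j < 10 → σ'.v j = σ.v j) ∧ σ'.x = σ.x ∧
      (∀ D, D < o + 3 ∨ o + 10 ≤ D → σ'.a D = σ.a D) := by
  refine HT.seq (HT.mono (initClasses_spec hE h hcfg fun A h1 h2 => h0 A h1 (by omega)) ?_)
  rintro σ1 t1 ⟨ht1, ⟨f, hf⟩, v1, x1, a1⟩
  refine HT.seq (HT.mono (bucketEdges_spec hE h (hcfg.of_eq v1)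
    (hT.of_eq (a1 _ (by omega)) (a1 _ (by omega))) fun A h1 h2 j => ?_) ?_)
  · rw [a1 A (by omega), h0 A (by omega) (by omega)]
  rintro σ2 t2 ⟨ht2, he, v2, x2, a2⟩
  refine HT.mono (joinLevels_spec hE h ((hcfg.of_eq v1).of_eq v2)
    ((hT.of_eq (a1 _ (by omega)) (a1 _ (by omega))).of_eq (a2 _ (by omega)) (a2 _ (by omega))) he
    (hf.of_eq (a2 _ (by omega)) (a2 _ (by omega)) (a2 _ (by omega))) fun A h1 h2 j => ?_) ?_
  · rw [a2 A (by omega), a1 A (by omega), h0 A (by omega) (by omega)]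
  rintro σ3 t3 ⟨ht3, hg, v3, x3, a3⟩
  refine ⟨by omega, hg, fun j hj => ?_, by rw [x3, x2, x1], fun D hD => ?_⟩
  · rw [v3 j hj, v2 j hj, v1 j hj]
  · rw [a3 D hD, a2 D (by omega), a1 D (by omega)]

end levels

end WordRAM

/-! ### From pairs to the ends of the intervals -/

namespace LevelSystem

variable {n : ℕ} {rel : ℕ → ℕ → ℕ → Prop}

/-- The intervals of squares of period `p` begin at the left ends given by the reversed string, except
for those that continue an interval. -/
theorem leftEnds_eq (h : LevelSystem n rel) {p : ℕ} (hp : 1 ≤ p) (D : ℕ → Prop) [DecidablePred D]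
    (hD : ∀ a, D a ↔ (∃ i, i ∈ newPairs n (revRel n rel) p ∧ i + 2 * p + a = n + 2) ∧
      a - 1 ∉ newPairs n rel p) (m : ℕ) :
    (List.range' 1 m).filter (fun a => D a) = leftEnds {x | rel p x (x + p)} m := by
  refine List.filter_congr fun a ha => ?_
  have ha := (List.mem_range'_1.1 ha).1
  simp only [decide_eq_decide, Set.mem_ofPred_eq]
  rw [hD, h.newPairs_rev_iff hp, h.mem_newPairs hp]
  constructor
  · rintro ⟨⟨h1, h2⟩, h3⟩
    refine ⟨h1, fun h4 => ?_⟩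
    rcases h2 with h2 | h2
    · have := (h.valid h4).1
      omega
    · exact h3 ⟨h4, h2⟩
  · rintro ⟨h1, h2⟩
    exact ⟨⟨h1, Or.inr fun h3 => h2 (h.mono h3)⟩, fun h3 => h2 h3.1⟩

theorem rightEnds_eq (h : LevelSystem n rel) {p : ℕ} (hp : 1 ≤ p) (D : ℕ → Prop) [DecidablePred D]
    (hD : ∀ a, D a ↔ a ∈ newPairs n rel p ∧
      ¬ ∃ i, i ∈ newPairs n (revRel n rel) p ∧ i + 2 * p + (a + 1) = n + 2) (m : ℕ) :
    (List.range' 1 m).filter (fun a => D a) = rightEnds {x | rel p x (x + p)} m := by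
  refine List.filter_congr fun a ha => ?_
  have ha := (List.mem_range'_1.1 ha).1
  simp only [decide_eq_decide, Set.mem_ofPred_eq]
  rw [hD, h.newPairs_rev_iff hp, h.mem_newPairs hp, Nat.add_sub_cancel]
  constructor
  · rintro ⟨⟨h1, h2⟩, h3⟩
    exact ⟨h1, fun h4 => h3 ⟨h4, Or.inr h2⟩⟩
  · rintro ⟨h1, h2⟩
    refine ⟨⟨h1, fun h3 => h2 ?_⟩, fun h3 => h2 h3.1⟩
    have := h.shift h3
    rwa [show a + p + 1 = a + 1 + p by omega] at this

end LevelSystem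

/-- The entry `p` of the list `f x` is among the first `m` entries of `f i`, or among those of a list
with an index smaller than `i`. -/
def Visited (f : ℕ → List ℕ) (i m x p : ℕ) : Prop :=
  1 ≤ x ∧ ((x < i ∧ p ∈ f x) ∨ (x = i ∧ p ∈ (f x).take m))

theorem mem_take_succ {l : List ℕ} {m : ℕ} (hm : m < l.length) {p : ℕ} :
    p ∈ l.take (m + 1) ↔ p ∈ l.take m ∨ p = l[m] := by
  rw [List.take_succ_eq_append_getElem hm, List.mem_append, List.mem_singleton]

theorem getElem_notMem_take {l : List ℕ} (hl : l.Nodup) {m : ℕ} (hm : m < l.length) :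
    l[m] ∉ l.take m := by
  rw [List.mem_take_iff_getElem]
  rintro ⟨j, hj, e⟩
  have := hl.getElem_inj_iff.1 e
  omega

namespace Visited

variable {f : ℕ → List ℕ} {i m x p : ℕ}

theorem not_start : ¬ Visited f 1 0 x p := by
  rintro ⟨h1, ⟨h2, -⟩ | ⟨-, h2⟩⟩
  · omega
  · simp at h2

theorem succ (hi : 1 ≤ i) (hm : m < (f i).length) :
    Visited f i (m + 1) x p ↔ Visited f i m x p ∨ (x = i ∧ p = (f i)[m]) := by
  unfold Visited
  by_cases hx : x = i
  · subst hx
    rw [mem_take_succ hm]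
    simp only [lt_irrefl, false_and, false_or, true_and]
    tauto
  · simp [hx]

theorem next : Visited f (i + 1) 0 x p ↔ Visited f i (f i).length x p := by
  unfold Visited
  refine and_congr_right fun _ => ?_
  by_cases hx : x = i
  · subst hx
    simp
  · have : x < i + 1 ↔ x < i := by omega
    simp [hx, this]

end Visited

namespace WordRAM

/-- Runs `P` for each entry of the rows `1, …, n` of array `A` with row lengths in array `B`, with the
number of the row in variable `30` and the entry in variable `31`. -/
def forRows (A B : ℕ) (P : Prog) : Prog :=
  .seq (asg 30 1) (forUp 30 (.v 1) (.seq (asg 39 0) (forUp 39 (.rd B (.v 30))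
    (.seq (asg 31 (.rd A (.v 30 * .v 1 + .v 39))) P))))

section emit

variable {w n M C K : ℕ}

theorem HT.forRows (hE : Env w n M C K) {A B c : ℕ} {P : Prog} {f : ℕ → List ℕ} {σ : St}
    (I : ℕ → ℕ → St → Prop) (hlen : ∀ x, (f x).length ≤ n) (hf : ∀ x, ∀ q ∈ f x, q ≤ n)
    (hrows : ∀ i m σ, I i m σ → σ.v 1 = M ∧ Rows M A B f σ)
    (hvar : ∀ i m σ σ', I i m σ → (∀ j < 10, σ'.v j = σ.v j) → σ'.a = σ.a → I i m σ')
    (hbody : ∀ i m σ, ∀ hm : m < (f i).length, 1 ≤ i → i ≤ n → I i m σ → σ.v 30 = i →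
      σ.v 31 = (f i)[m] →
      HT w P σ fun σ' t => t ≤ c ∧ I i (m + 1) σ' ∧ σ'.v 30 = i ∧ σ'.v 39 = σ.v 39)
    (hnext : ∀ i σ, 1 ≤ i → i ≤ n → I i (f i).length σ → I (i + 1) 0 σ) (h0 : I 1 0 σ) :
    HT w (forRows A B P) σ fun σ' t => I (n + 1) 0 σ' ∧
      t ≤ (c + 30) * ∑ i ∈ Finset.Icc 1 n, (f i).length + 40 * (n + 1) := by
  have hw := hE.hw
  have hM := hE.hM
  have hn := hE.hn
  have b1 := hE.sq_lt
  have b2 := hE.le_sq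
  refine HT.seq (HT.asg hw (by simp; omega) ?_)
  refine HT.mono (HT.forUp hw (b := M) (a := 1)
    (B := (c + 30) * ∑ i ∈ Finset.Ico 1 M, (f i).length + 30 * n)
    (fun i B σ' => 1 ≤ i ∧ I i 0 σ' ∧
      B = (c + 30) * ∑ i ∈ Finset.Ico i M, (f i).length + 30 * (M - i))
    ?_ (by omega) (by omega) ⟨le_rfl, hvar _ _ _ _ h0 ?_ rfl, by rw [hM]; simp⟩ ?_) ?_
  · rintro i B σ1 ⟨hi, hI, rfl⟩ h30 hiM
    obtain ⟨v1, -⟩ := hrows _ _ _ hI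
    refine ⟨by simp [v1]; omega, by simp [v1], fun hlt => ?_⟩
    rw [Finset.sum_eq_sum_Ico_succ_bot hlt, mul_add]
    refine HT.seq (HT.asg hw (by simp) ?_)
    refine HT.mono (HT.forUp hw (b := (f i).length) (a := 0)
      (B := (c + 30) * (f i).length)
      (fun m B σ' => I i m σ' ∧ σ'.v 30 = i ∧ B = (c + 30) * ((f i).length - m))
      ?_ (by have := hlen i; omega) (by omega) ⟨hvar _ _ _ _ hI ?_ rfl, ?_, rfl⟩ ?_) ?_
    · rintro m B σ2 ⟨hI2, k30, rfl⟩ k39 hml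
      obtain ⟨v1, hr⟩ := hrows _ _ _ hI2
      have hli := hlen i
      refine ⟨by simp [k30, (hr i).1]; omega, by simp [k30, (hr i).1], fun hlt2 => ?_⟩
      have e1 := (hr i).2 m hlt2
      have e2 := hf i _ (List.getElem_mem hlt2)
      have c1 : i * M + m < M * M := mul_add_lt (by omega) (by omega)
      refine HT.seq (HT.asg hw (by simp [k30, k39, v1, e1]; omega) ?_)
      have e3 : Ex.eval σ2 (.rd A (.v 30 * .v 1 + .v 39)) = (f i)[m] := by
        simp [k30, k39, v1, e1]
      rw [e3]
      refine HT.mono (hbody i m _ hlt2 hi (by omega) (hvar _ _ _ _ hI2 ?_ rfl) (by simp [k30])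
        (by simp)) ?_
      · intro j hj
        rw [St.setV_v, if_neg (by omega)]
      · rintro σ3 t ⟨ht, hI3, j30, j39⟩
        refine ⟨by rw [j39]; simp [k39], _, ⟨hvar _ _ _ _ hI3 ?_ rfl, by simp [j30], rfl⟩, ?_⟩
        · intro j hj
          rw [St.setV_v, if_neg (by omega)]
        · obtain ⟨d, hd⟩ : ∃ d, (f i).length - m = d + 1 := ⟨(f i).length - m - 1, by omega⟩
          rw [hd, show (f i).length - (m + 1) = d by omega, mul_add]
          simp
          omega
    · intro j hj
      rw [St.setV_v, if_neg (by omega)]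
    · simp [h30]
    · simp
    · rintro σ2 t ⟨-, B', ⟨hI2, k30, rfl⟩, ht⟩
      refine ⟨k30, _, ⟨by omega, hvar _ _ _ _ (hnext i σ2 hi (by omega) hI2) ?_ rfl, rfl⟩, ?_⟩
      · intro j hj
        rw [St.setV_v, if_neg (by omega)]
      · simp at ht ⊢
        omega
  · intro j hj
    rw [St.setV_v, if_neg (by omega)]
  · simp
  · rintro σ1 t ⟨-, B', ⟨-, hI, -⟩, ht⟩
    rw [hM] at hI
    refine ⟨hI, ?_⟩
    have : Finset.Ico 1 M = Finset.Icc 1 n := by rw [hM]; rfl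
    rw [this] at ht
    simp at ht ⊢
    omega

/-- Marks the entries of the rows of array `14` in array `28`. -/
def markPairs : Prog := forRows 14 15 (put 28 (.v 30 * .v 1 + .v 31) 1)

theorem markPairs_spec (hE : Env w n M C K) {g : ℕ → List ℕ} {σ : St} (hcfg : Cfg n M C K σ)
    (hg : Rows M 14 15 g σ) (hlen : ∀ x, (g x).length ≤ n)
    (hgn : ∀ x, ∀ q ∈ g x, 1 ≤ x ∧ x ≤ n ∧ q ≤ n) (h0 : ∀ j, σ.a 28 j = 0) :
    HT w markPairs σ fun σ' t =>
      t ≤ 50 * ∑ i ∈ Finset.Icc 1 n, (g i).length + 40 * (n + 1) ∧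
      (∀ x p, p < M → (σ'.a 28 (x * M + p) ≠ 0 ↔ p ∈ g x)) ∧ (∀ j, σ'.a 28 j ≤ 1) ∧
      (∀ j < 10, σ'.v j = σ.v j) ∧ (∀ D, D ≠ 28 → σ'.a D = σ.a D) := by
  have hw := hE.hw
  have hM := hE.hM
  have b1 := hE.sq_lt
  have b2 := hE.le_sq
  refine HT.mono (HT.forRows hE (c := 20) (f := g) (fun i m σ' =>
    (∀ x p, p < M → (σ'.a 28 (x * M + p) ≠ 0 ↔ Visited (fun x => g x) i m x p)) ∧
    (∀ j, σ'.a 28 j ≤ 1) ∧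
    (∀ j < 10, σ'.v j = σ.v j) ∧ (∀ D, D ≠ 28 → σ'.a D = σ.a D)) hlen
    (fun x q hq => (hgn x q hq).2.2) ?_ ?_ ?_ ?_ ?_) ?_
  · rintro i m σ1 ⟨-, -, h2, h3⟩
    exact ⟨(h2 1 (by omega)).trans hcfg.v1, hg.of_eq (h3 _ (by omega)) (h3 _ (by omega))⟩
  · rintro i m σ1 σ2 ⟨h1, hb, h2, h3⟩ e1 e2
    rw [e2]
    exact ⟨h1, hb, fun j hj => (e1 j hj).trans (h2 j hj), h3⟩
  · rintro i m σ1 hm hi hin ⟨h1, hb, h2, h3⟩ h30 h31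
    have v1 := (h2 1 (by omega)).trans hcfg.v1
    have hp := (hgn i _ (List.getElem_mem hm)).2.2
    have c1 : i * M + (g i)[m] < M * M := mul_add_lt (by omega) (by omega)
    refine HT.put hw (by simp [h30, h31, v1]; omega) (by simp; omega) ⟨by simp, ⟨?_, ?_, h2, ?_⟩,
      h30, rfl⟩
    · intro x p hpM
      rw [Visited.succ hi hm, ← h1 x p hpM]
      simp only [St.setA_a, true_and, Ex.eval_add, Ex.eval_mul, Ex.eval_v, h30, h31, v1,
        mul_add_inj hpM (show (g i)[m] < M by omega)]
      split_ifs with e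
      · simp [e]
      · simp [e]
    · intro j
      rw [St.setA_a]
      split_ifs
      · simp
      · exact hb j
    · intro D hD
      rw [← h3 D hD]
      funext j
      simp [hD]
  · rintro i σ1 - - ⟨h1, hb, h2, h3⟩
    refine ⟨fun x p hp => ?_, hb, h2, h3⟩
    rw [h1 x p hp]
    exact Visited.next.symm
  · refine ⟨fun x p _ => ?_, fun j => by rw [h0]; omega, fun _ _ => rfl, fun _ _ => rfl⟩
    rw [h0]
    simp only [ne_eq, not_true_eq_false, false_iff]
    exact Visited.not_start
  · rintro σ1 t ⟨⟨h1, hb, h2, h3⟩, ht⟩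
    refine ⟨ht, fun x p hp => ?_, hb, h2, h3⟩
    rw [h1 x p hp]
    constructor
    · rintro ⟨-, ⟨-, h4⟩ | ⟨-, h4⟩⟩
      · exact h4
      · simp at h4
    · intro h4
      obtain ⟨k1, k2, k3⟩ := hgn x p h4
      exact ⟨k1, Or.inl ⟨by omega, h4⟩⟩

/-- Translates the pairs of the reversed string in the rows of array `24` into positions of the
string, collects them in the rows of array `26` and marks them in array `29`. -/
def reflectPairs : Prog := forRows 24 25
  (.seq (asg 32 (.v 0 + 2 - (.v 30 + (.v 31 + .v 31))))
  (.seq (put 29 (.v 32 * .v 1 + .v 31) 1) (push 26 27 32 31)))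

theorem reflectPairs_spec (hE : Env w n M C K) {g : ℕ → List ℕ} {σ : St} (hcfg : Cfg n M C K σ)
    (hg : Rows M 24 25 g σ) (hlen : ∀ x, (g x).length ≤ n) (hnd : ∀ x, (g x).Nodup)
    (hgn : ∀ x, ∀ q ∈ g x, 1 ≤ x ∧ 1 ≤ q ∧ x + 2 * q ≤ n + 1)
    (h26 : ∀ j, σ.a 27 j = 0) (h29 : ∀ j, σ.a 29 j = 0) :
    HT w reflectPairs σ fun σ' t =>
      t ≤ 80 * ∑ i ∈ Finset.Icc 1 n, (g i).length + 40 * (n + 1) ∧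
      (∃ h : ℕ → List ℕ, Rows M 26 27 h σ' ∧ (∀ x, (h x).Nodup) ∧
        (∀ a p, p ∈ h a ↔ ∃ y, p ∈ g y ∧ y + 2 * p + a = n + 2) ∧
        ∀ x p, p < M → (σ'.a 29 (x * M + p) ≠ 0 ↔ p ∈ h x)) ∧ (∀ j, σ'.a 29 j ≤ 1) ∧
      (∀ j < 10, σ'.v j = σ.v j) ∧ (∀ D, D ≠ 26 → D ≠ 27 → D ≠ 29 → σ'.a D = σ.a D) := by
  have hw := hE.hw
  have hM := hE.hM
  have b1 := hE.sq_lt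
  have b2 := hE.le_sq
  have b3 := hE.four_le_sq
  refine HT.mono (HT.forRows hE (c := 50) (f := g) (fun i m σ' =>
    (∃ h : ℕ → List ℕ, Rows M 26 27 h σ' ∧ (∀ x, (h x).Nodup) ∧
      (∀ a p, p ∈ h a ↔ ∃ y, Visited g i m y p ∧ y + 2 * p + a = n + 2) ∧
      ∀ x p, p < M → (σ'.a 29 (x * M + p) ≠ 0 ↔ p ∈ h x)) ∧ (∀ j, σ'.a 29 j ≤ 1) ∧
    (∀ j < 10, σ'.v j = σ.v j) ∧ (∀ D, D ≠ 26 → D ≠ 27 → D ≠ 29 → σ'.a D = σ.a D)) hlen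
    (fun x q hq => by have := hgn x q hq; omega) ?_ ?_ ?_ ?_ ?_) ?_
  · rintro i m σ1 ⟨-, -, h2, h3⟩
    exact ⟨(h2 1 (by omega)).trans hcfg.v1, hg.of_eq (h3 _ (by omega) (by omega) (by omega))
      (h3 _ (by omega) (by omega) (by omega))⟩
  · rintro i m σ1 σ2 ⟨⟨h, h1, h1', h1'', h1'''⟩, hb, h2, h3⟩ e1 e2
    rw [e2]
    exact ⟨⟨h, h1.of_eq (by rw [e2]) (by rw [e2]), h1', h1'', h1'''⟩,
      hb, fun j hj => (e1 j hj).trans (h2 j hj), h3⟩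
  · rintro i m σ1 hm hi hin ⟨⟨h, hr, hhn, hh, hk⟩, hb, h2, h3⟩ h30 h31
    have v0 := (h2 0 (by omega)).trans hcfg.v0
    have v1 := (h2 1 (by omega)).trans hcfg.v1
    have hp := hgn i _ (List.getElem_mem hm)
    have hnew := getElem_notMem_take (hnd i) hm
    have hsucc : ∀ x p, Visited g i (m + 1) x p ↔ Visited g i m x p ∨ (x = i ∧ p = (g i)[m]) :=
      fun x p => Visited.succ hi hm
    have hnotv : ¬ Visited g i m i (g i)[m] := by
      rintro ⟨-, ⟨e, -⟩ | ⟨-, e⟩⟩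
      · omega
      · exact hnew e
    generalize (g i)[m] = q at *
    obtain ⟨a, ha⟩ : ∃ a, a = n + 2 - (i + (q + q)) := ⟨_, rfl⟩
    have c1 : a * M + q < M * M := mul_add_lt (by omega) (by omega)
    have hhl : ∀ x, (h x).length ≤ n := fun x => length_le_of_nodup (hhn x) fun p hp => by
      obtain ⟨y, ⟨-, hv⟩, -⟩ := (hh x p).1 hp
      have hm : p ∈ g y := by
        rcases hv with hv | hv
        · exact hv.2
        · exact List.mem_of_mem_take hv.2
      have := hgn y p hm
      omega
    have hqa : q ∉ h a := fun hm => by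
      obtain ⟨y, hv, e⟩ := (hh a q).1 hm
      rw [show y = i by omega] at hv
      exact hnotv hv
    refine HT.seq (HT.asg hw (by simp [h30, h31, v0]; omega) ?_)
    have e32 : Ex.eval σ1 (.v 0 + 2 - (.v 30 + (.v 31 + .v 31))) = a := by
      simp [h30, h31, v0, ha]
    rw [e32]
    refine HT.seq (HT.put hw (by simp [h31, v1]; omega) (by simp; omega) ?_)
    refine HT.push hE (k := a) (z := q) (f := h) (by omega) (by simp [v1]) (hr.of_eq ?_ ?_) hhl
      (by simp) (by omega) (by simp [h31]) (by omega) ?_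
    · funext j; simp
    · funext j; simp
    intro σ2 k1 k2 k3 k4
    have hmem : ∀ x p, p ∈ Function.update h a (h a ++ [q]) x ↔ p ∈ h x ∨ (x = a ∧ p = q) := by
      intro x p
      by_cases e : x = a
      · subst e; simp
      · simp [e]
    refine ⟨by simp, ⟨⟨_, k1, ?_, ?_, ?_⟩, ?_, ?_, ?_⟩, by rw [k2]; simp [h30], by rw [k2]; simp⟩
    · intro x
      by_cases e : x = a
      · subst e
        rw [Function.update_self]
        refine List.Nodup.append (hhn _) (List.nodup_singleton _) ?_
        intro z z1 z2
        rw [List.mem_singleton] at z2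
        exact hqa (z2 ▸ z1)
      · rw [Function.update_of_ne e]
        exact hhn x
    · intro x p
      rw [hmem, hh]
      simp only [hsucc]
      constructor
      · rintro (⟨y, k5, k6⟩ | ⟨rfl, rfl⟩)
        · exact ⟨y, Or.inl k5, k6⟩
        · exact ⟨i, Or.inr ⟨rfl, rfl⟩, by omega⟩
      · rintro ⟨y, k5 | ⟨rfl, rfl⟩, k6⟩
        · exact Or.inl ⟨y, k5, k6⟩
        · exact Or.inr ⟨by omega, rfl⟩
    · intro x p hpM
      rw [hmem, ← hk x p hpM, k4 _ (by omega) (by omega)]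
      simp only [St.setA_a, St.setV_a, St.setV_v, true_and, Ex.eval_add, Ex.eval_mul, Ex.eval_v, h31,
        v1, if_true, reduceIte, Nat.reduceEqDiff, mul_add_inj hpM (show q < M by omega)]
      split_ifs with e
      · simp [e]
      · simp [e]
    · intro j
      rw [k4 _ (by omega) (by omega), St.setA_a]
      split_ifs
      · simp
      · exact hb j
    · intro j hj
      rw [k2]
      simp [show j ≠ 32 by omega, h2 j hj]
    · intro D d1 d2 d3
      rw [k4 D d1 d2, ← h3 D d1 d2 d3]
      funext j
      simp [d3]
  · rintro i σ1 - - ⟨⟨h, hr, hhn, hh, hk⟩, hb, h2, h3⟩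
    refine ⟨⟨h, hr, hhn, fun a p => ?_, hk⟩, hb, h2, h3⟩
    rw [hh]
    exact exists_congr fun y => and_congr_left fun _ => Visited.next.symm
  · refine ⟨⟨fun _ => [], fun k => by simp [h26], by simp, fun a p => ?_, fun x p _ => ?_⟩,
      fun j => by rw [h29]; omega, fun _ _ => rfl, fun _ _ _ _ => rfl⟩
    · simp only [List.not_mem_nil, false_iff, not_exists, not_and]
      intro y hy
      exact absurd hy Visited.not_start
    · simp [h29]
  · rintro σ1 t ⟨⟨⟨h, hr, hhn, hh, hk⟩, hb, h2, h3⟩, ht⟩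
    refine ⟨ht, ⟨h, hr, hhn, fun a p => ?_, hk⟩, hb, h2, h3⟩
    rw [hh]
    refine exists_congr fun y => and_congr_left fun _ => ?_
    constructor
    · rintro ⟨-, ⟨-, h4⟩ | ⟨-, h4⟩⟩
      · exact h4
      · simp at h4
    · intro h4
      have := hgn y p h4
      exact ⟨this.1, Or.inl ⟨by omega, h4⟩⟩

/-- Appends `i` to row `p` of array `D`, for each entry `p` of row `i` of array `A` that is not marked
in row `e` of array `G`. -/
def emit (A B D E G : ℕ) (e : Ex) : Prog :=
  forRows A B (ite (.rd G (e * .v 1 + .v 31)) .skip (push D E 31 30))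

open Classical in
theorem emit_spec (hE : Env w n M C K) {A B D E G : ℕ} {e : Ex} {f u : ℕ → List ℕ} {ε : ℕ → ℕ}
    {σ : St} (hcfg : Cfg n M C K σ) (hf : Rows M A B f σ) (hlen : ∀ x, (f x).length ≤ n)
    (hfn : ∀ x, ∀ q ∈ f x, q ≤ n) (hnd : ∀ x, (f x).Nodup)
    (he : ∀ σ, ∀ i ≤ n, σ.v 30 = i → 1 ≤ i → e.Safe w σ ∧ e.eval σ = ε i ∧ e.cost ≤ 5)
    (hε : ∀ i ≤ n, ε i ≤ n + 1) (hDE : D ≠ E)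
    (hne : A ≠ D ∧ A ≠ E ∧ B ≠ D ∧ B ≠ E ∧ G ≠ D ∧ G ≠ E)
    (hG : ∀ x p, p < M → (σ.a G (x * M + p) ≠ 0 ↔ p ∈ u x)) (hG1 : ∀ j, σ.a G j ≤ 1)
    (h0 : ∀ j, σ.a E j = 0) :
    HT w (emit A B D E G e) σ fun σ' t =>
      t ≤ 80 * ∑ i ∈ Finset.Icc 1 n, (f i).length + 40 * (n + 1) ∧
      Rows M D E (fun p => (List.range' 1 n).filter fun i => p ∈ f i ∧ p ∉ u (ε i)) σ' ∧
      (∀ j < 10, σ'.v j = σ.v j) ∧ (∀ F, F ≠ D → F ≠ E → σ'.a F = σ.a F) := by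
  have hw := hE.hw
  have hM := hE.hM
  have b1 := hE.sq_lt
  have b2 := hE.le_sq
  have b3 := hE.four_le_sq
  obtain ⟨n1, n2, n3, n4, n5, n6⟩ := hne
  refine HT.mono (HT.forRows hE (c := 50) (f := f) (fun i m σ' =>
    Rows M D E (fun p => ((List.range' 1 (i - 1)).filter fun i => p ∈ f i ∧ p ∉ u (ε i)) ++
      if p ∈ (f i).take m ∧ p ∉ u (ε i) then [i] else []) σ' ∧
    (∀ j < 10, σ'.v j = σ.v j) ∧ (∀ F, F ≠ D → F ≠ E → σ'.a F = σ.a F)) hlen hfn ?_ ?_ ?_ ?_ ?_) ?_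
  · rintro i m σ1 ⟨-, h2, h3⟩
    exact ⟨(h2 1 (by omega)).trans hcfg.v1, hf.of_eq (h3 _ n1 n2) (h3 _ n3 n4)⟩
  · rintro i m σ1 σ2 ⟨h1, h2, h3⟩ e1 e2
    rw [e2]
    exact ⟨h1.of_eq (by rw [e2]) (by rw [e2]), fun j hj => (e1 j hj).trans (h2 j hj), h3⟩
  · rintro i m σ1 hm hi hin ⟨h1, h2, h3⟩ h30 h31
    have v1 := (h2 1 (by omega)).trans hcfg.v1
    have hp := hfn i _ (List.getElem_mem hm)
    have hnew := getElem_notMem_take (hnd i) hm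
    simp only [mem_take_succ hm]
    generalize (f i)[m] = q at *
    obtain ⟨s1, s2, s3⟩ := he σ1 i hin h30 hi
    have s4 := hε i hin
    have c1 : ε i * M + q ≤ M * M + M := by
      have : ε i * M ≤ M * M := Nat.mul_le_mul_right M (by omega)
      omega
    have e1 : σ1.a G = σ.a G := h3 G n5 n6
    have e2 := hG1 (ε i * M + q)
    have e3 := Ex.eval_lt_two_pow hw s1
    refine HT.ite hw (by simp [s1, s2, v1, h31, e1]; omega) (fun hnz => ?_) (fun hz => ?_)
    · simp only [Ex.eval_rd, Ex.eval_add, Ex.eval_mul, Ex.eval_v, s2, v1, h31, e1] at hnz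
      have hu := (hG (ε i) q (by omega)).1 hnz
      refine HT.skip ⟨by simp; omega, ⟨?_, h2, h3⟩, h30, rfl⟩
      have : ∀ p, (p ∈ (f i).take m ∨ p = q) ∧ p ∉ u (ε i) ↔ p ∈ (f i).take m ∧ p ∉ u (ε i) := by
        intro p
        constructor
        · rintro ⟨k1 | rfl, k2⟩
          · exact ⟨k1, k2⟩
          · exact absurd hu k2
        · rintro ⟨k1, k2⟩
          exact ⟨Or.inl k1, k2⟩
      simpa only [this] using h1
    · simp only [Ex.eval_rd, Ex.eval_add, Ex.eval_mul, Ex.eval_v, s2, v1, h31, e1] at hz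
      have hu : q ∉ u (ε i) := fun hq => (hG (ε i) q (by omega)).2 hq hz
      refine HT.push hE (k := q) (z := i) hDE v1 h1 ?_ h31 hp h30 hin ?_
      · intro k
        have := List.length_filter_le (fun i => decide (k ∈ f i ∧ k ∉ u (ε i)))
          (List.range' 1 (i - 1))
        rw [List.length_range'] at this
        rw [List.length_append]
        split_ifs
        · simp only [List.length_singleton]; omega
        · simp only [List.length_nil]; omega
      · intro σ2 k1 k2 k3 k4
        refine ⟨by simp; omega, ⟨?_, ?_, ?_⟩, by rw [k2, h30], by rw [k2]⟩
        · convert k1 using 1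
          funext p
          by_cases hpq : p = q
          · subst hpq
            simp [hu, hnew]
          · simp [hpq]
        · intro j hj
          rw [k2, h2 j hj]
        · intro F f1 f2
          rw [k4 F f1 f2, h3 F f1 f2]
  · rintro i σ1 hi - ⟨h1, h2, h3⟩
    refine ⟨?_, h2, h3⟩
    convert h1 using 1
    funext p
    rw [List.take_length, Nat.add_sub_cancel, List.take_zero, if_neg (by simp), List.append_nil]
    obtain ⟨j, rfl⟩ := Nat.exists_eq_succ_of_ne_zero (show i ≠ 0 by omega)
    rw [Nat.succ_eq_add_one, Nat.add_sub_cancel, List.range'_1_concat, List.filter_append]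
    congr 1
    rw [show 1 + j = j + 1 by omega, List.filter_cons]
    simp
  · refine ⟨fun k => by simp [h0], fun _ _ => rfl, fun _ _ _ => rfl⟩
  · rintro σ1 t ⟨⟨h1, h2, h3⟩, ht⟩
    refine ⟨ht, ?_, h2, h3⟩
    simpa using h1

end emit

end WordRAM

theorem Collected.sum_length_le {n : ℕ} {rel : ℕ → ℕ → ℕ → Prop} {g : ℕ → List ℕ}
    (hg : Collected n rel 0 g) (h : LevelSystem n rel) :
    ∑ i ∈ Finset.Icc 1 n, (g i).length ≤ 2 * (n * Nat.log 2 n) := by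
  classical
  refine le_trans (le_of_eq ?_) (h.sum_card_newPairs_le n)
  have h1 : ∀ i ∈ Finset.Icc 1 n,
      (g i).length = ∑ p ∈ Finset.Icc 1 n, if i ∈ newPairs n rel p then 1 else 0 := by
    intro i _
    rw [← List.toFinset_card_of_nodup (hg.nodup i), ← Finset.card_filter]
    congr 1
    ext p
    rw [List.mem_toFinset, Finset.mem_filter, Finset.mem_Icc]
    constructor
    · intro hp
      have := hg.bound h hp
      exact ⟨by omega, ((hg.mem i p).1 hp).2⟩
    · rintro ⟨hp, hi⟩
      exact (hg.mem i p).2 ⟨by omega, hi⟩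
  rw [Finset.sum_congr rfl h1, Finset.sum_comm]
  refine Finset.sum_congr rfl fun p hp => ?_
  rw [← Finset.card_filter]
  congr 1
  ext i
  rw [Finset.mem_filter, and_iff_right_iff_imp, Finset.mem_Icc]
  intro hi
  have := (h.mem_newPairs_iff_rp (Finset.mem_Icc.1 hp).1).1 hi
  omega

namespace WordRAM

section finish

variable {w n M C K : ℕ} {rel : ℕ → ℕ → ℕ → Prop}

/-- Computes the ends of the intervals of squares of each period, given the pairs of the string and of
the reversed string. -/
def emitIntervals : Prog :=
  .seq markPairs (.seq reflectPairs
  (.seq (emit 26 27 3 2 28 (.v 30 - 1)) (.seq (emit 14 15 4 5 29 (.v 30 + 1))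
  (.seq (asg 30 0) (forUp 30 (.v 1) (put 1 (.v 30) (.v 30 * .v 1)))))))

theorem emitIntervals_spec (hE : Env w n M C K) (h : LevelSystem n rel) {g g' : ℕ → List ℕ} {σ : St}
    (hcfg : Cfg n M C K σ) (hg : Collected n rel 0 g) (hgr : Rows M 14 15 g σ)
    (hg' : Collected n (revRel n rel) 0 g') (hgr' : Rows M 24 25 g' σ)
    (h0 : ∀ A, (1 ≤ A ∧ A ≤ 5) ∨ (26 ≤ A ∧ A ≤ 29) → ∀ j, σ.a A j = 0) :
    HT w emitIntervals σ fun σ' t => t ≤ 600 * (n * Nat.log 2 n) + 250 * (n + 1) ∧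
      ∀ p, 1 ≤ p → p ≤ n → σ'.a 1 p = p * M ∧
        (σ'.a 2 p = (leftEnds {x | rel p x (x + p)} n).length ∧
          ∀ (m : ℕ) (hm : m < (leftEnds {x | rel p x (x + p)} n).length),
            σ'.a 3 (p * M + m) = (leftEnds {x | rel p x (x + p)} n)[m]) ∧
        ∀ (m : ℕ) (hm : m < (rightEnds {x | rel p x (x + p)} n).length),
            σ'.a 4 (p * M + m) = (rightEnds {x | rel p x (x + p)} n)[m] := by
  classical
  have hw := hE.hw
  have hM := hE.hM
  have hn := hE.hn
  have b1 := hE.sq_lt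
  have b2 := hE.le_sq
  have hl : ∀ x, (g x).length ≤ n := fun x => (hg.length_le h x).trans (by omega)
  have hl' : ∀ x, (g' x).length ≤ n := fun x => (hg'.length_le h.rev x).trans (by omega)
  have s1 := hg.sum_length_le h
  have s2 := hg'.sum_length_le h.rev
  refine HT.seq (HT.mono (markPairs_spec hE hcfg hgr hl (fun x q hq => ?_)
    (h0 28 (by omega))) ?_)
  · have := hg.bound h hq
    omega
  rintro σ1 t1 ⟨ht1, m1, m1', v1, a1⟩
  have hcfg1 := hcfg.of_eq v1
  refine HT.seq (HT.mono (reflectPairs_spec hE hcfg1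
    (hgr'.of_eq (a1 24 (by omega)) (a1 25 (by omega))) hl' hg'.nodup (fun x q hq => ?_)
    (fun j => ?_) (fun j => ?_)) ?_)
  · have e1 := hg'.bound h.rev hq
    have e2 := (h.rev.mem_newPairs (by omega)).1 ((hg'.mem x q).1 hq).2
    have e3 := h.rev.valid_right e2.1
    omega
  · rw [a1 27 (by omega), h0 27 (by omega)]
  · rw [a1 29 (by omega), h0 29 (by omega)]
  rintro σ2 t2 ⟨ht2, ⟨u, hur, hun, hu, m2⟩, m2', v2, a2⟩
  have hcfg2 := hcfg1.of_eq v2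
  have hu' : ∀ a p, p ∈ u a ↔ 1 ≤ p ∧ ∃ i, i ∈ newPairs n (revRel n rel) p ∧
      i + 2 * p + a = n + 2 := by
    intro a p
    rw [hu]
    simp only [hg'.mem]
    constructor
    · rintro ⟨y, ⟨h1, h2⟩, h3⟩
      exact ⟨h1, y, h2, h3⟩
    · rintro ⟨h1, y, h2, h3⟩
      exact ⟨y, ⟨h1, h2⟩, h3⟩
  have hub : ∀ a, ∀ p ∈ u a, 1 ≤ a ∧ a ≤ n ∧ 1 ≤ p ∧ p ≤ n := by
    intro a p hp
    obtain ⟨k1, k2⟩ := (hu' a p).1 hp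
    rw [h.newPairs_rev_iff k1] at k2
    have := h.valid k2.1
    have := h.valid_right k2.1
    omega
  have hul : ∀ x, (u x).length ≤ n := fun x =>
    length_le_of_nodup (hun x) fun p hp => (hub x p hp).2.2
  -- Reflection is injective on pairs, so the lists `u` have no more entries than the lists `g'`.
  have s3 : ∑ i ∈ Finset.Icc 1 n, (u i).length ≤ ∑ i ∈ Finset.Icc 1 n, (g' i).length := by
    have e : ∀ f : ℕ → List ℕ, (∀ x, (f x).Nodup) → ∑ i ∈ Finset.Icc 1 n, (f i).length =
        ((Finset.Icc 1 n).sigma fun i => (f i).toFinset).card := by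
      intro f hf
      rw [Finset.card_sigma]
      exact Finset.sum_congr rfl fun i _ => (List.toFinset_card_of_nodup (hf i)).symm
    rw [e u hun, e g' hg'.nodup]
    refine Finset.card_le_card_of_injOn (fun s => ⟨n + 2 - 2 * s.2 - s.1, s.2⟩) ?_ ?_
    · rintro ⟨a, p⟩ hs
      simp only [Finset.coe_sigma, Set.mem_sigma_iff, Finset.mem_coe, Finset.mem_Icc,
        List.mem_toFinset] at hs ⊢
      obtain ⟨y, h1, h2⟩ := (hu a p).1 hs.2
      have h3 := hg'.bound h.rev h1
      rw [show n + 2 - 2 * p - a = y by omega]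
      exact ⟨by omega, h1⟩
    · rintro ⟨a, p⟩ hs ⟨b, q⟩ hs' he
      simp only [Finset.coe_sigma, Set.mem_sigma_iff, Finset.mem_coe, Finset.mem_Icc,
        List.mem_toFinset] at hs hs'
      obtain ⟨y, -, h2⟩ := (hu a p).1 hs.2
      obtain ⟨z, -, h4⟩ := (hu b q).1 hs'.2
      simp only [Sigma.mk.injEq, heq_eq_eq] at he
      obtain ⟨h5, rfl⟩ := he
      rw [show a = b by omega]
  refine HT.seq (HT.mono (emit_spec hE (f := u) (u := g) (ε := fun i => i - 1) hcfg2 hur hul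
    (fun a p hp => (hub a p hp).2.2.2) hun ?_ (fun i hi => by omega) (by omega) (by omega)
    ?_ ?_ ?_) ?_)
  · intro σ i hi h30 hi1
    exact ⟨by simp [h30]; omega, by simp [h30], by simp⟩
  · intro x p hp
    rw [a2 28 (by omega) (by omega) (by omega), m1 x p hp]
  · intro j
    rw [a2 28 (by omega) (by omega) (by omega)]
    exact m1' j
  · intro j
    rw [a2 2 (by omega) (by omega) (by omega), a1 2 (by omega), h0 2 (by omega)]
  rintro σ3 t3 ⟨ht3, r3, v3, a3⟩
  have hcfg3 := hcfg2.of_eq v3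
  refine HT.seq (HT.mono (emit_spec hE (f := g) (u := u) (ε := fun i => i + 1) hcfg3
    (hgr.of_eq ?_ ?_) hl (fun a p hp => ?_) hg.nodup ?_ (fun i hi => by omega) (by omega) (by omega)
    ?_ ?_ ?_) ?_)
  · rw [a3 _ (by omega) (by omega), a2 _ (by omega) (by omega) (by omega), a1 _ (by omega)]
  · rw [a3 _ (by omega) (by omega), a2 _ (by omega) (by omega) (by omega), a1 _ (by omega)]
  · have := hg.bound h hp
    omega
  · intro σ i hi h30 hi1
    exact ⟨by simp [h30]; omega, by simp [h30], by simp⟩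
  · intro x p hp
    rw [a3 _ (by omega) (by omega), m2 x p hp]
  · intro j
    rw [a3 _ (by omega) (by omega)]
    exact m2' j
  · intro j
    rw [a3 _ (by omega) (by omega), a2 _ (by omega) (by omega) (by omega), a1 _ (by omega),
      h0 _ (by omega)]
  rintro σ4 t4 ⟨ht4, r4, v4, a4⟩
  have hcfg4 := hcfg3.of_eq v4
  refine HT.seq (HT.asg hw (by simp) ?_)
  refine HT.mono (HT.forUp hw (b := M) (a := 0) (B := 15 * M) (fun m B σ' => B = 15 * (M - m) ∧
    (∀ p < m, σ'.a 1 p = p * M) ∧ σ'.v 1 = M ∧ ∀ D, D ≠ 1 → σ'.a D = σ4.a D)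
    ?_ (by omega) (by omega) ⟨rfl, fun p hp => by omega, by simp [hcfg4.v1],
      fun D _ => by simp⟩ (by simp)) ?_
  · rintro m B σ5 ⟨rfl, q1, q2, q3⟩ h30 hmM
    refine ⟨by simp [q2]; omega, by simp [q2], fun hlt => ?_⟩
    have c1 : m * M + 0 < M * M := mul_add_lt hlt (by omega)
    refine HT.put hw (by simp [h30]; omega) (by simp [h30, q2]; omega)
      ⟨h30, _, ⟨rfl, ?_, by simp [q2], ?_⟩, by simp; omega⟩
    · intro p hp
      by_cases e : p = m
      · simp [e, h30, q2]
      · simp [e, h30, q1 p (by omega)]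
    · intro D hD
      rw [← q3 D hD]
      funext j
      simp [hD]
  rintro σ5 t5 ⟨-, B', ⟨-, q1, -, q3⟩, ht5⟩
  refine ⟨?_, fun p hp hpn => ⟨q1 p (by omega), ?_, ?_⟩⟩
  · simp only [Ex.cost_v, Ex.cost_ofNat] at ht5 ⊢
    omega
  · have e := h.leftEnds_eq hp (fun i => p ∈ u i ∧ p ∉ g (i - 1)) (fun a => by
      simp only [hu', hg.mem, show 0 < p from hp, show 1 ≤ p from hp, true_and]) n
    have := r3 p
    simp only [e] at this
    rw [q3 2 (by omega), q3 3 (by omega), a4 2 (by omega) (by omega), a4 3 (by omega) (by omega)]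
    exact this
  · have e := h.rightEnds_eq hp (fun i => p ∈ g i ∧ p ∉ u (i + 1)) (fun a => by
      simp only [hu', hg.mem, show 0 < p from hp, show 1 ≤ p from hp, true_and]) n
    have := r4 p
    simp only [e] at this
    rw [q3 4 (by omega)]
    exact this.2

end finish

end WordRAM

/-! ### The two families of codes -/

theorem IsEncoding.factorRel_succ_iff {α : Type*} {r : List α → List α → Prop} {E : List α → ℤ}
    (hE : IsEncoding r E) (T : List α) {L x y : ℕ} (hx : 1 ≤ x) (hxL : x + L ≤ T.length)
    (hy : 1 ≤ y) (hyL : y + L ≤ T.length) :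
    factorRel r T (L + 1) x y ↔
      factorRel r T L x y ∧ E (factor T x (x + L)) = E (factor T y (y + L)) := by
  have key : ∀ m, m ≤ L + 1 → (factorRel r T m x y ↔ ∀ i, 1 ≤ i → i ≤ m →
      E (factor T x (x + i - 1)) = E (factor T y (y + i - 1))) := by
    intro m hm
    unfold factorRel
    rw [hE]
    have h1 := length_factor T (i := x) (j := x + m - 1) (by omega)
    have h2 := length_factor T (i := y) (j := y + m - 1) (by omega)
    have h3 : ∀ z i, 1 ≤ z → 1 ≤ i → i ≤ m →
        factor (factor T z (z + m - 1)) 1 i = factor T z (z + i - 1) := fun z i hz _ hi => by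
      rw [factor_factor T hz le_rfl (by omega), Nat.add_sub_cancel]
    constructor
    · rintro ⟨-, -, -, -, -, h⟩ i hi him
      have := h i hi (by omega)
      rwa [h3 x i hx hi him, h3 y i hy hi him] at this
    · intro h
      refine ⟨hx, by omega, hy, by omega, by omega, fun i hi him => ?_⟩
      rw [h3 x i hx hi (by omega), h3 y i hy hi (by omega)]
      exact h i hi (by omega)
  rw [key _ le_rfl, key L (by omega)]
  constructor
  · intro h
    refine ⟨fun i h1 h2 => h i h1 (by omega), ?_⟩
    have := h (L + 1) (by omega) le_rfl
    rwa [show x + (L + 1) - 1 = x + L by omega, show y + (L + 1) - 1 = y + L by omega] at this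
  · rintro ⟨h1, h2⟩ i h3 h4
    by_cases e : i = L + 1
    · rwa [e, show x + (L + 1) - 1 = x + L by omega, show y + (L + 1) - 1 = y + L by omega]
    · exact h1 i h3 (by omega)

/-- In the reversed string, the representative of a factor can serve as its code: it determines the
factor up to equivalence. -/
theorem LevelSystem.codeFn_rev {n C : ℕ} {rel : ℕ → ℕ → ℕ → Prop} (h : LevelSystem n rel)
    (hC : n < C) : CodeFn n C (revRel n rel) fun x L => rp rel L (n + 2 - L - x) where
  lt := by
    intro x L h1 h2 h3
    have := h.rp_le L (n + 2 - L - x)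
    omega
  iff := by
    intro L x y h1 h2 h3 h4
    rw [h.rp_eq_iff]
    constructor
    · intro hr
      exact ⟨h.rev.mono hr, Or.inr hr.2.2.2.2⟩
    · rintro ⟨-, e | hr⟩
      · obtain rfl : x = y := by omega
        exact h.rev.refl h1 (by omega)
      · exact ⟨h1, by omega, h3, by omega, hr⟩

namespace WordRAM

theorem Ready.fits {w W : ℕ} {pre query : Prog} {T : List ℕ} (hW : w ≤ W)
    (hT : T.length < 2 ^ W) {s : Store} (h : Ready w pre query T s) : ∀ x, Fits W (s.reg x) := by
  induction h with
  | preprocessed t s h =>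
    refine h.fits hW fun x => ?_
    simp only [input]
    split_ifs
    · exact Ex.fits_natCast hT
    · exact Ex.fits_natCast (by positivity)
  | queried s s' t i j hs hi hij hj h ih =>
    refine h.fits hW fun x => ?_
    simp only [ask, Store.setReg_reg]
    split_ifs
    · exact Ex.fits_natCast (by omega)
    · exact Ex.fits_natCast (by omega)
    · exact ih x

section queries

variable {w n M C K : ℕ}

/-- The code of `T[x .. x + L)`, shifted to a natural number. -/
def factorCode (E : List ℕ → ℤ) (T : List ℕ) (W x L : ℕ) : ℕ :=
  (E (factor T x (x + L - 1)) + 2 ^ W).toNat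

/-- Runs `query` on the embedded store, for the factor of length `L` at `x` with `x` and `L` in the
variables `10` and `11`. -/
def forwardQuery (query : Prog) : Prog :=
  .seq (setExt 1 (.v 10)) (.seq (setExt 2 (.v 10 + .v 11 - 1)) (.seq (onExt query) (getExt 12 0 4)))

/-- The condition under which `forwardQuery` can run. -/
def ForwardReady (w W : ℕ) (pre query : Prog) (T : List ℕ) (M C K : ℕ) (σ : St) : Prop :=
  Ready w pre query T σ.x ∧ Cfg T.length M C K σ ∧ σ.v 4 = 2 ^ W

/-- What the given programs guarantee for the string `T`. -/
structure Oracle (w W : ℕ) (E : List ℕ → ℤ) (π ρ : ℕ) (pre query : Prog) (T : List ℕ) : Prop where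
  run_pre : ∃ t s, Exec w pre (input T) t s ∧ t ≤ π
  run_query : ∀ s, Ready w pre query T s → ∀ i j, 1 ≤ i → i ≤ j → j ≤ T.length →
    ∃ t s', Exec w query (ask s i j) t s' ∧ t ≤ ρ ∧ s'.reg 0 = E (factor T i j)
  le : w ≤ W
  lt : T.length < 2 ^ W

theorem Oracle.fits {w W π ρ : ℕ} {E : List ℕ → ℤ} {pre query : Prog} {T : List ℕ}
    (hO : Oracle w W E π ρ pre query T) {i j : ℕ} (hi : 1 ≤ i) (hij : i ≤ j) (hj : j ≤ T.length) :
    Fits W (E (factor T i j)) := by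
  obtain ⟨t, s, h, -⟩ := hO.run_pre
  obtain ⟨t', s', h', -, he⟩ := hO.run_query s (.preprocessed t s h) i j hi hij hj
  rw [← he]
  exact (Ready.queried s s' t' i j (.preprocessed t s h) hi hij hj h').fits hO.le hO.lt 0

theorem Oracle.codeFn {w W π ρ : ℕ} {r : List ℕ → List ℕ → Prop} {E : List ℕ → ℤ}
    {pre query : Prog} {T : List ℕ} (hO : Oracle w W E π ρ pre query T) (hE : IsEncoding r E) :
    CodeFn T.length (2 ^ W + 2 ^ W) (factorRel r T) (factorCode E T W) where
  lt := by
    intro x L h1 h2 h3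
    have h4 := hO.fits h1 (j := x + L - 1) (by omega) (by omega)
    have h5 : ((2 ^ W : ℕ) : ℤ) = 2 ^ W := by push_cast; rfl
    unfold Fits at h4
    unfold factorCode
    rw [← h5] at h4 ⊢
    generalize 2 ^ W = N at *
    omega
  iff := by
    intro L x y h1 h2 h3 h4
    rw [hE.factorRel_succ_iff T h1 h2 h3 h4]
    refine and_congr_right fun _ => ?_
    have h5 := (hO.fits h1 (j := x + L) (by omega) (by omega)).1
    have h6 := (hO.fits h3 (j := y + L) (by omega) (by omega)).1
    unfold factorCode
    rw [show x + (L + 1) - 1 = x + L by omega, show y + (L + 1) - 1 = y + L by omega]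
    omega

theorem forwardQuery_spec {wk W π ρ : ℕ} {E : List ℕ → ℤ} {pre query : Prog} {T : List ℕ}
    (hO : Oracle wk W E π ρ pre query T) (hEnv : Env w T.length M (2 ^ W + 2 ^ W) K) (hwk : wk ≤ w)
    (lo hi : ℕ) :
    Query w T.length (factorCode E T W) (ρ + 10) (forwardQuery query)
      (ForwardReady wk W pre query T M (2 ^ W + 2 ^ W) K) lo hi where
  run := by
    rintro σ x L ⟨h1, h2, h3⟩ h10 h11 hx hL hxL
    have hw := hEnv.hw
    have hM := hEnv.hM
    have b1 := hEnv.sq_lt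
    have b2 := hEnv.le_sq
    have b3 := hEnv.hbig
    have b4 : 1 * (2 ^ W + 2 ^ W) ≤ M * M * (2 ^ W + 2 ^ W) :=
      Nat.mul_le_mul_right _ (by have := hEnv.four_le_sq; omega)
    obtain ⟨t, s', h4, h5, h6⟩ := hO.run_query σ.x h1 x (x + L - 1) hx (by omega) (by omega)
    have h7 := hO.fits hx (j := x + L - 1) (by omega) (by omega)
    have h8 : ((2 ^ W : ℕ) : ℤ) = 2 ^ W := by push_cast; rfl
    refine HT.seq (HT.setExt hw (by simp [h10]; omega) ?_)
    refine HT.seq (HT.setExt hw (by simp [h10, h11]; omega) ?_)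
    refine HT.seq (HT.onExt (t := t) (x' := s') ?_ ?_)
    · have : ask σ.x x (x + L - 1) = (St.setX (St.setX σ (σ.x.setReg 1 (Ex.eval σ (.v 10) : ℤ)))
          ((St.setX σ (σ.x.setReg 1 (Ex.eval σ (.v 10) : ℤ))).x.setReg 2
            (Ex.eval (St.setX σ (σ.x.setReg 1 (Ex.eval σ (.v 10) : ℤ)))
              (.v 10 + .v 11 - 1) : ℤ))).x := by
        simp [ask, h10, h11]
      rw [← this]
      exact h4.mono hwk
    · refine HT.getExt (r := factorCode E T W x L) ?_ ?_ ⟨?_, ⟨?_, h2.of_eq fun j hj => ?_, ?_⟩,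
        by simp, fun i hi => ?_, rfl⟩
      · unfold Fits at h7
        simp only [St.setX_x, St.setX_v, h6, h3, factorCode]
        omega
      · unfold Fits at h7
        unfold factorCode
        rw [← h8] at h7 ⊢
        generalize 2 ^ W = N at *
        omega
      · simp; omega
      · exact .queried _ _ _ _ _ h1 hx (by omega) (by omega) h4
      · simp [show j ≠ 12 by omega]
      · simp [h3]
      · simp [show i ≠ 12 by omega]
  stable := by
    rintro σ σ' ⟨h1, h2, h3⟩ e1 e2 -
    exact ⟨by rwa [e1], h2.of_eq e2, by rw [e2 4 (by omega), h3]⟩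

/-- Computes the representative of a factor of the reversed string, by climbing in the forest of the
string, which is in the arrays from `6` on. -/
def reverseQuery : Prog :=
  .seq (asg 21 (.v 11)) (.seq (asg 20 (.v 0 + 2 - (.v 11 + .v 10)))
  (.seq (climb 6) (asg 12 (.v 20))))

theorem reverseQuery_spec {rel : ℕ → ℕ → ℕ → Prop} (hEnv : Env w n M C K) (h : LevelSystem n rel) :
    Query w n (fun x L => rp rel L (n + 2 - L - x)) (30 * K + 50) reverseQuery
      (fun σ => Cfg n M C K σ ∧ TreeData rel M K 6 n σ) 16 26 where
  run := by
    rintro σ x L ⟨h1, h2⟩ h10 h11 hx hL hxL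
    have hw := hEnv.hw
    have hM := hEnv.hM
    have b1 := hEnv.sq_lt
    have b2 := hEnv.le_sq
    have b3 := hEnv.four_le_sq
    refine HT.seq (HT.asg hw (by simp [h11]; omega) ?_)
    refine HT.seq (HT.asg hw (by simp [h10, h11, h1.v0]; omega) ?_)
    refine HT.seq (HT.mono (climb_spec hEnv h (o := 6) (m := n) (x := n + 2 - L - x) (L := L)
      (h1.of_eq fun j hj => ?_) (h2.of_eq rfl rfl) le_rfl ?_ (by omega) (by simp [h11])
      (by omega)) ?_)
    · simp [show j ≠ 20 by omega, show j ≠ 21 by omega]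
    · simp [h10, h11, h1.v0]; omega
    rintro σ1 t ⟨ht, k1, k2, k3, k4⟩
    have hle := h.rp_le L (n + 2 - L - x)
    refine HT.asg hw (by simp [k1]; omega) ⟨?_, ⟨h1.of_eq fun j hj => ?_, h2.of_eq ?_ ?_⟩, ?_, ?_, ?_⟩
    · simp; omega
    · rw [St.setV_v, if_neg (by omega), k2 j (by omega) (by omega)]
      simp [show j ≠ 20 by omega, show j ≠ 21 by omega]
    · rw [St.setV_a, k3]; rfl
    · rw [St.setV_a, k3]; rfl
    · simp [k1]
    · intro j hj
      rw [St.setV_v, if_neg (by omega), k2 j (by omega) (by omega)]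
      simp [show j ≠ 20 by omega, show j ≠ 21 by omega]
    · rw [St.setV_a, k3]; rfl
  stable := by
    rintro σ σ' ⟨h1, h2⟩ - e1 e2
    exact ⟨h1.of_eq e1, h2.of_eq (e2 _ (by omega)) (e2 _ (by omega))⟩

end queries

end WordRAM

/-! ### The algorithm -/

namespace WordRAM

/-- The structured memory that represents the input. -/
def inputSt (T : List ℕ) : St where
  v := fun i => if i = 0 then T.length else 0
  a := fun A j => if A = 0 ∧ 1 ≤ j then T.getD (j - 1) 0 else 0
  x := { reg := fun _ => 0, arr := fun _ _ => 0 }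

theorem rep_inputSt (T : List ℕ) : Rep (inputSt T) (input T) where
  var := by
    intro i
    simp only [input, inputSt]
    by_cases h : i = 0
    · simp [h]
    · simp [h]
  ext := by
    intro i
    simp only [input, inputSt]
    rw [if_neg (by omega)]
  arr := by
    intro A j
    simp only [input, inputSt]
    have : ownArr A = 0 ↔ A = 0 := ownArr_inj (B := 0)
    simp only [this]
    split_ifs <;> simp
  earr := by
    intro A j
    simp only [input, inputSt]
    rw [if_neg]
    rintro ⟨h, -⟩
    exact ownArr_ne_extArr 0 A h.symm

/-- Computes the parameters: `n + 1`, the number of bits of `n`, an offset that makes all codes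
nonnegative, and a bound on the codes. -/
def computeParams (k : ℕ) : Prog :=
  .seq (asg 1 (.v 0 + 1)) (.seq (asg 3 1) (.seq (asg 5 2)
  (.seq (whl (.lt (.v 5) (.v 1)) (.seq (asg 3 (.v 3 + 1)) (asg 5 (.v 5 + .v 5))))
  (.seq (asg 4 (.shl 1 (.c (k + 1) * .v 3))) (asg 2 (.v 4 + .v 4))))))

/-- Copies the input to the embedded store. -/
def copyInput : Prog :=
  .seq (setExt 0 (.v 0)) (.seq (asg 30 1) (forUp 30 (.v 1) (putExt 0 (.v 30) (.rd 0 (.v 30)))))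

/-- The whole algorithm for a nonempty string. -/
def squaresProgNonempty (k : ℕ) (pre query : Prog) : Prog :=
  .seq (computeParams k) (.seq copyInput (.seq (onExt pre)
  (.seq (buildForest 6 (forwardQuery query)) (.seq (collectPairs 6)
  (.seq (buildForest 16 reverseQuery) (.seq (collectPairs 16) emitIntervals))))))

/-- The whole algorithm. -/
def squaresProg (k : ℕ) (pre query : Prog) : Prog :=
  ite (.v 0) (squaresProgNonempty k pre query) .skip

section main

variable {w : ℕ}

theorem computeParams_spec {k n K : ℕ} {σ : St} (hn : 1 ≤ n) (hK : K = Nat.log 2 n + 1)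
    (hw : (k + 6) * K ≤ w) (h0 : σ.v 0 = n) :
    HT w (computeParams k) σ fun σ' t => t ≤ 20 * K + 40 ∧
      Cfg n (n + 1) (2 ^ ((k + 1) * K) + 2 ^ ((k + 1) * K)) K σ' ∧ σ'.v 4 = 2 ^ ((k + 1) * K) ∧
      σ'.a = σ.a ∧ σ'.x = σ.x := by
  have hlt : n < 2 ^ K := by rw [hK]; exact Nat.lt_pow_succ_log_self (by norm_num) n
  have hw6 : 6 * K ≤ w := le_trans (Nat.mul_le_mul_right K (by omega)) hw
  have hw1 : 1 ≤ w := by omega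
  have p0 : 2 ^ (K + 3) ≤ 2 ^ w := Nat.pow_le_pow_right (by norm_num) (by omega)
  rw [pow_add] at p0
  have p1 : 2 ^ ((k + 1) * K + 2) ≤ 2 ^ w := by
    refine Nat.pow_le_pow_right (by norm_num) (le_trans ?_ hw)
    have : (k + 6) * K = (k + 1) * K + 5 * K := by ring
    omega
  rw [pow_add] at p1
  have p2 : (k + 1) * K < 2 ^ ((k + 1) * K) := Nat.lt_two_pow_self
  have p5 : K < 2 ^ K := Nat.lt_two_pow_self
  have p3 : (k + 1) * 1 ≤ (k + 1) * K := Nat.mul_le_mul_left _ (by omega)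
  refine HT.seq (HT.asg hw1 (by simp [h0]; omega) ?_)
  refine HT.seq (HT.asg hw1 (by simp; omega) ?_)
  refine HT.seq (HT.asg hw1 (by simp; omega) ?_)
  refine HT.seq (HT.mono (HT.whl hw1 (I := fun B σ' => ∃ j, 1 ≤ j ∧ j ≤ K ∧ B = 20 * (K - j) + 10 ∧
    σ'.v 3 = j ∧ σ'.v 5 = 2 ^ j ∧ σ'.v 1 = n + 1 ∧ σ'.v 0 = n ∧ σ'.a = σ.a ∧ σ'.x = σ.x)
    (B := 20 * (K - 1) + 10) ?_
    ⟨1, le_rfl, by omega, rfl, by simp, by simp, by simp [h0], by simp [h0], rfl, rfl⟩) ?_)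
  · rintro B σ1 ⟨j, h1, h2, rfl, h3, h5, g1, g0, ga, gx⟩
    have p4 : 2 ^ j ≤ 2 ^ K := Nat.pow_le_pow_right (by norm_num) h2
    refine ⟨by simp [h5, g1]; omega, by simp, fun hne => ?_⟩
    simp [h5, g1] at hne
    have hjK : j < K := by
      by_contra hc
      have : j = K := by omega
      subst this
      omega
    refine HT.seq (HT.asg hw1 (by simp [h3]; omega) ?_)
    refine HT.asg hw1 (by simp [h5]; omega) ⟨_, ⟨j + 1, by omega, by omega, rfl, by simp [h3],
      ?_, by simp [g1], by simp [g0], ga, gx⟩, ?_⟩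
    · simp [h5, pow_succ]; omega
    · simp; omega
  rintro σ1 t1 ⟨B', ⟨j, h1, h2, rfl, h3, h5, g1, g0, ga, gx⟩, hz, ht1⟩
  simp [h5, g1] at hz
  have hj : j = K := by
    have : Nat.log 2 n < j := Nat.log_lt_of_lt_pow (by omega) hz
    omega
  subst hj
  refine HT.seq (HT.asg hw1 (by simp [h3]; omega) ?_)
  refine HT.asg hw1 (by simp [h3]; omega) ⟨?_, ⟨by simp [g0], by simp [g1], by simp [h3],
    by simp [h3]⟩, by simp [h3], ga, gx⟩
  simp at ht1 ⊢
  omega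

theorem copyInput_spec {n M C K : ℕ} (hE : Env w n M C K) {T : List ℕ} (hT : T.length = n)
    (hTw : ∀ a ∈ T, a < 2 ^ w) {σ : St} (hcfg : Cfg n M C K σ) (ha : σ.a = (inputSt T).a)
    (hx : σ.x = (inputSt T).x) :
    HT w copyInput σ fun σ' t => t ≤ 20 * n + 20 ∧ σ'.x = input T ∧ σ'.a = σ.a ∧
      ∀ j < 10, σ'.v j = σ.v j := by
  have hw := hE.hw
  have hM := hE.hM
  have hn := hE.hn
  have b1 := hE.sq_lt
  have b2 := hE.le_sq
  have hget : ∀ j, T.getD j 0 < 2 ^ w := by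
    intro j
    by_cases h : j < T.length
    · rw [List.getD_eq_getElem _ _ h]
      exact hTw _ (List.getElem_mem h)
    · rw [List.getD_eq_default _ _ (by omega)]
      positivity
  refine HT.seq (HT.setExt hw (by simp [hcfg.v0]; omega) ?_)
  refine HT.seq (HT.asg hw (by simp; omega) ?_)
  refine HT.mono (HT.forUp hw (b := M) (a := 1) (B := 15 * n) (fun m B σ' => B = 15 * (M - m) ∧
    1 ≤ m ∧ σ'.x.reg = (input T).reg ∧
    (∀ A j, σ'.x.arr A j = if j < m then (input T).arr A j else 0) ∧ σ'.a = σ.a ∧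
    ∀ j < 10, σ'.v j = σ.v j) ?_ (by omega) (by omega) ⟨by omega, le_rfl, ?_, ?_, rfl, ?_⟩ ?_) ?_
  · rintro m B σ1 ⟨rfl, g0, g1, g2, g3, g4⟩ h30 hmM
    have v1 := (g4 1 (by omega)).trans hcfg.v1
    refine ⟨by simp [v1]; omega, by simp [v1], fun hlt => ?_⟩
    have e0 : σ1.a 0 m = T.getD (m - 1) 0 := by
      rw [g3, ha]; simp only [inputSt]; rw [if_pos ⟨trivial, g0⟩]
    refine HT.putExt hw (by simp [h30]; omega)
      (by simp only [Ex.safe_rd, Ex.safe_v, Ex.eval_v, h30, e0]; exact ⟨by omega, hget _⟩)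
      ⟨h30, _, ⟨rfl, by omega, g1, ?_, g3, ?_⟩, by simp; omega⟩
    · intro A j
      simp only [St.setV_x, St.setX_x, Store.setArr_arr, Ex.eval_v, Ex.eval_rd, h30, e0, g2]
      by_cases e : A = 0 ∧ j = m
      · obtain ⟨rfl, rfl⟩ := e
        rw [if_pos ⟨rfl, rfl⟩, if_pos (by omega)]
        simp only [input]
        rw [if_pos ⟨trivial, g0⟩]
      · rw [if_neg e]
        by_cases hj : j = m
        · have hA : A ≠ 0 := fun h => e ⟨h, hj⟩
          simp [input, hA]
        · have : j < m ↔ j < m + 1 := by omega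
          simp only [this]
    · intro j hj
      simp [show j ≠ 30 by omega, g4 j hj]
  · simp only [St.setV_x, St.setX_x, hx, Ex.eval_v, hcfg.v0, Store.setReg, inputSt, input, hT]
    funext j
    simp [Function.update_apply]
  · intro A j
    have : σ.x.arr A j = 0 := by rw [hx]; rfl
    simp only [St.setV_x, St.setX_x, Store.setReg, this]
    split_ifs with h
    · simp [input, show j = 0 by omega]
    · rfl
  · intro j hj
    simp [show j ≠ 30 by omega]
  · simp
  · rintro σ1 t ⟨-, B', ⟨-, -, g1, g2, g3, g4⟩, ht⟩
    refine ⟨by simp at ht ⊢; omega, ?_, g3, g4⟩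
    have e : σ1.x.arr = (input T).arr := by
      funext A j
      rw [g2]
      split_ifs with h
      · rfl
      · simp only [input]
        split_ifs
        · rw [List.getD_eq_default _ _ (by omega)]; rfl
        · rfl
    cases hs : σ1.x with
    | mk r a =>
      rw [hs] at g1 e
      simp only at g1 e
      rw [g1, e]

theorem squaresProgNonempty_spec {r : List ℕ → List ℕ → Prop} (hr : IsSCER r) {E : List ℕ → ℤ}
    (hEn : IsEncoding r E) {T : List ℕ} {n K k wk π ρ : ℕ} {pre query : Prog} (hT : T.length = n)
    (hn : 1 ≤ n) (hK : K = Nat.log 2 n + 1) (hw : (k + 6) * K ≤ w) (hwk : wk ≤ w)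
    (hTw : ∀ a ∈ T, a < 2 ^ w) (hO : Oracle wk ((k + 1) * K) E π ρ pre query T) :
    HT w (squaresProgNonempty k pre query) (inputSt T) fun σ' t =>
      t ≤ π + (n + 1) * (6 * ρ + 400 * K + 2500) + 920 * (n * Nat.log 2 n) ∧
      ∀ p, 1 ≤ p → p ≤ n → σ'.a 1 p = p * (n + 1) ∧
        (σ'.a 2 p = (leftEnds (Squares r T p) n).length ∧
          ∀ (m : ℕ) (hm : m < (leftEnds (Squares r T p) n).length),
            σ'.a 3 (p * (n + 1) + m) = (leftEnds (Squares r T p) n)[m]) ∧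
        ∀ (m : ℕ) (hm : m < (rightEnds (Squares r T p) n).length),
            σ'.a 4 (p * (n + 1) + m) = (rightEnds (Squares r T p) n)[m] := by
  have hlt : n < 2 ^ K := by rw [hK]; exact Nat.lt_pow_succ_log_self (by norm_num) n
  have hKn : K ≤ n := by
    rw [hK]
    exact Nat.log_lt_self 2 (by omega)
  have hEnv : Env w n (n + 1) (2 ^ ((k + 1) * K) + 2 ^ ((k + 1) * K)) K := by
    have p1 : 2 ^ K ≤ 2 ^ ((k + 1) * K) :=
      Nat.pow_le_pow_right (by norm_num) (Nat.le_mul_of_pos_left K (by omega))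
    have hw6 : 6 * K ≤ w := le_trans (Nat.mul_le_mul_right K (by omega)) hw
    refine ⟨by omega, hn, rfl, by omega, hKn, hlt, by omega, ?_⟩
    have p2 : (n + 1) * (n + 1) ≤ 2 ^ K * 2 ^ K := Nat.mul_le_mul hlt hlt
    calc 4 * ((n + 1) * (n + 1) * (2 ^ ((k + 1) * K) + 2 ^ ((k + 1) * K)))
        ≤ 4 * (2 ^ K * 2 ^ K * (2 ^ ((k + 1) * K) + 2 ^ ((k + 1) * K))) := by gcongr
      _ = 2 ^ (3 + (K + K + (k + 1) * K)) := by rw [pow_add, pow_add, pow_add]; ring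
      _ ≤ 2 ^ w := by
        refine Nat.pow_le_pow_right (by norm_num) (le_trans ?_ hw)
        have : (k + 6) * K = (k + 1) * K + 5 * K := by ring
        omega
  have h := hr.levelSystem T
  have hcode := hO.codeFn hEn
  rw [hT] at h hcode
  obtain ⟨tp, sp, hpre, htp⟩ := hO.run_pre
  refine HT.seq (HT.mono (computeParams_spec hn hK hw (by simp [inputSt, hT])) ?_)
  rintro σ1 t1 ⟨ht1, hcfg1, h4, a1, x1⟩
  refine HT.seq (HT.mono (copyInput_spec hEnv hT hTw hcfg1 a1 x1) ?_)
  rintro σ2 t2 ⟨ht2, x2, a2, v2⟩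
  have hcfg2 := hcfg1.of_eq v2
  refine HT.seq (HT.onExt (t := tp) (x' := sp) (by rw [x2]; exact hpre.mono hwk) ?_)
  have zero : ∀ A, A ≠ 0 → ∀ j, (σ2.setX sp).a A j = 0 := by
    intro A hA j
    rw [St.setX_a, a2, a1]
    simp [inputSt, hA]
  have hready : ForwardReady wk ((k + 1) * K) pre query T (n + 1)
      (2 ^ ((k + 1) * K) + 2 ^ ((k + 1) * K)) K (σ2.setX sp) :=
    ⟨.preprocessed _ _ hpre, by rw [hT]; exact hcfg2.of_eq fun _ _ => rfl, by rw [St.setX_v, v2 4 (by omega), h4]⟩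
  have hQ := forwardQuery_spec hO (w := w) (M := n + 1) (K := K) (by rw [hT]; exact hEnv) hwk 6 16
  rw [hT] at hQ
  have hcfg2' : Cfg n (n + 1) (2 ^ ((k + 1) * K) + 2 ^ ((k + 1) * K)) K (σ2.setX sp) :=
    hcfg2.of_eq fun _ _ => rfl
  generalize σ2.setX sp = σ3 at zero hready hcfg2'
  refine HT.seq (HT.mono (buildForest_spec hEnv h hcode hQ hcfg2' hready
    fun A _ _ => zero A (by omega)) ?_)
  rintro σ4 t4 ⟨ht4, -, hT4, v4, a4⟩
  have hcfg4 := hcfg2'.of_eq v4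
  refine HT.seq (HT.mono (collectPairs_spec hEnv h hcfg4 hT4 fun A _ _ j => ?_) ?_)
  · rw [a4 A (by omega), zero A (by omega)]
  rintro σ5 t5 ⟨ht5, ⟨g, hg, hgr⟩, v5, -, a5⟩
  have hcfg5 := hcfg4.of_eq v5
  have hT5 : TreeData (factorRel r T) (n + 1) K 6 n σ5 :=
    hT4.of_eq (a5 _ (by omega)) (a5 _ (by omega))
  have hQ' := reverseQuery_spec hEnv h
  refine HT.seq (HT.mono (buildForest_spec hEnv h.rev (h.codeFn_rev (by have := hEnv.hC; omega)) hQ'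
    hcfg5 ⟨hcfg5, hT5⟩ fun A _ _ j => ?_) ?_)
  · rw [a5 A (by omega), a4 A (by omega), zero A (by omega)]
  rintro σ6 t6 ⟨ht6, -, hT6, v6, a6⟩
  have hcfg6 := hcfg5.of_eq v6
  refine HT.seq (HT.mono (collectPairs_spec hEnv h.rev hcfg6 hT6 fun A _ _ j => ?_) ?_)
  · rw [a6 A (by omega), a5 A (by omega), a4 A (by omega), zero A (by omega)]
  rintro σ7 t7 ⟨ht7, ⟨g', hg', hgr'⟩, v7, -, a7⟩
  refine HT.mono (emitIntervals_spec hEnv h (hcfg6.of_eq v7) hg ?_ hg' hgr' ?_) ?_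
  · exact (hgr.of_eq (a6 _ (by omega)) (a6 _ (by omega))).of_eq (a7 _ (by omega)) (a7 _ (by omega))
  · intro A hA j
    rw [a7 A (by omega), a6 A (by omega), a5 A (by omega), a4 A (by omega), zero A (by omega)]
  rintro σ8 t8 ⟨ht8, hres⟩
  refine ⟨?_, fun p hp hpn => ?_⟩
  · have e1 : (n + 1) * (6 * (ρ + 10) + 70 * K + 400) + (n + 1) * (6 * (30 * K + 50) + 70 * K + 400) +
        ((n + 1) * (80 * K) + (n + 1) * 1340) =
        (n + 1) * (6 * ρ + 400 * K + 2500) := by ring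
    have e2 : K ≤ (n + 1) * (80 * K) := by
      calc K ≤ 80 * K := by omega
        _ ≤ (n + 1) * (80 * K) := Nat.le_mul_of_pos_left _ (by omega)
    omega
  · have e : {x | factorRel r T p x (x + p)} = Squares r T p := by
      ext x
      exact (mem_squares_iff hr T hp).symm
    have := hres p hp hpn
    rwa [e] at this

end main

end WordRAM

theorem squares_bounds {α : Type*} {r : List α → List α → Prop} {T : List α} {p x : ℕ}
    (hp : 1 ≤ p) (hx : x ∈ Squares r T p) : 1 ≤ x ∧ x ≤ T.length := by
  have h1 := hx.1
  have h2 := hx.2.1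
  omega

theorem mainTheorem5 :
    ∃ C : ℝ,
      -- the interval representations have total size at most `C n log n`
      (∀ (α : Type*) (r : List α → List α → Prop), IsSCER r →
        ∀ (T : List α) (R : ℕ → List (ℕ × ℕ)),
          (∀ p ∈ Finset.Icc 1 (T.length / 2), IsIntervalRep (Squares r T p) (R p)) →
          ((∑ p ∈ Finset.Icc 1 (T.length / 2), (R p).length : ℕ) : ℝ) ≤
            C * (T.length * Real.log T.length)) ∧
      -- they can be computed in time `C (π(n) + n ρ(n) + n log n)`; the summand `1` matters only
      -- for `n ≤ 1`, where `n log n = 0`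
      (∀ (r : List ℕ → List ℕ → Prop), IsSCER r →
        ∀ (E : List ℕ → ℤ), IsEncoding r E →
        ∀ (c k : ℕ) (π ρ : ℕ → ℕ) (pre query : WordRAM.Prog),
          WordRAM.ComputesFactorCodes k c E π ρ pre query →
          ∃ (k' : ℕ) (alg : WordRAM.Prog),
            ∀ T : List ℕ, WordRAM.IntegerAlphabet c T →
              ∃ (t : ℕ) (s : WordRAM.Store),
                WordRAM.Exec (WordRAM.wordLength k' T.length) alg (WordRAM.input T) t s ∧
                (t : ℝ) ≤ C * (π T.length + T.length * ρ T.length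
                  + T.length * Real.log T.length + 1) ∧
                ∀ p ∈ Finset.Icc 1 (T.length / 2), ∃ L : List (ℕ × ℕ),
                  IsIntervalRep (Squares r T p) L ∧ WordRAM.StoredAt s p L) := by
  refine ⟨20000, ?_, ?_⟩
  · intro α r hr T R hR
    have h1 := hr.sum_length_le T R hR
    have h2 : ((∑ p ∈ Finset.Icc 1 (T.length / 2), (R p).length : ℕ) : ℝ) ≤
        2 * (T.length * Nat.log 2 T.length) := by exact_mod_cast h1
    have h3 := mul_le_mul_of_nonneg_left (natLog_le_two_mul_log T.length)
      (Nat.cast_nonneg (α := ℝ) T.length)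
    have h4 : (0 : ℝ) ≤ T.length * Nat.log 2 T.length := by positivity
    linarith
  · intro r hr E hE c k π ρ pre query hcomp
    refine ⟨k + c + 8, WordRAM.squaresProg k pre query, fun T hT => ?_⟩
    obtain ⟨n, hn⟩ : ∃ n, T.length = n := ⟨_, rfl⟩
    obtain ⟨K, hK⟩ : ∃ K, K = Nat.log 2 n + 1 := ⟨_, rfl⟩
    obtain ⟨w, hw⟩ : ∃ w, w = WordRAM.wordLength (k + c + 8) n := ⟨_, rfl⟩
    have hwK : w = (k + c + 8) * K := by rw [hw, hK]; rfl
    have hw1 : 1 ≤ w := by rw [hwK]; exact Nat.mul_pos (by omega) (by omega)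
    have hlt : n < 2 ^ K := by rw [hK]; exact Nat.lt_pow_succ_log_self (by norm_num) n
    have hnw : n < 2 ^ w := hlt.trans_le (Nat.pow_le_pow_right (by norm_num)
      (by rw [hwK]; exact Nat.le_mul_of_pos_left _ (by omega)))
    rw [hn, ← hw]
    have hlog : (0 : ℝ) ≤ n * Real.log n :=
      mul_nonneg (Nat.cast_nonneg _) (Real.log_natCast_nonneg n)
    rcases Nat.eq_zero_or_pos n with h0 | hpos
    · subst h0
      have := WordRAM.HT.ite (w := w) (σ := WordRAM.inputSt T) (e := .v 0)
        (P := WordRAM.squaresProgNonempty k pre query) (Q := .skip)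
        (R := fun _ t => t ≤ 3) hw1 (by simp [WordRAM.inputSt, hn])
        (fun h => by simp [WordRAM.inputSt, hn] at h)
        (fun _ => WordRAM.HT.skip (by simp))
      obtain ⟨t, s, -, h1, -, h2⟩ := this _ (WordRAM.rep_inputSt T)
      refine ⟨t, s, h1, ?_, by simp⟩
      have h3 : (t : ℝ) ≤ 3 := by exact_mod_cast h2
      have h4 : (0 : ℝ) ≤ π 0 := by positivity
      push_cast
      linarith
    · have hO : WordRAM.Oracle (WordRAM.wordLength k n) ((k + 1) * K) E (π n) (ρ n) pre query T := by
        obtain ⟨g1, g2⟩ := hcomp T hT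
        rw [hn] at g1 g2
        refine ⟨g1, by rw [hn]; exact g2, ?_, ?_⟩
        · rw [WordRAM.wordLength, ← hK]
          exact Nat.mul_le_mul_right K (by omega)
        · rw [hn]
          exact hlt.trans_le (Nat.pow_le_pow_right (by norm_num)
            (Nat.le_mul_of_pos_left _ (by omega)))
      -- A run takes at least one step, so the time for the queries is at least `n`.
      have hρ : 1 ≤ ρ n := by
        obtain ⟨t, s, g1, -⟩ := hO.run_pre
        obtain ⟨t', s', g2, g3, -⟩ := hO.run_query s (.preprocessed t s g1) 1 1 le_rfl le_rfl
          (by omega)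
        exact g2.one_le.trans g3
      have hTw : ∀ a ∈ T, a < 2 ^ w := by
        intro a ha
        have h1 := hT a ha
        rw [hn] at h1
        calc a ≤ n ^ c := h1
          _ ≤ (2 ^ K) ^ c := Nat.pow_le_pow_left hlt.le c
          _ = 2 ^ (c * K) := by rw [← pow_mul, mul_comm]
          _ < 2 ^ w := by
            refine Nat.pow_lt_pow_right (by norm_num) ?_
            rw [hwK]
            exact Nat.mul_lt_mul_of_pos_right (by omega) (by omega)
      have hmain := WordRAM.HT.ite (e := .v 0) (Q := .skip) (R := fun σ' t =>
          t ≤ 2 + (π n + (n + 1) * (6 * ρ n + 400 * K + 2500) + 920 * (n * Nat.log 2 n)) ∧ _) hw1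
        (by simp [WordRAM.inputSt, hn, hnw])
        (fun _ => WordRAM.HT.mono (WordRAM.squaresProgNonempty_spec (w := w) hr hE hn hpos hK
          (by rw [hwK]; exact Nat.mul_le_mul_right K (by omega))
          (by rw [hwK, WordRAM.wordLength, ← hK]; exact Nat.mul_le_mul_right K (by omega)) hTw hO)
          fun σ' t h => ⟨by have := h.1; simp only [WordRAM.Ex.cost_v]; omega, h.2⟩)
        (fun h => by simp [WordRAM.inputSt, hn] at h; omega)
      obtain ⟨t, s, σ, h1, h2, h3, h4⟩ := hmain _ (WordRAM.rep_inputSt T)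
      refine ⟨t, s, h1, ?_, fun p hp => ?_⟩
      · have h5 : t ≤ 2 + (π n + (n + 1) * (6 * ρ n + 400 * K + 2500) + 920 * (n * Nat.log 2 n)) := h3
        have h6 : (n + 1) * (6 * ρ n + 400 * K + 2500) ≤
            (2 * n) * (6 * ρ n + 400 * K + 2500) := Nat.mul_le_mul_right _ (by omega)
        have h7 : n * 1 ≤ n * ρ n := Nat.mul_le_mul_left n hρ
        have h8 : (2 * n) * (6 * ρ n + 400 * K + 2500) =
            12 * (n * ρ n) + 800 * (n * Nat.log 2 n) + 5800 * n := by rw [hK]; ring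
        have h9 : t ≤ 2 + π n + 6000 * (n * ρ n) + 2000 * (n * Nat.log 2 n) := by omega
        have h10 : (t : ℝ) ≤ 2 + π n + 6000 * (n * ρ n) + 2000 * (n * Nat.log 2 n) := by
          exact_mod_cast h9
        have h11 := mul_le_mul_of_nonneg_left (natLog_le_two_mul_log n)
          (Nat.cast_nonneg (α := ℝ) n)
        have h12 : (0 : ℝ) ≤ π n := by positivity
        have h13 : (0 : ℝ) ≤ n * ρ n := by positivity
        linarith
      · rw [Finset.mem_Icc] at hp
        obtain ⟨k1, ⟨k2, k3⟩, k4⟩ := h4 p hp.1 (by omega)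
        have hsq : ∀ x ∈ Squares r T p, 1 ≤ x ∧ x ≤ n := fun x hx => by
          rw [← hn]; exact squares_bounds hp.1 hx
        obtain ⟨hlen, hrep⟩ := isIntervalRep_zip hsq
        refine ⟨_, hrep, p * (n + 1), ?_, ?_, fun m hm => ?_⟩
        · rw [show s.arr 1 p = (σ.a 1 p : ℤ) from h2.arr 1 p, k1]
        · rw [show s.arr 2 p = (σ.a 2 p : ℤ) from h2.arr 2 p, k2, List.length_zip, hlen, min_self]
        · rw [List.length_zip] at hm
          rw [show s.arr 3 (p * (n + 1) + m) = (σ.a 3 _ : ℤ) from h2.arr 3 _,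
            show s.arr 4 (p * (n + 1) + m) = (σ.a 4 _ : ℤ) from h2.arr 4 _,
            k3 m (by omega), k4 m (by omega), List.getElem_zip]
          exact ⟨rfl, rfl⟩
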